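/- **Setting.** Let $\mathcal H$ be a real separable Hilbert space with orthonormal basis $(e_i)$, let $W=\{W(h):h\in\mathcal H\}$ be an isonormal Gaussian process over $\mathcal H$ on a probability space $(\Omega,\mathcal F,\mathbb P)$, that is, a centered jointly Gaussian family with $\mathbb E[W(h)W(g)]=\langle h,g\rangle_{\mathcal H}$. Let $I_n$ be the $n$-th multiple Wiener–Itô integral ($n\ge 1$) and $D$ the Malliavin derivative, i.e. the closure in $L^2(\Omega)\times L^2(\Omega;\mathcal H)$ of $\varphi(W(h_1),\dots,W(h_m))\mapsto\sum_i\partial_i\varphi(W(h_1),\dots,W(h_m))h_i$, where $\varphi$ is smooth and bounded with all its derivatives. Let $f_t\in\mathcal H^{\otimes n}$, $t\in[0,1]$, be symmetric kernels and let $X_t=I_n(f_t)$ be a process with almost surely continuous paths. For $0\le s\le t\le 1$ let $F_{s,t}\subset\mathcal H$ be the closed linear span of all contractions $\langle f_t-f_s,\,e_{i_1}\otimes\cdots\otimes e_{i_{n-1}}\rangle_{\mathcal H^{\otimes(n-1)}}$. **Regularity assumption.** $f_0=0$ and there are constants $C>0$, $\theta>1$ with $$0<\|f_t-f_s\|_{\mathcal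 H^{\otimes n}}\le C|t-s|^{\theta/2}\qquad(0\le s<t\le1).$$ **Block-form assumption.** There is a constant $\alpha\in(0,1)$ such that for all points $0\le t_0<t_1<\dots<t_m\le1$, all subdivisions $0=s_0<s_1<\dots<s_k=t_0$ of $[0,t_0]$, all points $t_m=r_0<r_1<\dots<r_l\le1$ (with $k=0$ or $l=0$ allowed), all reals $a_1,\dots,a_m$ and all $\xi_i\in F_{t_{i-1},t_i}$ such that $v=\sum_{i=1}^m a_i\xi_i\neq0$, $$\|v-Pv\|_{\mathcal H}^2>\alpha\,\|v\|_{\mathcal H}^2,$$ where $P$ is the orthogonal projection onto the closed linear span of $F_{s_0,s_1},\dots,F_{s_{k-1},s_k},F_{r_0,r_1},\dots,F_{r_{l-1},r_l}$. **Proposition.** Under these two assumptions let $\rho,\tau\ge 0$ satisfy $\rho<\theta/2$ and $\tau+\rho>1$, and let $\{g_t\}_{0\le t\le1}$ be a real process whose paths are almost surely $\tau$-Hölder continuous on $[0,1]$. Then every $X_t$ belongs to the domain of $D$, the process $\{DX_t\}_{0\le t\le 1}$ has a version whose paths are almost surely $r$-Hölder continuous for every $0\le r<\theta/2$, and for every version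 of $DX$ with almost surely continuous paths the following holds almost surely: the Young integrals $\int_0^t g_r\,dDX_r$ exist in $\mathcal H$ for all $t\in[0,1]$, their norms are bounded in $t$, and $$\Big\|\int_0^1 g_r\,dDX_r\Big\|_{\mathcal H}\ \ge\ \sqrt{\alpha}\;\sup_{t\in[0,1]}\Big\|\int_0^t g_r\,dDX_r\Big\|_{\mathcal H}.$$ -/

import Mathlib

open MeasureTheory ProbabilityTheory Set Filter Topology
open scoped NNReal ENNReal

namespace ChaosProcess

noncomputable section

/-- `W` is an isonormal Gaussian process over the real Hilbert space `H`: a centered (jointly)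
Gaussian family indexed by `H` with `E[W(h) W(g)] = ⟨h, g⟩`. -/
structure IsIsonormal {Ω H : Type*} [MeasurableSpace Ω]
    [NormedAddCommGroup H] [InnerProductSpace ℝ H]
    (W : H → Ω → ℝ) (P : Measure Ω) : Prop where
  gaussian : IsGaussianProcess W P
  centered : ∀ h, ∫ ω, W h ω ∂P = 0
  covariance : ∀ h g, ∫ ω, W h ω * W g ω ∂P = inner ℝ h g

/-- The Hilbert tensor power `H^{⊗ n}`, realised in coordinates with respect to an orthonormal
basis `(e_i)_{i ∈ ι}` of `H`: the family `a ∈ ℓ²(ι^n)` stands for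
`∑ a(i₁,…,iₙ) e_{i₁} ⊗ ⋯ ⊗ e_{iₙ}`, and the norm of `H^{⊗ n}` is the `ℓ²` norm. -/
abbrev TensorPow (ι : Type*) (n : ℕ) : Type _ := lp (fun _ : Fin n → ι => ℝ) 2

/-- `f` lies in the symmetric tensor power. -/
def IsSymmTensor {ι : Type*} {n : ℕ} (f : TensorPow ι n) : Prop :=
  ∀ (σ : Equiv.Perm (Fin n)) (i : Fin n → ι), f (i ∘ σ) = f i

open scoped Classical in
/-- The multiple integral of the symmetrization of `e_{i₁} ⊗ ⋯ ⊗ e_{iₙ}`: the product over the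
distinct indices `j` occurring in `(i₁,…,iₙ)` of `H_{k_j}(W(e_j))`, where `k_j` is the number of
occurrences of `j` and `H_k` is the `k`-th (probabilists') Hermite polynomial. -/
def basisIntegral {Ω H ι : Type*} [NormedAddCommGroup H] [InnerProductSpace ℝ H]
    (W : H → Ω → ℝ) (e : HilbertBasis ι ℝ H) {n : ℕ} (i : Fin n → ι) (ω : Ω) : ℝ :=
  ∏ j ∈ Finset.univ.image i,
    Polynomial.aeval (W (e j) ω)
      (Polynomial.hermite (Finset.univ.filter (fun q => i q = j)).card)

/-- `X = Iₙ(f)` (almost surely): `X` is the `L²(P)`-limit of the multiple integrals of the finite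
partial sums of the expansion of `f` in the basis tensors. -/
def IsMultipleIntegral {Ω H ι : Type*} [MeasurableSpace Ω]
    [NormedAddCommGroup H] [InnerProductSpace ℝ H]
    (W : H → Ω → ℝ) (P : Measure Ω) (e : HilbertBasis ι ℝ H) {n : ℕ}
    (f : TensorPow ι n) (X : Ω → ℝ) : Prop :=
  AEStronglyMeasurable X P ∧
    Tendsto
      (fun S : Finset (Fin n → ι) =>
        eLpNorm (fun ω => X ω - ∑ i ∈ S, f i * basisIntegral W e i ω) 2 P)
      atTop (𝓝 0)

/-- `F` is a cylindrical random variable `φ(W(h₁),…,W(h_m))`, with `φ` smooth and bounded together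
with all its derivatives, and `DF = ∑ ∂ᵢφ(W(h₁),…,W(h_m)) hᵢ`. -/
def IsCylindricalDeriv {Ω H : Type*} [NormedAddCommGroup H] [InnerProductSpace ℝ H]
    (W : H → Ω → ℝ) (F : Ω → ℝ) (DF : Ω → H) : Prop :=
  ∃ (m : ℕ) (h : Fin m → H) (φ : (Fin m → ℝ) → ℝ),
    ContDiff ℝ ((⊤ : ℕ∞) : WithTop ℕ∞) φ ∧
    (∀ q : ℕ, ∃ C : ℝ, ∀ x, ‖iteratedFDeriv ℝ q φ x‖ ≤ C) ∧
    (∀ ω, F ω = φ (fun i => W (h i) ω)) ∧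
    (∀ ω, DF ω = ∑ i, fderiv ℝ φ (fun i => W (h i) ω) (Pi.single i 1) • h i)

/-- `F ∈ 𝔻^{1,2}` with Malliavin derivative `DF`: the pair `(F, DF)` is a limit in
`L²(Ω) × L²(Ω; H)` of pairs given by cylindrical random variables. -/
def IsMalliavinDeriv {Ω H : Type*} [MeasurableSpace Ω]
    [NormedAddCommGroup H] [InnerProductSpace ℝ H]
    (W : H → Ω → ℝ) (P : Measure Ω) (F : Ω → ℝ) (DF : Ω → H) : Prop :=
  AEStronglyMeasurable F P ∧ AEStronglyMeasurable DF P ∧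
  ∃ (G : ℕ → Ω → ℝ) (DG : ℕ → Ω → H),
    (∀ k, IsCylindricalDeriv W (G k) (DG k)) ∧
    Tendsto (fun k => eLpNorm (fun ω => F ω - G k ω) 2 P) atTop (𝓝 0) ∧
    Tendsto (fun k => eLpNorm (fun ω => DF ω - DG k ω) 2 P) atTop (𝓝 0)

/-- The closed linear span in `H` of all contractions of `f` with the `(n-1)`-fold tensors of basis
vectors. In slot `a` the contraction is the vector `∑_j f(k₁,…,j,…,kₙ) e_j`, with `j` in place `a`;
for symmetric `f` all slots give the same vectors. -/
def contractionSpace {H ι : Type*} [NormedAddCommGroup H] [InnerProductSpace ℝ H]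
    (e : HilbertBasis ι ℝ H) {n : ℕ} (f : TensorPow ι n) : Submodule ℝ H :=
  open scoped Classical in
  (Submodule.span ℝ
    {ξ : H | ∃ (a : Fin n) (k : Fin n → ι),
      ξ = ∑' j : ι, f (Function.update k a j) • e j}).topologicalClosure

/-- The space `F_{s,t}` attached to the kernel increment `f_t - f_s`. -/
abbrev incrementSpace {H ι : Type*} [NormedAddCommGroup H] [InnerProductSpace ℝ H]
    (e : HilbertBasis ι ℝ H) {n : ℕ} (f : ℝ → TensorPow ι n) (s t : ℝ) : Submodule ℝ H :=
  contractionSpace e (f t - f s)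

/-- The regularity assumption on the kernels, with constants `C > 0` and `θ > 1`. -/
def KernelRegularity {ι : Type*} {n : ℕ} (f : ℝ → TensorPow ι n) (C θ : ℝ) : Prop :=
  0 < C ∧ 1 < θ ∧ f 0 = 0 ∧
    ∀ s t : ℝ, 0 ≤ s → s < t → t ≤ 1 →
      0 < ‖f t - f s‖ ∧ ‖f t - f s‖ ≤ C * |t - s| ^ (θ / 2)

/-- The closed span of `F_{s₀,s₁}, …, F_{s_{k-1},s_k}, F_{r₀,r₁}, …, F_{r_{l-1},r_l}`. -/
abbrev outerSpace {H ι : Type*} [NormedAddCommGroup H] [InnerProductSpace ℝ H]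
    (e : HilbertBasis ι ℝ H) {n : ℕ} (f : ℝ → TensorPow ι n) {k l : ℕ}
    (s : Fin (k + 1) → ℝ) (r : Fin (l + 1) → ℝ) : Submodule ℝ H :=
  ((⨆ i : Fin k, incrementSpace e f (s i.castSucc) (s i.succ)) ⊔
    (⨆ i : Fin l, incrementSpace e f (r i.castSucc) (r i.succ))).topologicalClosure

/-- The block-form assumption with constant `α ∈ (0,1)`. Here `t₀ < t₁ < ⋯ < t_m` are points of
`[0,1]`, `0 = s₀ < s₁ < ⋯ < s_k = t₀` is a subdivision of `[0, t₀]`, and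
`t_m = r₀ < r₁ < ⋯ < r_l ≤ 1`. The strict bound is required of every nonzero combination
`v = a₁ ξ_{t₀,t₁} + ⋯ + a_m ξ_{t_{m-1},t_m}` with `ξ_{t_{i-1},t_i} ∈ F_{t_{i-1},t_i}`. -/
def BlockForm {H ι : Type*} [NormedAddCommGroup H] [InnerProductSpace ℝ H] [CompleteSpace H]
    (e : HilbertBasis ι ℝ H) {n : ℕ} (f : ℝ → TensorPow ι n) (α : ℝ) : Prop :=
  0 < α ∧ α < 1 ∧
    ∀ (m k l : ℕ) (t : Fin (m + 1) → ℝ) (s : Fin (k + 1) → ℝ) (r : Fin (l + 1) → ℝ)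
      (a : Fin m → ℝ) (ξ : Fin m → H),
      StrictMono t → 0 ≤ t 0 → t (Fin.last m) ≤ 1 →
      StrictMono s → s 0 = 0 → s (Fin.last k) = t 0 →
      StrictMono r → r 0 = t (Fin.last m) → r (Fin.last l) ≤ 1 →
      (∀ i : Fin m, ξ i ∈ incrementSpace e f (t i.castSucc) (t i.succ)) →
      ∑ i, a i • ξ i ≠ 0 →
      α * ‖∑ i, a i • ξ i‖ ^ 2 <
        ‖∑ i, a i • ξ i - (outerSpace e f s r).starProjection (∑ i, a i • ξ i)‖ ^ 2

/-- `J = ∫_a^b g dY` as a Young (Riemann–Stieltjes) integral: the tagged Riemann sums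
`∑ g(cᵢ) (Y(p_{i+1}) - Y(pᵢ))` over partitions of `[a,b]` converge to `J` as the mesh tends
to zero. -/
def IsYoungIntegral {H : Type*} [NormedAddCommGroup H] [InnerProductSpace ℝ H]
    (g : ℝ → ℝ) (Y : ℝ → H) (a b : ℝ) (J : H) : Prop :=
  ∀ ε > 0, ∃ δ > 0, ∀ (N : ℕ) (p : ℕ → ℝ) (c : ℕ → ℝ),
    Monotone p → p 0 = a → p N = b →
    (∀ i < N, p (i + 1) - p i < δ ∧ c i ∈ Icc (p i) (p (i + 1))) →
    ‖∑ i ∈ Finset.range N, g (c i) • (Y (p (i + 1)) - Y (p i)) - J‖ < ε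

end

end ChaosProcess

/-!
Expanding the kernel `f` in the basis tensors exhibits the derivative of `Iₙ(f)` as an `L²`-limit of
sums of products of Hermite polynomials in the independent standard Gaussians `W(e_j)` with the
contractions of `f`. Such sums lie in the closed subspace `contractionSpace e f`, and Wick's formula
bounds all their moments by powers of `‖f‖`. As the derivative is linear in the kernel,
`DX_t - DX_s` takes values in `F_{s,t}` and has moments of order `|t - s|^{θ/2}`, and Kolmogorov's
criterion yields a version with Hölder paths. Integration by parts makes the derivative unique, so
that every continuous version has these properties.

The rest is pathwise. The Young integrals exist by the sewing argument, as `τ + ρ > 1`. A Riemann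
sum over `[0, 1]` with rational partition points splits at a time `t` into a combination `v` of
vectors of the spaces `F` over `[0, t]` and a vector in the span of those over `[t, 1]`; by the
block form its norm is at least the distance of `v` to that span, which is at least `√α ‖v‖`, and
the inequality passes to the limit.
-/

namespace ChaosProcess

/-! ### The sewing lemma and Young integrals -/

section Sewing

variable {E : Type*} [NormedAddCommGroup E]

/-- `p 0 ≤ p 1 ≤ ⋯ ≤ p N` is a partition of `[a, b]`. The values of `p` beyond `N` are irrelevant
to the integrals; they are kept monotone to match the partitions of `IsYoungIntegral`. -/
structure IsPartition (p : ℕ → ℝ) (N : ℕ) (a b : ℝ) : Prop where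
  monotone : Monotone p
  zero : p 0 = a
  last : p N = b

/-- A germ `A` is almost additive on `T` when its defect of additivity on `[s, t]` is at most
`K * (t - s) ^ β`; for `β > 1` such germs can be integrated. -/
structure IsAlmostAdditive (A : ℝ → ℝ → E) (T : Set ℝ) (K β : ℝ) : Prop where
  nonneg : 0 ≤ K
  self : ∀ x, A x x = 0
  norm_sub_sub_le : ∀ s ∈ T, ∀ u ∈ T, ∀ t ∈ T, s ≤ u → u ≤ t →
    ‖A s t - A s u - A u t‖ ≤ K * (t - s) ^ β

/-- The sum of the germ `A` over the intervals of a partition. -/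
def partitionSum (A : ℝ → ℝ → E) (p : ℕ → ℝ) (N : ℕ) : E :=
  ∑ i ∈ Finset.range N, A (p i) (p (i + 1))

/-- The constant of the Young–Loève inequality. -/
noncomputable def sewingConst (β : ℝ) : ℝ := 2 / (1 - 2 ^ (1 - β))

variable {A : ℝ → ℝ → E} {T : Set ℝ} {K β a b : ℝ} {p q : ℕ → ℝ} {N M : ℕ}

theorem two_rpow_one_sub_lt_one (hβ : 1 < β) : (2 : ℝ) ^ (1 - β) < 1 :=
  Real.rpow_lt_one_of_one_lt_of_neg one_lt_two (sub_neg.2 hβ)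

theorem sewingConst_nonneg (hβ : 1 < β) : 0 ≤ sewingConst β :=
  div_nonneg zero_le_two (sub_nonneg.2 (two_rpow_one_sub_lt_one hβ).le)

theorem sewingConst_mul_add_two (hβ : 1 < β) :
    sewingConst β * 2 ^ (1 - β) + 2 = sewingConst β := by
  have hne : (1 : ℝ) - 2 ^ (1 - β) ≠ 0 := (sub_pos.2 (two_rpow_one_sub_lt_one hβ)).ne'
  rw [sewingConst]
  field_simp
  ring

theorem rpow_le_of_le_half (hβ : 0 ≤ β) {x y : ℝ} (hx : 0 ≤ x) (hy : 0 ≤ y) (hxy : x ≤ y / 2) :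
    x ^ β ≤ 2 ^ (1 - β) * y ^ β / 2 := by
  calc x ^ β ≤ (y / 2) ^ β := Real.rpow_le_rpow hx hxy hβ
    _ = 2 ^ (1 - β) * y ^ β / 2 := by
      rw [Real.div_rpow hy zero_le_two, Real.rpow_sub two_pos, Real.rpow_one]
      field_simp

theorem exists_mem_Icc_succ {p : ℕ → ℝ} {m n : ℕ} (hmn : m < n) {x : ℝ} (hx : x ∈ Icc (p m) (p n)) :
    ∃ k, m ≤ k ∧ k < n ∧ x ∈ Icc (p k) (p (k + 1)) := by
  induction n, hmn using Nat.le_induction with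
  | base => exact ⟨m, le_rfl, m.lt_succ_self, hx⟩
  | succ n hmn ih =>
    rcases le_total x (p n) with hxn | hxn
    · obtain ⟨k, hmk, hkn, hxk⟩ := ih ⟨hx.1, hxn⟩
      exact ⟨k, hmk, hkn.trans n.lt_succ_self, hxk⟩
    · exact ⟨n, m.le_succ.trans hmn, n.lt_succ_self, hxn, hx.2⟩

namespace IsAlmostAdditive

-- The interval containing the midpoint is split off, so each of the two remaining pieces has at
-- most half the length; the two defects of additivity produced by the splitting are absorbed
-- because `sewingConst β * 2 ^ (1 - β) + 2 = sewingConst β`.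
theorem norm_sum_Ico_sub_le_of_split (hA : IsAlmostAdditive A T K β) (hβ : 1 < β)
    (hp : Monotone p) (hpT : ∀ i, p i ∈ T) {m k n : ℕ} (hmk : m ≤ k) (hkn : k < n)
    (hmid : (p m + p n) / 2 ∈ Icc (p k) (p (k + 1)))
    (hleft : ‖∑ i ∈ Finset.Ico m k, A (p i) (p (i + 1)) - A (p m) (p k)‖ ≤
      sewingConst β * K * (p k - p m) ^ β)
    (hright : ‖∑ i ∈ Finset.Ico (k + 1) n, A (p i) (p (i + 1)) - A (p (k + 1)) (p n)‖ ≤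
      sewingConst β * K * (p n - p (k + 1)) ^ β) :
    ‖∑ i ∈ Finset.Ico m n, A (p i) (p (i + 1)) - A (p m) (p n)‖ ≤
      sewingConst β * K * (p n - p m) ^ β := by
  obtain ⟨hmid_ge, hmid_le⟩ := hmid
  have hpmk := hp hmk
  have hpkn := hp hkn.le
  have hpk1n := hp (Nat.succ_le_of_lt hkn)
  have hβ0 : 0 ≤ β := by linarith
  have hc : 0 ≤ sewingConst β * K := mul_nonneg (sewingConst_nonneg hβ) hA.nonneg
  have hdecomp : ∑ i ∈ Finset.Ico m n, A (p i) (p (i + 1)) - A (p m) (p n) =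
      (∑ i ∈ Finset.Ico m k, A (p i) (p (i + 1)) - A (p m) (p k)) +
      (∑ i ∈ Finset.Ico (k + 1) n, A (p i) (p (i + 1)) - A (p (k + 1)) (p n)) -
      (A (p m) (p n) - A (p m) (p k) - A (p k) (p n)) -
      (A (p k) (p n) - A (p k) (p (k + 1)) - A (p (k + 1)) (p n)) := by
    rw [← Finset.sum_Ico_consecutive _ hmk hkn.le, Finset.sum_eq_sum_Ico_succ_bot hkn]
    abel
  have hdefect₁ := hA.norm_sub_sub_le _ (hpT m) _ (hpT k) _ (hpT n) hpmk hpkn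
  have hdefect₂ : ‖A (p k) (p n) - A (p k) (p (k + 1)) - A (p (k + 1)) (p n)‖ ≤
      K * (p n - p m) ^ β :=
    (hA.norm_sub_sub_le _ (hpT k) _ (hpT (k + 1)) _ (hpT n) (hp k.le_succ) hpk1n).trans
      (mul_le_mul_of_nonneg_left (Real.rpow_le_rpow (by linarith) (by linarith) hβ0) hA.nonneg)
  have hhalf₁ := hleft.trans (mul_le_mul_of_nonneg_left
    (rpow_le_of_le_half (y := p n - p m) hβ0 (by linarith) (by linarith) (by linarith)) hc)
  have hhalf₂ := hright.trans (mul_le_mul_of_nonneg_left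
    (rpow_le_of_le_half (y := p n - p m) hβ0 (by linarith) (by linarith) (by linarith)) hc)
  rw [hdecomp]
  refine (norm_sub_le_of_le (norm_sub_le_of_le (norm_add_le_of_le hhalf₁ hhalf₂) hdefect₁)
    hdefect₂).trans_eq ?_
  linear_combination K * (p n - p m) ^ β * sewingConst_mul_add_two hβ

theorem norm_sum_Ico_sub_le (hA : IsAlmostAdditive A T K β) (hβ : 1 < β)
    (hp : Monotone p) (hpT : ∀ i, p i ∈ T) {m n : ℕ} (hmn : m ≤ n) :
    ‖∑ i ∈ Finset.Ico m n, A (p i) (p (i + 1)) - A (p m) (p n)‖ ≤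
      sewingConst β * K * (p n - p m) ^ β := by
  induction hd : n - m using Nat.strong_induction_on generalizing m n with
  | _ d ih =>
    rcases hmn.eq_or_lt with rfl | hlt
    · simp only [Finset.Ico_self, Finset.sum_empty, hA.self, sub_self, norm_zero]
      exact mul_nonneg (mul_nonneg (sewingConst_nonneg hβ) hA.nonneg) (Real.rpow_nonneg le_rfl _)
    have hpmn := hp hmn
    obtain ⟨k, hmk, hkn, hmid⟩ := exists_mem_Icc_succ (p := p) hlt
      (x := (p m + p n) / 2) ⟨by linarith, by linarith⟩
    exact hA.norm_sum_Ico_sub_le_of_split hβ hp hpT hmk hkn hmid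
      (ih (k - m) (by omega) hmk rfl) (ih (n - (k + 1)) (by omega) hkn rfl)

end IsAlmostAdditive

open scoped Classical in
/-- The value of the germ `A` on the intersection of `[a, b]` and `[c, d]`. Summing it over the
intervals of two partitions is summing `A` over their common refinement. -/
noncomputable def onInter (A : ℝ → ℝ → E) (a b c d : ℝ) : E :=
  if max a c ≤ min b d then A (max a c) (min b d) else 0

theorem onInter_comm (A : ℝ → ℝ → E) (a b c d : ℝ) : onInter A a b c d = onInter A c d a b := by
  simp only [onInter, max_comm a c, min_comm b d]

theorem onInter_eq_clip (hA : ∀ x, A x x = 0) {c d : ℝ} (hab : a ≤ b) (hcd : c ≤ d) :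
    onInter A a b c d = A (max a (min c b)) (max a (min d b)) := by
  unfold onInter
  split_ifs with h
  · simp only [le_min_iff, max_le_iff] at h
    rw [min_eq_left h.1.2, min_comm b d, max_eq_right (le_min h.2.1 h.1.1)]
  · rcases lt_or_ge d a with hda | had
    · rw [max_eq_left ((min_le_left _ _).trans (hcd.trans hda.le)),
        max_eq_left ((min_le_left _ _).trans hda.le), hA]
    · have hbc : b < c := by
        by_contra! hcb
        exact h (le_min (max_le hab hcb) (max_le had hcd))
      rw [min_eq_right hbc.le, min_eq_right (hbc.le.trans hcd), hA]

namespace IsAlmostAdditive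

theorem norm_partitionSum_sub_sum_onInter_le (hA : IsAlmostAdditive A (Icc a b) K β) (hβ : 1 < β)
    (hp : IsPartition p N a b) (hq : IsPartition q M a b) :
    ‖partitionSum A p N -
      ∑ i ∈ Finset.range N, ∑ j ∈ Finset.range M, onInter A (p i) (p (i + 1)) (q j) (q (j + 1))‖ ≤
      sewingConst β * K * ∑ i ∈ Finset.range N, (p (i + 1) - p i) ^ β := by
  rw [partitionSum, ← Finset.sum_sub_distrib, Finset.mul_sum]
  refine norm_sum_le_of_le _ fun i hi => ?_
  have ha : a ≤ p i := hp.zero ▸ hp.monotone i.zero_le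
  have hb : p (i + 1) ≤ b := hp.last ▸ hp.monotone (Finset.mem_range.1 hi)
  have hle : p i ≤ p (i + 1) := hp.monotone i.le_succ
  have hclip : Monotone fun j => max (p i) (min (q j) (p (i + 1))) := fun j k hjk =>
    max_le_max le_rfl (min_le_min (hq.monotone hjk) le_rfl)
  have hsum := hA.norm_sum_Ico_sub_le hβ hclip
    (fun j => ⟨ha.trans (le_max_left _ _), max_le (hle.trans hb) ((min_le_right _ _).trans hb)⟩)
    M.zero_le
  simp only [hq.zero, hq.last, min_eq_right hb, max_eq_right hle, min_eq_left (ha.trans hle),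
    max_eq_left ha] at hsum
  rwa [norm_sub_rev, Finset.sum_congr rfl fun j _ =>
    onInter_eq_clip hA.self hle (hq.monotone j.le_succ), Finset.range_eq_Ico]

theorem norm_partitionSum_sub_partitionSum_le (hA : IsAlmostAdditive A (Icc a b) K β)
    (hβ : 1 < β) (hp : IsPartition p N a b) (hq : IsPartition q M a b) :
    ‖partitionSum A p N - partitionSum A q M‖ ≤
      sewingConst β * K * (∑ i ∈ Finset.range N, (p (i + 1) - p i) ^ β +
        ∑ i ∈ Finset.range M, (q (i + 1) - q i) ^ β) := by
  have hrefine_p := hA.norm_partitionSum_sub_sum_onInter_le hβ hp hq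
  have hrefine_q := hA.norm_partitionSum_sub_sum_onInter_le hβ hq hp
  rw [Finset.sum_comm, norm_sub_rev] at hrefine_q
  simp only [onInter_comm A (q _)] at hrefine_q
  rw [mul_add]
  exact (norm_sub_le_norm_sub_add_norm_sub _ _ _).trans (add_le_add hrefine_p hrefine_q)

end IsAlmostAdditive

theorem sum_rpow_le_of_mesh {δ : ℝ} (hβ : 1 < β) (hp : Monotone p)
    (hδ : ∀ i < N, p (i + 1) - p i ≤ δ) :
    ∑ i ∈ Finset.range N, (p (i + 1) - p i) ^ β ≤ δ ^ (β - 1) * (p N - p 0) := by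
  rw [← Finset.sum_range_sub, Finset.mul_sum]
  refine Finset.sum_le_sum fun i hi => ?_
  have hstep : 0 ≤ p (i + 1) - p i := sub_nonneg.2 (hp i.le_succ)
  calc (p (i + 1) - p i) ^ β = (p (i + 1) - p i) ^ (β - 1) * (p (i + 1) - p i) := by
        rw [← Real.rpow_add_one' hstep (by linarith), sub_add_cancel]
    _ ≤ δ ^ (β - 1) * (p (i + 1) - p i) := by
        have := hδ i (Finset.mem_range.1 hi)
        gcongr

/-- The subdivision of `[a, b]` into `n + 1` intervals of equal length. -/
noncomputable def uniformPartition (a b : ℝ) (n i : ℕ) : ℝ := a + i * ((b - a) / (n + 1))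

theorem isPartition_uniformPartition (hab : a ≤ b) (n : ℕ) :
    IsPartition (uniformPartition a b n) (n + 1) a b where
  monotone i j hij := by
    have := sub_nonneg.2 hab
    simp only [uniformPartition]
    gcongr
  zero := by simp [uniformPartition]
  last := by
    simp only [uniformPartition]
    push_cast
    field_simp
    ring

theorem tendsto_sum_rpow_uniformPartition (hβ : 1 < β) (hab : a ≤ b) :
    Tendsto (fun n : ℕ => ∑ i ∈ Finset.range (n + 1),
      (uniformPartition a b n (i + 1) - uniformPartition a b n i) ^ β) atTop (𝓝 0) := by
  have hstep : ∀ n i : ℕ, uniformPartition a b n (i + 1) - uniformPartition a b n i =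
      (b - a) / (n + 1) := fun n i => by
    simp only [uniformPartition]
    push_cast
    ring
  have hmesh : Tendsto (fun n : ℕ => (b - a) / ((n : ℝ) + 1)) atTop (𝓝 0) := by
    simpa [div_eq_mul_inv] using
      (tendsto_one_div_add_atTop_nhds_zero_nat (𝕜 := ℝ)).const_mul (b - a)
  have hbound := (hmesh.rpow_const (p := β - 1) (Or.inr (by linarith))).mul_const (b - a)
  rw [Real.zero_rpow (by linarith), zero_mul] at hbound
  refine squeeze_zero (fun n => Finset.sum_nonneg fun i _ => ?_) (fun n => ?_) hbound
  · exact Real.rpow_nonneg (sub_nonneg.2 ((isPartition_uniformPartition hab n).monotone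
      i.le_succ)) _
  · have hP := isPartition_uniformPartition hab n
    have hle := sum_rpow_le_of_mesh hβ hP.monotone (N := n + 1) fun i _ => (hstep n i).le
    rwa [hP.zero, hP.last] at hle

theorem IsAlmostAdditive.exists_integral [CompleteSpace E]
    (hA : IsAlmostAdditive A (Icc a b) K β) (hβ : 1 < β) (hab : a ≤ b) :
    ∃ J, ∀ p N, IsPartition p N a b → ‖partitionSum A p N - J‖ ≤
      sewingConst β * K * ∑ i ∈ Finset.range N, (p (i + 1) - p i) ^ β := by
  set R : ℕ → E := fun n => partitionSum A (uniformPartition a b n) (n + 1)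
  set V : ℕ → ℝ := fun n => ∑ i ∈ Finset.range (n + 1),
    (uniformPartition a b n (i + 1) - uniformPartition a b n i) ^ β
  have hV : Tendsto V atTop (𝓝 0) := tendsto_sum_rpow_uniformPartition hβ hab
  have hpart := isPartition_uniformPartition hab
  have hcauchy : CauchySeq R := by
    rw [Metric.cauchySeq_iff']
    intro ε hε
    have hVV : Tendsto (fun nm : ℕ × ℕ => sewingConst β * K * (V nm.1 + V nm.2))
        atTop (𝓝 0) := by
      rw [← prod_atTop_atTop_eq]
      simpa using ((hV.comp tendsto_fst).add (hV.comp tendsto_snd)).const_mul (sewingConst β * K)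
    obtain ⟨n₀, hn₀⟩ := eventually_atTop_prod_self.1 (hVV.eventually (gt_mem_nhds hε))
    refine ⟨n₀, fun n hn => ?_⟩
    rw [dist_eq_norm]
    exact (hA.norm_partitionSum_sub_partitionSum_le hβ (hpart n) (hpart n₀)).trans_lt
      (hn₀ n n₀ hn le_rfl)
  obtain ⟨J, hJ⟩ := cauchySeq_tendsto_of_complete hcauchy
  refine ⟨J, fun p N hp => ?_⟩
  have hlim : Tendsto (fun n => sewingConst β * K *
      (∑ i ∈ Finset.range N, (p (i + 1) - p i) ^ β + V n)) atTop
      (𝓝 (sewingConst β * K * ∑ i ∈ Finset.range N, (p (i + 1) - p i) ^ β)) := by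
    simpa using (hV.const_add (∑ i ∈ Finset.range N, (p (i + 1) - p i) ^ β)).const_mul
      (sewingConst β * K)
  exact le_of_tendsto_of_tendsto' (tendsto_const_nhds.sub hJ).norm hlim fun n =>
    hA.norm_partitionSum_sub_partitionSum_le hβ hp (hpart n)

end Sewing

theorem norm_sub_le_of_holderOnWith {E : Type*} [NormedAddCommGroup E] {y : ℝ → E} {s : Set ℝ}
    {K r : ℝ≥0} (h : HolderOnWith K r y s) {a b : ℝ} (ha : a ∈ s) (hb : b ∈ s) :
    ‖y a - y b‖ ≤ K * |a - b| ^ (r : ℝ) := by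
  rw [← dist_eq_norm, ← Real.dist_eq]
  exact h.dist_le ha hb

section Young

variable {H : Type*} [NormedAddCommGroup H] [InnerProductSpace ℝ H] {g : ℝ → ℝ} {Y : ℝ → H}

theorem norm_smul_sub_le_of_holderOnWith {s : Set ℝ} {K₁ K₂ τ ρ : ℝ≥0}
    (hg : HolderOnWith K₁ τ g s) (hY : HolderOnWith K₂ ρ Y s) {u v x y d : ℝ}
    (hu : u ∈ s) (hv : v ∈ s) (hx : x ∈ s) (hy : y ∈ s) (huv : |u - v| ≤ d) (hxy : |x - y| ≤ d) :
    ‖(g u - g v) • (Y x - Y y)‖ ≤ K₁ * K₂ * d ^ ((τ : ℝ) + ρ) := by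
  have hd : 0 ≤ d := (abs_nonneg _).trans huv
  have hgd : ‖g u - g v‖ ≤ K₁ * d ^ (τ : ℝ) :=
    (norm_sub_le_of_holderOnWith hg hu hv).trans (by gcongr)
  have hYd : ‖Y x - Y y‖ ≤ K₂ * d ^ (ρ : ℝ) :=
    (norm_sub_le_of_holderOnWith hY hx hy).trans (by gcongr)
  rw [norm_smul, Real.rpow_add_of_nonneg hd τ.coe_nonneg ρ.coe_nonneg, mul_mul_mul_comm]
  exact mul_le_mul hgd hYd (norm_nonneg _) (by positivity)

theorem isAlmostAdditive_of_holderOnWith {s : Set ℝ} {K₁ K₂ τ ρ : ℝ≥0}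
    (hg : HolderOnWith K₁ τ g s) (hY : HolderOnWith K₂ ρ Y s) :
    IsAlmostAdditive (fun x y => g x • (Y y - Y x)) s (K₁ * K₂) (τ + ρ) where
  nonneg := by positivity
  self x := by rw [sub_self, smul_zero]
  norm_sub_sub_le x hx y hy z hz hxy hyz := by
    have hdefect : g x • (Y z - Y x) - g x • (Y y - Y x) - g y • (Y z - Y y) =
        (g x - g y) • (Y z - Y y) := by
      simp only [smul_sub, sub_smul]
      abel
    rw [hdefect]
    exact norm_smul_sub_le_of_holderOnWith hg hY hx hy hz hy
      (by rw [abs_sub_comm, abs_of_nonneg] <;> linarith) (by rw [abs_of_nonneg] <;> linarith)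

theorem exists_isYoungIntegral [CompleteSpace H] {K₁ K₂ τ ρ : ℝ≥0} {a b : ℝ} (hab : a ≤ b)
    (hg : HolderOnWith K₁ τ g (Icc a b)) (hY : HolderOnWith K₂ ρ Y (Icc a b)) (hτρ : 1 < τ + ρ) :
    ∃ J, IsYoungIntegral g Y a b J := by
  have hβ : 1 < (τ : ℝ) + ρ := by exact_mod_cast hτρ
  obtain ⟨J, hJ⟩ := (isAlmostAdditive_of_holderOnWith hg hY).exists_integral hβ hab
  set c := (1 + sewingConst (τ + ρ)) * (K₁ * K₂ : ℝ) with hc_def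
  have hc : 0 ≤ c := mul_nonneg (add_nonneg zero_le_one (sewingConst_nonneg hβ)) (by positivity)
  refine ⟨J, fun ε hε => ?_⟩
  have hsmall : Tendsto (fun δ : ℝ => c * (δ ^ ((τ : ℝ) + ρ - 1) * (b - a))) (𝓝[>] 0) (𝓝 0) := by
    have := ((tendsto_id (x := 𝓝 (0 : ℝ))).rpow_const (p := (τ : ℝ) + ρ - 1)
      (Or.inr (sub_pos.2 hβ).le)).mul_const (b - a) |>.const_mul c
    rw [Real.zero_rpow (sub_pos.2 hβ).ne', zero_mul, mul_zero] at this
    exact this.mono_left nhdsWithin_le_nhds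
  obtain ⟨δ, hδε, hδ⟩ := ((hsmall.eventually (gt_mem_nhds hε)).and self_mem_nhdsWithin).exists
  refine ⟨δ, hδ, fun N p x hp hp0 hpN hpx => ?_⟩
  have hmem : ∀ i ≤ N, p i ∈ Icc a b := fun i hi => ⟨hp0 ▸ hp i.zero_le, hpN ▸ hp hi⟩
  have hmesh := sum_rpow_le_of_mesh (δ := δ) hβ hp (N := N) fun i hi => (hpx i hi).1.le
  rw [hpN, hp0] at hmesh
  have htags : ‖∑ i ∈ Finset.range N, g (x i) • (Y (p (i + 1)) - Y (p i)) -
      partitionSum (fun s t => g s • (Y t - Y s)) p N‖ ≤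
      K₁ * K₂ * ∑ i ∈ Finset.range N, (p (i + 1) - p i) ^ ((τ : ℝ) + ρ) := by
    rw [partitionSum, ← Finset.sum_sub_distrib, Finset.mul_sum]
    refine norm_sum_le_of_le _ fun i hi => ?_
    have hi := Finset.mem_range.1 hi
    obtain ⟨-, hx_ge, hx_le⟩ := hpx i hi
    have hpi := hmem i hi.le
    have hpi1 := hmem (i + 1) hi
    rw [← sub_smul]
    exact norm_smul_sub_le_of_holderOnWith hg hY ⟨hpi.1.trans hx_ge, hx_le.trans hpi1.2⟩ hpi hpi1
      hpi (by rw [abs_of_nonneg] <;> linarith) (by rw [abs_of_nonneg]; linarith [hp i.le_succ])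
  calc _ ≤ K₁ * K₂ * ∑ i ∈ Finset.range N, (p (i + 1) - p i) ^ ((τ : ℝ) + ρ) +
        sewingConst (τ + ρ) * (K₁ * K₂) * ∑ i ∈ Finset.range N, (p (i + 1) - p i) ^ ((τ : ℝ) + ρ) :=
        (norm_sub_le_norm_sub_add_norm_sub _ _ _).trans (add_le_add htags (hJ p N ⟨hp, hp0, hpN⟩))
    _ = c * ∑ i ∈ Finset.range N, (p (i + 1) - p i) ^ ((τ : ℝ) + ρ) := by rw [hc_def]; ring
    _ ≤ c * (δ ^ ((τ : ℝ) + ρ - 1) * (b - a)) := mul_le_mul_of_nonneg_left hmesh hc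
    _ < ε := hδε

theorem natFloor_mul_div_mem_Icc {t : ℝ} (ht : 0 ≤ t) {N : ℕ} (hN : 0 < N) :
    (⌊t * N⌋₊ / N : ℝ) ∈ Icc 0 t :=
  ⟨by positivity, (div_le_iff₀ (by exact_mod_cast hN)).2 (Nat.floor_le (by positivity))⟩

theorem IsYoungIntegral.tendsto_clipped_riemannSum {t : ℝ} (ht : 0 ≤ t) {I : H}
    (hI : IsYoungIntegral g Y 0 t I) :
    Tendsto (fun N : ℕ => ∑ i ∈ Finset.range ⌊t * N⌋₊,
      g (i / N) • (Y ((i + 1 : ℕ) / N) - Y (i / N)) +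
        g (⌊t * N⌋₊ / N) • (Y t - Y (⌊t * N⌋₊ / N))) atTop (𝓝 I) := by
  rw [Metric.tendsto_atTop']
  intro ε hε
  obtain ⟨δ, hδ, hsum⟩ := hI ε hε
  obtain ⟨N₀, hN₀⟩ := eventually_atTop.1
    ((tendsto_inv_atTop_nhds_zero_nat (𝕜 := ℝ)).eventually (gt_mem_nhds hδ))
  refine ⟨N₀, fun N hN => ?_⟩
  have hNpos : 0 < N := N₀.zero_le.trans_lt hN
  have hN' : (0 : ℝ) < N := by exact_mod_cast hNpos
  set m := ⌊t * N⌋₊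
  set p : ℕ → ℝ := fun i => min (i / N) t
  have hp : Monotone p := fun i j hij => min_le_min (by gcongr) le_rfl
  have hp_eq : ∀ i ≤ m, p i = i / N := fun i hi =>
    min_eq_left (le_trans (by gcongr) (natFloor_mul_div_mem_Icc ht hNpos).2)
  have hp_last : p (m + 1) = t := min_eq_right <| by
    rw [le_div_iff₀ hN']
    exact_mod_cast (Nat.lt_floor_add_one _).le
  have hmesh : ∀ i < m + 1, p (i + 1) - p i < δ := fun i hi => by
    have hle : p (i + 1) ≤ (i + 1 : ℕ) / N := min_le_left _ _
    have hstep : ((i + 1 : ℕ) : ℝ) / N - i / N = (N : ℝ)⁻¹ := by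
      push_cast
      field_simp
      ring
    rw [hp_eq i (Nat.lt_succ_iff.1 hi)]
    linarith [hN₀ N hN.le]
  have hclose := hsum (m + 1) p p hp (by rw [hp_eq 0 m.zero_le]; simp) hp_last
    fun i hi => ⟨hmesh i hi, le_rfl, hp i.le_succ⟩
  have hfull : ∑ i ∈ Finset.range m, g (p i) • (Y (p (i + 1)) - Y (p i)) =
      ∑ i ∈ Finset.range m, g (i / N) • (Y ((i + 1 : ℕ) / N) - Y (i / N)) :=
    Finset.sum_congr rfl fun i hi => by
      have hi := Finset.mem_range.1 hi
      rw [hp_eq i hi.le, hp_eq (i + 1) hi]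
  rw [Finset.sum_range_succ, hp_last, hp_eq m le_rfl, hfull] at hclose
  rwa [dist_eq_norm]

theorem IsYoungIntegral.tendsto_riemannSum {t : ℝ} (ht : 0 ≤ t) {I : H}
    (hI : IsYoungIntegral g Y 0 t I) (hY : ContinuousWithinAt Y (Icc 0 t) t) {B : ℝ}
    (hg : ∀ x ∈ Icc 0 t, |g x| ≤ B) :
    Tendsto (fun N : ℕ => ∑ i ∈ Finset.range ⌊t * N⌋₊,
      g (i / N) • (Y ((i + 1 : ℕ) / N) - Y (i / N))) atTop (𝓝 I) := by
  have hfloor : Tendsto (fun N : ℕ => (⌊t * N⌋₊ : ℝ) / N) atTop (𝓝[Icc 0 t] t) := by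
    refine tendsto_nhdsWithin_iff.2
      ⟨(tendsto_nat_floor_mul_div_atTop ht).comp tendsto_natCast_atTop_atTop, ?_⟩
    filter_upwards [eventually_gt_atTop 0] with N hN using natFloor_mul_div_mem_Icc ht hN
  have hYfloor : Tendsto (fun N : ℕ => Y t - Y (⌊t * N⌋₊ / N)) atTop (𝓝 0) := by
    simpa using (hY.tendsto.comp hfloor).const_sub (Y t)
  have hlast : Tendsto (fun N : ℕ => g (⌊t * N⌋₊ / N) • (Y t - Y (⌊t * N⌋₊ / N))) atTop
      (𝓝 0) := by
    refine squeeze_zero_norm' ?_ (by simpa using hYfloor.norm.const_mul B)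
    filter_upwards [eventually_gt_atTop 0] with N hN
    rw [norm_smul]
    exact mul_le_mul_of_nonneg_right (hg _ (natFloor_mul_div_mem_Icc ht hN)) (norm_nonneg _)
  simpa using (hI.tendsto_clipped_riemannSum ht).sub hlast

end Young

section BlockForm

variable {H ι : Type*} [NormedAddCommGroup H] [InnerProductSpace ℝ H] {n : ℕ}

theorem norm_sub_starProjection_le_norm_add (K : Submodule ℝ H) [K.HasOrthogonalProjection]
    (v : H) {w : H} (hw : w ∈ K) : ‖v - K.starProjection v‖ ≤ ‖v + w‖ := by
  rw [Submodule.starProjection_minimal]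
  refine (ciInf_le ⟨0, ?_⟩ (⟨-w, K.neg_mem hw⟩ : K)).trans_eq (by simp)
  rintro _ ⟨x, rfl⟩
  exact norm_nonneg _

variable [CompleteSpace H] {e : HilbertBasis ι ℝ H} {f : ℝ → TensorPow ι n} {α : ℝ}

theorem BlockForm.sqrt_mul_norm_sum_le (hblock : BlockForm e f α) {p : ℕ → ℝ} (hp : StrictMono p)
    (hp0 : p 0 = 0) (a : ℕ → ℝ) {ξ : ℕ → H} {m N : ℕ} (hpN : p N ≤ 1)
    (hξ : ∀ i < N, ξ i ∈ incrementSpace e f (p i) (p (i + 1))) (hm : m ≤ N) :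
    √α * ‖∑ i ∈ Finset.range m, a i • ξ i‖ ≤ ‖∑ i ∈ Finset.range N, a i • ξ i‖ := by
  obtain ⟨hα, -, hproj⟩ := hblock
  set v := ∑ i ∈ Finset.range m, a i • ξ i with hv
  rcases eq_or_ne v 0 with hv0 | hv0
  · rw [hv0, norm_zero, mul_zero]
    exact norm_nonneg _
  let s : Fin (0 + 1) → ℝ := fun _ => 0
  let r : Fin (N - m + 1) → ℝ := fun i => p (m + i)
  set w := ∑ i ∈ Finset.range (N - m), a (m + i) • ξ (m + i) with hw
  have hsum : ∑ i ∈ Finset.range N, a i • ξ i = v + w := by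
    rw [hv, hw, ← Finset.sum_range_add (fun i => a i • ξ i), Nat.add_sub_cancel' hm]
  have hwmem : w ∈ outerSpace e f s r := by
    refine Submodule.le_topologicalClosure _ (Submodule.mem_sup_right ?_)
    rw [hw, Finset.sum_range]
    exact Submodule.sum_mem _ fun i _ => Submodule.smul_mem _ _
      (Submodule.mem_iSup_of_mem i (hξ (m + i) (by omega)))
  have hlt := hproj m 0 (N - m) (fun i => p i) s r (fun i => a i) (fun i => ξ i)
    (fun i j hij => hp hij) hp0.ge ((hp.monotone hm).trans hpN)
    (fun i j hij => absurd hij (by simp [Fin.eq_zero])) rfl hp0.symm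
    (fun i j hij => hp (Nat.add_lt_add_left hij m)) rfl
    (by simpa only [r, Fin.val_last, Nat.add_sub_cancel' hm] using hpN)
    (fun i => hξ i (i.2.trans_le hm))
    (by rwa [← Finset.sum_range fun i => a i • ξ i])
  rw [← Finset.sum_range fun i => a i • ξ i, ← hv] at hlt
  rw [hsum]
  refine le_of_sq_le_sq ?_ (norm_nonneg _)
  rw [mul_pow, Real.sq_sqrt hα.le]
  exact hlt.le.trans
    (pow_le_pow_left₀ (norm_nonneg _) (norm_sub_starProjection_le_norm_add _ v hwmem) 2)

theorem BlockForm.sqrt_mul_norm_youngIntegral_le (hblock : BlockForm e f α) {g : ℝ → ℝ} {Y : ℝ → H}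
    (hY : ∀ s t : ℚ, 0 ≤ s → s ≤ t → t ≤ 1 → Y t - Y s ∈ incrementSpace e f s t)
    (hYc : ContinuousOn Y (Icc 0 1)) {B : ℝ} (hg : ∀ x ∈ Icc (0 : ℝ) 1, |g x| ≤ B)
    {t : ℝ} (ht : t ∈ Icc (0 : ℝ) 1) {I J : H} (hI : IsYoungIntegral g Y 0 t I)
    (hJ : IsYoungIntegral g Y 0 1 J) : √α * ‖I‖ ≤ ‖J‖ := by
  have hsub : Icc 0 t ⊆ Icc (0 : ℝ) 1 := Icc_subset_Icc_right ht.2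
  have hIlim := hI.tendsto_riemannSum ht.1 ((hYc t ht).mono hsub) fun x hx => hg x (hsub hx)
  have hJlim := hJ.tendsto_riemannSum zero_le_one (hYc 1 (right_mem_Icc.2 zero_le_one)) hg
  simp only [one_mul, Nat.floor_natCast] at hJlim
  refine le_of_tendsto_of_tendsto (hIlim.norm.const_mul _) hJlim.norm ?_
  filter_upwards [eventually_gt_atTop 0] with N hN
  have hN' : (0 : ℝ) < N := by exact_mod_cast hN
  have hNq : (0 : ℚ) < N := by exact_mod_cast hN
  refine hblock.sqrt_mul_norm_sum_le (p := fun i => i / N) (fun i j hij => by simp only; gcongr)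
    (by simp) (fun i => g (i / N)) (by rw [div_self hN'.ne']) (fun i hi => ?_) ?_
  · simpa using hY (i / N) ((i + 1 : ℕ) / N) (by positivity) (by gcongr; omega)
      ((div_le_one hNq).2 (by exact_mod_cast hi))
  · exact Nat.floor_le_of_le (mul_le_of_le_one_left N.cast_nonneg ht.2)

end BlockForm

/-! ### Kolmogorov's continuity theorem -/

theorem holderOnWith_of_norm_sub_le {E : Type*} [NormedAddCommGroup E] {y : ℝ → E} {s : Set ℝ}
    {K r : ℝ≥0} (h : ∀ a ∈ s, ∀ b ∈ s, ‖y a - y b‖ ≤ K * |a - b| ^ (r : ℝ)) :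
    HolderOnWith K r y s := by
  intro a ha b hb
  rw [edist_dist, edist_dist, dist_eq_norm, Real.dist_eq,
    ENNReal.ofReal_rpow_of_nonneg (abs_nonneg _) r.coe_nonneg]
  refine (ENNReal.ofReal_le_ofReal (h a ha b hb)).trans_eq ?_
  rw [ENNReal.ofReal_mul K.coe_nonneg, ENNReal.ofReal_coe_nnreal]

section Dyadic

theorem natFloor_two_mul {x : ℝ} (hx : 0 ≤ x) :
    ⌊2 * x⌋₊ = 2 * ⌊x⌋₊ ∨ ⌊2 * x⌋₊ = 2 * ⌊x⌋₊ + 1 := by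
  have hle : 2 * ⌊x⌋₊ ≤ ⌊2 * x⌋₊ := Nat.le_floor <| by
    push_cast
    linarith [Nat.floor_le hx]
  have hlt : ⌊2 * x⌋₊ < 2 * ⌊x⌋₊ + 2 := (Nat.floor_lt (by positivity)).2 <| by
    push_cast
    linarith [Nat.lt_floor_add_one x]
  omega

theorem natFloor_mul_two_pow_le {t : ℝ} (ht : t ≤ 1) (n : ℕ) : ⌊t * 2 ^ n⌋₊ ≤ 2 ^ n := by
  refine Nat.floor_le_of_le ?_
  push_cast
  exact mul_le_of_le_one_left (by positivity) ht

/-- The dyadic approximation from below of level `n`. -/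
noncomputable def dyadicFloor (n : ℕ) (t : ℝ) : ℝ := ⌊t * 2 ^ n⌋₊ / 2 ^ n

variable {n : ℕ} {s t : ℝ}

theorem dyadicFloor_le (ht : 0 ≤ t) : dyadicFloor n t ≤ t :=
  (div_le_iff₀ (by positivity)).2 (Nat.floor_le (by positivity))

theorem sub_dyadicFloor_le : t - dyadicFloor n t ≤ (1 / 2) ^ n := by
  have hlt : t ≤ (⌊t * 2 ^ n⌋₊ + 1) / 2 ^ n :=
    (le_div_iff₀ (by positivity)).2 (Nat.lt_floor_add_one _).le
  rw [add_div] at hlt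
  rw [one_div, inv_pow, ← one_div, dyadicFloor]
  linarith

theorem dyadicFloor_mem_Icc (ht : t ∈ Icc (0 : ℝ) 1) : dyadicFloor n t ∈ Icc (0 : ℝ) 1 :=
  ⟨by unfold dyadicFloor; positivity, (dyadicFloor_le ht.1).trans ht.2⟩

theorem tendsto_dyadicFloor (ht : 0 ≤ t) :
    Tendsto (fun n => |dyadicFloor n t - t|) atTop (𝓝 0) := by
  refine squeeze_zero (fun n => abs_nonneg _) (fun n => ?_)
    (tendsto_pow_atTop_nhds_zero_of_lt_one (r := (1 / 2 : ℝ)) (by norm_num) (by norm_num))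
  rw [abs_sub_comm, abs_of_nonneg (sub_nonneg.2 (dyadicFloor_le ht))]
  exact sub_dyadicFloor_le

variable {E : Type*} [NormedAddCommGroup E] {v : ℝ → E} {S b : ℝ}

/-- The increments of `v` over the dyadic intervals of level `n` in `[0, 1]` are at most
`S * b ^ n`. -/
def HasDyadicDecay (v : ℝ → E) (S b : ℝ) : Prop :=
  ∀ n k : ℕ, k < 2 ^ n → ‖v ((k + 1 : ℕ) / 2 ^ n) - v (k / 2 ^ n)‖ ≤ S * b ^ n

/-- The limit of `v` along the dyadic approximations from below; it agrees with `v` when `v` is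
continuous, and is a junk value when the limit does not exist. -/
noncomputable def dyadicLimit (v : ℝ → E) (t : ℝ) : E :=
  limUnder atTop fun n => v (dyadicFloor n t)

namespace HasDyadicDecay

theorem nonneg (hv : HasDyadicDecay v S b) : 0 ≤ S := by
  simpa using (norm_nonneg _).trans (hv 0 0 (by norm_num))

theorem norm_dyadicFloor_sub_le (hv : HasDyadicDecay v S b) (hb : 0 ≤ b) (hs : 0 ≤ s)
    (ht : t ≤ 1) (hst : s ≤ t) (hd : t - s ≤ (1 / 2) ^ n) :
    ‖v (dyadicFloor n t) - v (dyadicFloor n s)‖ ≤ S * b ^ n := by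
  have hle : ⌊s * 2 ^ n⌋₊ ≤ ⌊t * 2 ^ n⌋₊ := by gcongr
  have hle_succ : ⌊t * 2 ^ n⌋₊ ≤ ⌊s * 2 ^ n⌋₊ + 1 := by
    rw [← Nat.floor_add_one (by positivity)]
    refine Nat.floor_le_floor ?_
    have : (t - s) * 2 ^ n ≤ 1 := by
      calc (t - s) * 2 ^ n ≤ (1 / 2) ^ n * 2 ^ n := by gcongr
        _ = 1 := by rw [← mul_pow]; norm_num
    linarith
  have ht_floor := natFloor_mul_two_pow_le ht n
  unfold dyadicFloor
  rcases hle.eq_or_lt with heq | hlt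
  · rw [heq, sub_self, norm_zero]
    exact mul_nonneg hv.nonneg (by positivity)
  · rw [show ⌊t * 2 ^ n⌋₊ = ⌊s * 2 ^ n⌋₊ + 1 by omega]
    exact hv n _ (by omega)

theorem dist_dyadicFloor_succ_le (hv : HasDyadicDecay v S b) (hb : 0 ≤ b) (hb1 : b ≤ 1)
    (ht : t ∈ Icc (0 : ℝ) 1) (n : ℕ) :
    dist (v (dyadicFloor n t)) (v (dyadicFloor (n + 1) t)) ≤ S * b ^ n := by
  have hfloor : ⌊t * 2 ^ (n + 1)⌋₊ = ⌊2 * (t * 2 ^ n)⌋₊ := by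
    congr 1
    ring
  have hcoarse : dyadicFloor n t = (2 * ⌊t * 2 ^ n⌋₊ : ℕ) / 2 ^ (n + 1) := by
    rw [dyadicFloor]
    push_cast
    field_simp
    ring
  have hle := natFloor_mul_two_pow_le ht.2 (n + 1)
  rw [hcoarse, dyadicFloor, hfloor, dist_comm, dist_eq_norm]
  rcases natFloor_two_mul (mul_nonneg ht.1 (by positivity : (0 : ℝ) ≤ 2 ^ n)) with heq | heq
  · rw [heq, sub_self, norm_zero]
    exact mul_nonneg hv.nonneg (by positivity)
  · rw [heq]
    exact (hv (n + 1) _ (by omega)).trans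
      (mul_le_mul_of_nonneg_left (pow_le_pow_of_le_one hb hb1 n.le_succ) hv.nonneg)

variable [CompleteSpace E]

theorem tendsto_dyadicLimit (hv : HasDyadicDecay v S b) (hb : 0 ≤ b) (hb1 : b < 1)
    (ht : t ∈ Icc (0 : ℝ) 1) :
    Tendsto (fun n => v (dyadicFloor n t)) atTop (𝓝 (dyadicLimit v t)) :=
  (cauchySeq_of_le_geometric b S hb1 (hv.dist_dyadicFloor_succ_le hb hb1.le ht)).tendsto_limUnder

theorem dist_dyadicFloor_dyadicLimit_le (hv : HasDyadicDecay v S b) (hb : 0 ≤ b) (hb1 : b < 1)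
    (ht : t ∈ Icc (0 : ℝ) 1) (n : ℕ) :
    dist (v (dyadicFloor n t)) (dyadicLimit v t) ≤ S * b ^ n / (1 - b) :=
  dist_le_of_le_geometric_of_tendsto b S hb1 (hv.dist_dyadicFloor_succ_le hb hb1.le ht)
    (hv.tendsto_dyadicLimit hb hb1 ht) n

theorem norm_dyadicLimit_sub_le (hv : HasDyadicDecay v S b) (hb : 0 ≤ b) (hb1 : b < 1)
    (hs : s ∈ Icc (0 : ℝ) 1) (ht : t ∈ Icc (0 : ℝ) 1) (hst : s ≤ t) (hd : t - s ≤ (1 / 2) ^ n) :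
    ‖dyadicLimit v s - dyadicLimit v t‖ ≤ (1 + 2 / (1 - b)) * S * b ^ n := by
  have hb1' : 0 < 1 - b := sub_pos.2 hb1
  have hmid := hv.norm_dyadicFloor_sub_le hb hs.1 ht.2 hst hd
  rw [← dist_eq_norm, dist_comm] at hmid
  rw [← dist_eq_norm]
  calc _ ≤ dist (dyadicLimit v s) (v (dyadicFloor n s)) +
        dist (v (dyadicFloor n s)) (v (dyadicFloor n t)) +
        dist (v (dyadicFloor n t)) (dyadicLimit v t) := dist_triangle4 _ _ _ _
    _ ≤ S * b ^ n / (1 - b) + S * b ^ n + S * b ^ n / (1 - b) :=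
        add_le_add (add_le_add ((dist_comm _ _).trans_le
          (hv.dist_dyadicFloor_dyadicLimit_le hb hb1 hs n)) hmid)
          (hv.dist_dyadicFloor_dyadicLimit_le hb hb1 ht n)
    _ = (1 + 2 / (1 - b)) * S * b ^ n := by
        field_simp
        ring

theorem exists_holderOnWith_dyadicLimit {r : ℝ≥0} (hr : 0 < r)
    (hv : HasDyadicDecay v S ((1 / 2 : ℝ) ^ (r : ℝ))) :
    ∃ K, HolderOnWith K r (dyadicLimit v) (Icc 0 1) := by
  set b : ℝ := (1 / 2 : ℝ) ^ (r : ℝ) with hb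
  have hb0 : 0 < b := Real.rpow_pos_of_pos (by norm_num) _
  have hb1 : b < 1 := Real.rpow_lt_one (by norm_num) (by norm_num) hr
  have hb1' : 0 < 1 - b := sub_pos.2 hb1
  have hS := hv.nonneg
  have hK : 0 ≤ (1 + 2 / (1 - b)) * S / b := by positivity
  refine ⟨⟨_, hK⟩, holderOnWith_of_norm_sub_le fun s hs t ht => ?_⟩
  change _ ≤ (1 + 2 / (1 - b)) * S / b * _
  wlog hst : s < t generalizing s t
  · rcases (not_lt.1 hst).eq_or_lt with rfl | hts
    · rw [sub_self, norm_zero]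
      positivity
    · rw [norm_sub_rev, abs_sub_comm]
      exact this t ht s hs hts
  obtain ⟨n, hn_lt, hn_le⟩ := exists_nat_pow_near_of_lt_one (x := t - s) (y := (1 / 2 : ℝ))
    (by linarith) (by linarith [hs.1, ht.2]) (by norm_num) (by norm_num)
  have hbn : b ^ (n + 1) ≤ (t - s) ^ (r : ℝ) := by
    rw [hb, ← Real.rpow_mul_natCast (by norm_num), mul_comm, Real.rpow_natCast_mul (by norm_num)]
    exact Real.rpow_le_rpow (by positivity) hn_lt.le hr.le
  rw [abs_sub_comm, abs_of_pos (sub_pos.2 hst)]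
  calc _ ≤ (1 + 2 / (1 - b)) * S * b ^ n :=
        hv.norm_dyadicLimit_sub_le hb0.le hb1 hs ht hst.le hn_le
    _ = (1 + 2 / (1 - b)) * S / b * b ^ (n + 1) := by
        field_simp
        ring
    _ ≤ _ := by gcongr

end HasDyadicDecay

end Dyadic

section Kolmogorov

variable {Ω E : Type*} [MeasurableSpace Ω] {P : Measure Ω} [NormedAddCommGroup E]

theorem eLpNorm_natCast_pow {m : ℕ} (hm : m ≠ 0) (F : Ω → E) :
    eLpNorm F m P ^ m = ∫⁻ ω, ‖F ω‖ₑ ^ m ∂P := by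
  simpa using eLpNorm_nnreal_pow_eq_lintegral (μ := P) (f := F) (p := m) (by exact_mod_cast hm)

theorem ae_exists_forall_norm_le {ι : Type*} [Countable ι] {m : ℕ} (hm : m ≠ 0) {G : ι → Ω → E}
    (hG : ∀ i, AEStronglyMeasurable (G i) P) (hsum : ∑' i, eLpNorm (G i) m P ^ m ≠ ∞) :
    ∀ᵐ ω ∂P, ∃ S : ℝ≥0, ∀ i, ‖G i ω‖ ≤ S := by
  have hmeas : ∀ i, AEMeasurable (fun ω => ‖G i ω‖ₑ ^ m) P := fun i => (hG i).enorm.pow_const m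
  have hint : ∫⁻ ω, ∑' i, ‖G i ω‖ₑ ^ m ∂P ≠ ∞ := by
    rw [lintegral_tsum hmeas]
    simpa only [eLpNorm_natCast_pow hm] using hsum
  filter_upwards [ae_lt_top' (AEMeasurable.tsum hmeas) hint] with ω hω
  have hm' : (0 : ℝ) < m := by exact_mod_cast hm.bot_lt
  refine ⟨((∑' i, ‖G i ω‖ₑ ^ m) ^ (m : ℝ)⁻¹).toNNReal, fun i => ?_⟩
  have hle : ‖G i ω‖ₑ ≤ (∑' i, ‖G i ω‖ₑ ^ m) ^ (m : ℝ)⁻¹ := by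
    rw [ENNReal.le_rpow_inv_iff hm', ENNReal.rpow_natCast]
    exact ENNReal.le_tsum i
  have hfin := ENNReal.rpow_lt_top_of_nonneg (inv_nonneg.2 hm'.le) hω.ne
  simpa only [toReal_enorm, ENNReal.coe_toNNReal_eq_toReal] using ENNReal.toReal_mono hfin.ne hle

/-- Every moment of the increments of `V` over `[0, 1]` is of Hölder type with exponent `κ`. -/
def HasHolderMoments (V : ℝ → Ω → E) (P : Measure Ω) (κ : ℝ) : Prop :=
  ∀ p : ℕ, ∃ C : ℝ≥0, ∀ s ∈ Icc (0 : ℝ) 1, ∀ t ∈ Icc (0 : ℝ) 1,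
    eLpNorm (V t - V s) p P ≤ ENNReal.ofReal (C * |t - s| ^ κ)

variable {V : ℝ → Ω → E} {κ : ℝ}

theorem HasHolderMoments.tendsto_eLpNorm_dyadicFloor_sub (hmom : HasHolderMoments V P κ)
    (hκ : 0 < κ) (p : ℕ) {t : ℝ} (ht : t ∈ Icc (0 : ℝ) 1) :
    Tendsto (fun n => eLpNorm (V (dyadicFloor n t) - V t) p P) atTop (𝓝 0) := by
  obtain ⟨C, hC⟩ := hmom p
  have hlim : Tendsto (fun n => ENNReal.ofReal (C * |dyadicFloor n t - t| ^ κ)) atTop (𝓝 0) := by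
    have := ((tendsto_dyadicFloor ht.1).rpow_const (p := κ) (Or.inr hκ.le)).const_mul (C : ℝ)
    rw [Real.zero_rpow hκ.ne', mul_zero] at this
    simpa using ENNReal.tendsto_ofReal this
  exact tendsto_of_tendsto_of_tendsto_of_le_of_le tendsto_const_nhds hlim (fun _ => zero_le)
    fun n => hC _ ht _ (dyadicFloor_mem_Icc ht)

variable [NormedSpace ℝ E]

theorem eLpNorm_normalized_dyadic_increment_le {C r : ℝ} {p : ℕ}
    (hC : ∀ s ∈ Icc (0 : ℝ) 1, ∀ t ∈ Icc (0 : ℝ) 1,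
      eLpNorm (V t - V s) p P ≤ ENNReal.ofReal (C * |t - s| ^ κ)) {n k : ℕ} (hk : k < 2 ^ n) :
    eLpNorm ((((1 / 2 : ℝ) ^ r) ^ n)⁻¹ • (V ((k + 1 : ℕ) / 2 ^ n) - V (k / 2 ^ n))) p P ≤
      ENNReal.ofReal (C * ((1 / 2 : ℝ) ^ (κ - r)) ^ n) := by
  have hmem : ∀ j : ℕ, j ≤ 2 ^ n → ((j : ℝ) / 2 ^ n) ∈ Icc (0 : ℝ) 1 := fun j hj =>
    ⟨by positivity, (div_le_one (by positivity)).2 (by exact_mod_cast hj)⟩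
  have hstep : |((k + 1 : ℕ) : ℝ) / 2 ^ n - k / 2 ^ n| = (1 / 2) ^ n := by
    rw [one_div, inv_pow, ← abs_of_pos (inv_pos.2 (by positivity : (0 : ℝ) < 2 ^ n))]
    congr 1
    push_cast
    field_simp
    ring
  have hsplit : ((1 / 2 : ℝ) ^ n) ^ κ = ((1 / 2 : ℝ) ^ r) ^ n * ((1 / 2 : ℝ) ^ (κ - r)) ^ n := by
    rw [← mul_pow, ← Real.rpow_add (by norm_num), add_sub_cancel,
      ← Real.rpow_mul_natCast (by norm_num), ← Real.rpow_natCast_mul (by norm_num), mul_comm]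
  have hincr := hC _ (hmem k hk.le) _ (hmem (k + 1) hk)
  rw [hstep, hsplit] at hincr
  rw [eLpNorm_const_smul, Real.enorm_of_nonneg (by positivity)]
  refine (mul_le_mul_right hincr _).trans_eq ?_
  rw [← ENNReal.ofReal_mul (by positivity)]
  congr 1
  field_simp

theorem tsum_sigma_fin_two_pow_ofReal_ne_top {A c : ℝ} (hc : 0 ≤ c) (hc' : 2 * c < 1) :
    ∑' x : Σ n : ℕ, Fin (2 ^ n), ENNReal.ofReal (A * c ^ x.1) ≠ ∞ := by
  have hlevel : ∀ n : ℕ, ∑' _ : Fin (2 ^ n), ENNReal.ofReal (A * c ^ n) =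
      ENNReal.ofReal (A * (2 * c) ^ n) := fun n => by
    rw [tsum_fintype, Finset.sum_const, Finset.card_univ, Fintype.card_fin, nsmul_eq_mul,
      ← ENNReal.ofReal_natCast, ← ENNReal.ofReal_mul (by positivity), mul_pow]
    congr 1
    push_cast
    ring
  rw [ENNReal.tsum_sigma fun (n : ℕ) (_ : Fin (2 ^ n)) => ENNReal.ofReal (A * c ^ n)]
  simp only [hlevel]
  exact ((summable_geometric_of_lt_one (by positivity) hc').mul_left A).tsum_ofReal_ne_top

theorem HasHolderMoments.ae_exists_hasDyadicDecay
    (hV : ∀ t ∈ Icc (0 : ℝ) 1, AEStronglyMeasurable (V t) P) (hmom : HasHolderMoments V P κ)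
    {r : ℝ} (hr : r < κ) :
    ∀ᵐ ω ∂P, ∃ S : ℝ, HasDyadicDecay (fun t => V t ω) S ((1 / 2 : ℝ) ^ r) := by
  set a : ℝ := (1 / 2 : ℝ) ^ (κ - r)
  have ha0 : 0 < a := Real.rpow_pos_of_pos (by norm_num) _
  have ha1 : a < 1 := Real.rpow_lt_one (by norm_num) (by norm_num) (by linarith)
  -- The moment of order `p` must beat the `2 ^ n` intervals of level `n`.
  obtain ⟨p, hp0, hap⟩ : ∃ p : ℕ, p ≠ 0 ∧ 2 * a ^ p < 1 := by
    obtain ⟨q, hq⟩ := exists_pow_lt_of_lt_one (show (0 : ℝ) < 1 / 2 by norm_num) ha1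
    refine ⟨q + 1, q.succ_ne_zero, ?_⟩
    linarith [pow_le_pow_of_le_one ha0.le ha1.le (Nat.le_add_right q 1)]
  obtain ⟨C, hC⟩ := hmom p
  have hmem : ∀ n k : ℕ, k ≤ 2 ^ n → ((k : ℝ) / 2 ^ n) ∈ Icc (0 : ℝ) 1 := fun n k hk =>
    ⟨by positivity, (div_le_one (by positivity)).2 (by exact_mod_cast hk)⟩
  set G : (Σ n : ℕ, Fin (2 ^ n)) → Ω → E := fun x =>
    (((1 / 2 : ℝ) ^ r) ^ x.1)⁻¹ • (V ((x.2 + 1 : ℕ) / 2 ^ x.1) - V (x.2 / 2 ^ x.1))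
  have hGmeas : ∀ x, AEStronglyMeasurable (G x) P := fun ⟨n, k⟩ =>
    ((hV _ (hmem n _ k.2)).sub (hV _ (hmem n _ k.2.le))).const_smul _
  have hGsum : ∑' x, eLpNorm (G x) p P ^ p ≠ ∞ := by
    refine ne_top_of_le_ne_top (tsum_sigma_fin_two_pow_ofReal_ne_top (A := (C : ℝ) ^ p)
      (by positivity) hap) (ENNReal.tsum_le_tsum fun ⟨n, k⟩ => ?_)
    rw [← pow_mul, mul_comm p, pow_mul, ← mul_pow, ENNReal.ofReal_pow (by positivity)]
    exact pow_le_pow_left₀ zero_le (eLpNorm_normalized_dyadic_increment_le hC k.2) p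
  filter_upwards [ae_exists_forall_norm_le hp0 hGmeas hGsum] with ω ⟨S, hS⟩
  refine ⟨S, fun n k hk => ?_⟩
  have hb : (0 : ℝ) < ((1 / 2 : ℝ) ^ r) ^ n := pow_pos (Real.rpow_pos_of_pos (by norm_num) _) n
  have hle := hS ⟨n, k, hk⟩
  simp only [G, Pi.smul_apply, Pi.sub_apply, norm_smul, norm_inv, Real.norm_of_nonneg hb.le] at hle
  rwa [inv_mul_le_iff₀ hb, mul_comm] at hle

theorem HasHolderMoments.exists_holder_modification [CompleteSpace E] (hκ : 0 < κ)
    (hV : ∀ t ∈ Icc (0 : ℝ) 1, AEStronglyMeasurable (V t) P) (hmom : HasHolderMoments V P κ) :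
    ∃ U : ℝ → Ω → E, (∀ t ∈ Icc (0 : ℝ) 1, U t =ᵐ[P] V t) ∧
      ∀ r : ℝ≥0, (r : ℝ) < κ →
        ∀ᵐ ω ∂P, ∃ K : ℝ≥0, HolderOnWith K r (fun t => U t ω) (Icc 0 1) := by
  refine ⟨fun t ω => dyadicLimit (fun t => V t ω) t, fun t ht => ?_, fun r hr => ?_⟩
  · obtain ⟨φ, hφ, hVφ⟩ := (tendstoInMeasure_of_tendsto_eLpNorm (p := (1 : ℕ)) (by norm_num)
      (fun n => hV _ (dyadicFloor_mem_Icc ht)) (hV t ht)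
      (hmom.tendsto_eLpNorm_dyadicFloor_sub hκ 1 ht)).exists_seq_tendsto_ae
    filter_upwards [hVφ, hmom.ae_exists_hasDyadicDecay hV (half_lt_self hκ)] with ω hω ⟨S, hS⟩
    exact tendsto_nhds_unique ((hS.tendsto_dyadicLimit (by positivity)
      (Real.rpow_lt_one (by norm_num) (by norm_num) (half_pos hκ)) ht).comp hφ.tendsto_atTop) hω
  · obtain ⟨r', hrr', hr'κ⟩ := exists_between hr
    lift r' to ℝ≥0 using r.coe_nonneg.trans hrr'.le
    filter_upwards [hmom.ae_exists_hasDyadicDecay hV hr'κ] with ω ⟨S, hS⟩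
    have hrr' : r < r' := by exact_mod_cast hrr'
    obtain ⟨K, hK⟩ := hS.exists_holderOnWith_dyadicLimit (pos_of_gt hrr')
    have hdiam : ∀ x ∈ Icc (0 : ℝ) 1, ∀ y ∈ Icc (0 : ℝ) 1, edist x y ≤ (1 : ℝ≥0) :=
      fun x hx y hy => by
        rw [edist_dist, ← ENNReal.ofReal_coe_nnreal]
        exact ENNReal.ofReal_le_ofReal (Real.dist_le_of_mem_Icc_01 hx hy)
    exact ⟨_, hK.of_le hdiam hrr'.le⟩

end Kolmogorov

/-! ### Random variables with moments of all orders -/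

/-- All moments of `F` are finite. -/
def AllMoments {Ω E : Type*} [MeasurableSpace Ω] [NormedAddCommGroup E] (F : Ω → E)
    (P : Measure Ω) : Prop :=
  ∀ p : ℕ, MemLp F p P

namespace AllMoments

variable {Ω Ω' E 𝕜 : Type*} [MeasurableSpace Ω] [MeasurableSpace Ω'] [NormedAddCommGroup E]
  [NormedField 𝕜] {P : Measure Ω} {Q : Measure Ω'} {F G : Ω → E} {u v : Ω → 𝕜}

theorem integrable (h : AllMoments F P) : Integrable F P :=
  memLp_one_iff_integrable.1 (by simpa using h 1)

theorem memLp_two (h : AllMoments F P) : MemLp F 2 P := by simpa using h 2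

theorem add (hF : AllMoments F P) (hG : AllMoments G P) :
    AllMoments (fun ω => F ω + G ω) P := fun p => (hF p).add (hG p)

theorem sub (hF : AllMoments F P) (hG : AllMoments G P) :
    AllMoments (fun ω => F ω - G ω) P := fun p => (hF p).sub (hG p)

theorem sum {κ : Type*} (s : Finset κ) {F : κ → Ω → E} (h : ∀ i ∈ s, AllMoments (F i) P) :
    AllMoments (fun ω => ∑ i ∈ s, F i ω) P := fun p => memLp_finsetSum s fun i hi => h i hi p

theorem smul [NormedSpace 𝕜 E] (hu : AllMoments u P) (hG : AllMoments G P) :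
    AllMoments (fun ω => u ω • G ω) P := fun p => by
  have : ENNReal.HolderTriple (2 * p : ℕ) (2 * p : ℕ) (p : ℝ≥0∞) := ⟨by
    push_cast
    rw [ENNReal.mul_inv (Or.inl (by norm_num)) (Or.inl (by norm_num)), ← add_mul,
      ENNReal.inv_two_add_inv_two, one_mul]⟩
  exact (hG (2 * p)).smul (hu (2 * p))

theorem mul (hu : AllMoments u P) (hv : AllMoments v P) : AllMoments (fun ω => u ω * v ω) P :=
  hu.smul hv

theorem const_mul (c : 𝕜) (hu : AllMoments u P) : AllMoments (fun ω => c * u ω) P :=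
  fun p => (hu p).const_mul c

theorem ofReal {F : Ω → ℝ} (h : AllMoments F P) : AllMoments (fun ω => (F ω : ℂ)) P :=
  fun p => (h p).ofReal

theorem star {F : Ω → ℂ} (h : AllMoments F P) :
    AllMoments (fun ω => (starRingEnd ℂ) (F ω)) P :=
  fun p => (h p).star

theorem comp_fst [IsFiniteMeasure Q] (h : AllMoments F P) :
    AllMoments (fun z : Ω × Ω' => F z.1) (P.prod Q) := fun p => (h p).comp_fst Q

variable [IsFiniteMeasure P]

theorem comp_snd {F : Ω' → E} [SFinite Q] (h : AllMoments F Q) :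
    AllMoments (fun z : Ω × Ω' => F z.2) (P.prod Q) := fun p => (h p).comp_snd P

theorem const (c : E) : AllMoments (fun _ : Ω => c) P := fun _ => memLp_const c

theorem prod {κ : Type*} (s : Finset κ) {u : κ → Ω → 𝕜} (h : ∀ i ∈ s, AllMoments (u i) P) :
    AllMoments (fun ω => ∏ i ∈ s, u i ω) P := by
  classical
  induction s using Finset.induction_on with
  | empty => simpa using const (1 : 𝕜)
  | insert a s ha ih =>
    simp only [Finset.prod_insert ha]
    exact (h a (Finset.mem_insert_self _ _)).mul
      (ih fun i hi => h i (Finset.mem_insert_of_mem hi))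

theorem pow (h : AllMoments u P) (n : ℕ) : AllMoments (fun ω => u ω ^ n) P := by
  simpa using prod (Finset.range n) (u := fun _ => u) fun _ _ => h

theorem aeval {F : Ω → ℝ} (h : AllMoments F P) (p : Polynomial ℤ) :
    AllMoments (fun ω => Polynomial.aeval (F ω) p) P := by
  simp only [Polynomial.aeval_eq_sum_range, zsmul_eq_mul]
  exact sum _ fun i _ => (h.pow i).const_mul _

end AllMoments

theorem allMoments_gaussianReal (v : ℝ≥0) :
    AllMoments (fun x : ℝ => x) (gaussianReal 0 v) :=
  fun p => memLp_id_gaussianReal' p (ENNReal.natCast_ne_top p)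

/-! ### Stein's identity -/

section Stein

theorem hasDerivAt_gaussianPDFReal {v : ℝ≥0} (hv : v ≠ 0) (x : ℝ) :
    HasDerivAt (gaussianPDFReal 0 v) (-(x / v) * gaussianPDFReal 0 v x) x := by
  have hv' : (v : ℝ) ≠ 0 := by exact_mod_cast hv
  have hexponent : HasDerivAt (fun x : ℝ => -(x - 0) ^ 2 / (2 * v)) (-(x / v)) x := by
    convert! (((hasDerivAt_id x).sub_const 0).pow 2).neg.div_const (2 * (v : ℝ)) using 1
    simp
    field_simp
  rw [gaussianPDFReal_def]
  convert! hexponent.exp.const_mul (√(2 * Real.pi * v))⁻¹ using 1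
  ring

variable {E : Type*} [NormedAddCommGroup E] [NormedSpace ℝ E] {v : ℝ≥0}

theorem integrable_gaussianReal_iff (hv : v ≠ 0) {f : ℝ → E} :
    Integrable f (gaussianReal 0 v) ↔ Integrable fun x => gaussianPDFReal 0 v x • f x := by
  rw [gaussianReal_of_var_ne_zero _ hv, integrable_withDensity_iff_integrable_smul'
    (measurable_gaussianPDF _ _) (ae_of_all _ fun _ => gaussianPDF_lt_top)]
  simp only [toReal_gaussianPDF]

theorem integral_smul_gaussianReal (hv : v ≠ 0) {f f' : ℝ → E}
    (hff' : ∀ x, HasDerivAt f (f' x) x)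
    (hf : Integrable f (gaussianReal 0 v)) (hxf : Integrable (fun x => x • f x) (gaussianReal 0 v))
    (hf' : Integrable f' (gaussianReal 0 v)) :
    ∫ x, x • f x ∂gaussianReal 0 v = (v : ℝ) • ∫ x, f' x ∂gaussianReal 0 v := by
  have hv' : (v : ℝ) ≠ 0 := by exact_mod_cast hv
  rw [integral_gaussianReal_eq_integral_smul hv, integral_gaussianReal_eq_integral_smul hv,
    ← integral_smul, ← sub_eq_zero]
  rw [integrable_gaussianReal_iff hv] at hf hxf hf'
  rw [← integral_sub hxf (show Integrable (fun x => (v : ℝ) • gaussianPDFReal 0 v x • f' x) from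
    hf'.smul (v : ℝ))]
  have hderiv : ∫ x, (-(v : ℝ)) • (gaussianPDFReal 0 v x • f' x +
      (-(x / v) * gaussianPDFReal 0 v x) • f x) = 0 := by
    rw [integral_smul, integral_eq_zero_of_hasDerivAt_of_integrable
      (f := fun x => gaussianPDFReal 0 v x • f x)
      (fun x => (hasDerivAt_gaussianPDFReal hv x).smul (hff' x)) ?_ hf, smul_zero]
    refine hf'.add ((hxf.smul (-(v : ℝ)⁻¹)).congr (ae_of_all _ fun x => ?_))
    simp only [Pi.smul_apply, smul_smul]
    congr 1
    ring
  rw [← hderiv]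
  refine integral_congr_ae (ae_of_all _ fun x => ?_)
  have hcoeff : -(v : ℝ) * (-(x / v) * gaussianPDFReal 0 v x) = gaussianPDFReal 0 v x * x := by
    field_simp
  simp only [smul_smul, smul_add]
  rw [hcoeff, neg_mul, neg_smul]
  abel

variable {Ω : Type*} [MeasurableSpace Ω] {Q : Measure Ω} [SFinite Q]

theorem integral_fst_smul_gaussianReal_prod (hv : v ≠ 0) {f f' : ℝ × Ω → E}
    (hff' : ∀ x y, HasDerivAt (fun x => f (x, y)) (f' (x, y)) x)
    (hf : Integrable f ((gaussianReal 0 v).prod Q))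
    (hxf : Integrable (fun z => z.1 • f z) ((gaussianReal 0 v).prod Q))
    (hf' : Integrable f' ((gaussianReal 0 v).prod Q)) :
    ∫ z, z.1 • f z ∂(gaussianReal 0 v).prod Q = (v : ℝ) • ∫ z, f' z ∂(gaussianReal 0 v).prod Q := by
  rw [integral_prod_symm _ hxf, integral_prod_symm _ hf', ← integral_smul]
  refine integral_congr_ae ?_
  filter_upwards [hf.prod_left_ae, hxf.prod_left_ae, hf'.prod_left_ae] with y hfy hxfy hf'y
  exact integral_smul_gaussianReal hv (fun x => hff' x y) hfy hxfy hf'y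

theorem integral_snd_smul_prod_gaussianReal (hv : v ≠ 0) {f f' : Ω × ℝ → E}
    (hff' : ∀ x y, HasDerivAt (fun y => f (x, y)) (f' (x, y)) y)
    (hf : Integrable f (Q.prod (gaussianReal 0 v)))
    (hyf : Integrable (fun z => z.2 • f z) (Q.prod (gaussianReal 0 v)))
    (hf' : Integrable f' (Q.prod (gaussianReal 0 v))) :
    ∫ z, z.2 • f z ∂Q.prod (gaussianReal 0 v) = (v : ℝ) • ∫ z, f' z ∂Q.prod (gaussianReal 0 v) := by
  rw [integral_prod _ hyf, integral_prod _ hf', ← integral_smul]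
  refine integral_congr_ae ?_
  filter_upwards [hf.prod_right_ae, hyf.prod_right_ae, hf'.prod_right_ae] with x hfx hyfx hf'x
  exact integral_smul_gaussianReal hv (hff' x) hfx hyfx hf'x

end Stein

/-! ### Hermite polynomials as Gaussian averages -/

theorem derivative_hermite_succ (n : ℕ) :
    Polynomial.derivative (Polynomial.hermite (n + 1)) =
      ((n : Polynomial ℤ) + 1) * Polynomial.hermite n := by
  induction n with
  | zero => simp
  | succ n ih =>
    rw [Polynomial.hermite_succ (n + 1), Polynomial.derivative_sub, Polynomial.derivative_mul,
      Polynomial.derivative_X, one_mul, ih, Polynomial.derivative_mul]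
    simp only [Polynomial.derivative_add, Polynomial.derivative_natCast, Polynomial.derivative_one,
      add_zero, zero_mul, zero_add]
    rw [Polynomial.hermite_succ n]
    push_cast
    ring

theorem hasDerivAt_linear_pow (c d : ℂ) (n : ℕ) (y : ℝ) :
    HasDerivAt (fun y : ℝ => (c + d * y) ^ n) (n * (c + d * y) ^ (n - 1) * d) y := by
  have hlinear : HasDerivAt (fun y : ℝ => c + d * (y : ℂ)) d y := by
    simpa using ((Complex.ofRealCLM.hasDerivAt (x := y)).const_mul d).const_add c
  exact hlinear.pow n

theorem allMoments_linear_pow (c d : ℂ) (n : ℕ) (v : ℝ≥0) :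
    AllMoments (fun y : ℝ => (c + d * y) ^ n) (gaussianReal 0 v) :=
  ((AllMoments.const c).add ((allMoments_gaussianReal v).ofReal.const_mul d)).pow n

theorem integral_linear_pow_succ (c d : ℂ) (n : ℕ) :
    ∫ y : ℝ, (c + d * y) ^ (n + 1) ∂gaussianReal 0 1 =
      c * ∫ y : ℝ, (c + d * y) ^ n ∂gaussianReal 0 1 +
        d ^ 2 * n * ∫ y : ℝ, (c + d * y) ^ (n - 1) ∂gaussianReal 0 1 := by
  have hmom := fun m => allMoments_linear_pow c d m 1
  have hymom := (allMoments_gaussianReal 1).smul (hmom n)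
  have hstein := integral_smul_gaussianReal one_ne_zero (hasDerivAt_linear_pow c d n)
    (hmom n).integrable hymom.integrable
    (((hmom (n - 1)).integrable.const_mul (n : ℂ)).mul_const d)
  rw [integral_mul_const, integral_const_mul, NNReal.coe_one, one_smul] at hstein
  have hexpand : ∀ y : ℝ, (c + d * y) ^ (n + 1) =
      c * (c + d * y) ^ n + d * (y • (c + d * (y : ℂ)) ^ n) := fun y => by
    rw [Complex.real_smul]
    ring
  simp only [hexpand]
  rw [integral_add ((hmom n).const_mul c).integrable (hymom.const_mul d).integrable,
    integral_const_mul, integral_const_mul, hstein]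
  ring

theorem aeval_hermite_eq_integral (x : ℝ) (n : ℕ) :
    ((Polynomial.aeval x (Polynomial.hermite n) : ℝ) : ℂ) =
      ∫ y : ℝ, ((x : ℂ) + Complex.I * y) ^ n ∂gaussianReal 0 1 := by
  induction n using Nat.strong_induction_on with
  | _ n ih =>
    match n with
    | 0 => simp
    | 1 =>
      rw [← zero_add 1, integral_linear_pow_succ]
      simp
    | n + 2 =>
      rw [integral_linear_pow_succ, Nat.add_sub_cancel, ← ih (n + 1) (by omega),
        ← ih n (by omega), Polynomial.hermite_succ (n + 1), derivative_hermite_succ, Complex.I_sq]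
      simp
      ring

/-! ### Moments of a standard complex Gaussian variable -/

/-- The mixed moment `E[Z ^ a * conj Z ^ b]` of the complex Gaussian variable `Z = x + i y`, where
`x` and `y` are independent standard real Gaussian variables. In this normalisation
`E[|Z| ^ 2] = 2`. -/
noncomputable def complexMoment (a b : ℕ) : ℂ :=
  ∫ z : ℝ × ℝ, ((z.1 : ℂ) + Complex.I * z.2) ^ a * ((z.1 : ℂ) - Complex.I * z.2) ^ b
    ∂(gaussianReal 0 1).prod (gaussianReal 0 1)

theorem allMoments_complexMoment (a b : ℕ) :
    AllMoments (fun z : ℝ × ℝ => ((z.1 : ℂ) + Complex.I * z.2) ^ a *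
      ((z.1 : ℂ) - Complex.I * z.2) ^ b) ((gaussianReal 0 1).prod (gaussianReal 0 1)) := by
  have hfst : AllMoments (fun z : ℝ × ℝ => (z.1 : ℂ))
      ((gaussianReal 0 1).prod (gaussianReal 0 1)) := (allMoments_gaussianReal 1).ofReal.comp_fst
  have hsnd : AllMoments (fun z : ℝ × ℝ => (z.2 : ℂ))
      ((gaussianReal 0 1).prod (gaussianReal 0 1)) := (allMoments_gaussianReal 1).ofReal.comp_snd
  exact ((hfst.add (hsnd.const_mul _)).pow a).mul ((hfst.sub (hsnd.const_mul _)).pow b)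

theorem integral_fst_smul_complexMonomial (a b : ℕ) :
    ∫ z : ℝ × ℝ, z.1 • (((z.1 : ℂ) + Complex.I * z.2) ^ a * ((z.1 : ℂ) - Complex.I * z.2) ^ b)
        ∂(gaussianReal 0 1).prod (gaussianReal 0 1) =
      a * complexMoment (a - 1) b + b * complexMoment a (b - 1) := by
  have hmom := fun a b => allMoments_complexMoment a b
  have hint := ((hmom (a - 1) b).const_mul (a : ℂ)).add ((hmom a (b - 1)).const_mul (b : ℂ))
  rw [integral_fst_smul_gaussianReal_prod one_ne_zero (fun x y => ?_) (hmom a b).integrable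
    ((allMoments_gaussianReal 1).comp_fst.smul (hmom a b)).integrable hint.integrable,
    integral_add ((hmom _ _).const_mul _).integrable ((hmom _ _).const_mul _).integrable,
    integral_const_mul, integral_const_mul, NNReal.coe_one, one_smul, complexMoment, complexMoment]
  convert! (hasDerivAt_linear_pow (Complex.I * y) 1 a x).mul
    (hasDerivAt_linear_pow (-(Complex.I * y)) 1 b x) using 1
  · ext x
    simp only [Pi.mul_apply]
    ring
  · ring

theorem integral_snd_smul_complexMonomial (a b : ℕ) :
    ∫ z : ℝ × ℝ, z.2 • (((z.1 : ℂ) + Complex.I * z.2) ^ a * ((z.1 : ℂ) - Complex.I * z.2) ^ b)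
        ∂(gaussianReal 0 1).prod (gaussianReal 0 1) =
      a * Complex.I * complexMoment (a - 1) b - b * Complex.I * complexMoment a (b - 1) := by
  have hmom := fun a b => allMoments_complexMoment a b
  have hint := ((hmom (a - 1) b).const_mul (a * Complex.I)).sub
    ((hmom a (b - 1)).const_mul (b * Complex.I))
  rw [integral_snd_smul_prod_gaussianReal one_ne_zero (fun x y => ?_) (hmom a b).integrable
    ((allMoments_gaussianReal 1).comp_snd.smul (hmom a b)).integrable hint.integrable,
    integral_sub ((hmom _ _).const_mul _).integrable ((hmom _ _).const_mul _).integrable,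
    integral_const_mul, integral_const_mul, NNReal.coe_one, one_smul, complexMoment, complexMoment]
  convert! (hasDerivAt_linear_pow x Complex.I a y).mul
    (hasDerivAt_linear_pow x (-Complex.I) b y) using 1
  · ext y
    simp only [Pi.mul_apply]
    ring
  · ring

/-- Multiplication by `Z` is adjoint to `∂₁ + i ∂₂`, which kills the powers of `Z`. -/
theorem complexMoment_succ (a b : ℕ) :
    complexMoment (a + 1) b = 2 * b * complexMoment a (b - 1) := by
  have hmom := allMoments_complexMoment a b
  have hfst : AllMoments (fun z : ℝ × ℝ => z.1 • (((z.1 : ℂ) + Complex.I * z.2) ^ a *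
      ((z.1 : ℂ) - Complex.I * z.2) ^ b)) ((gaussianReal 0 1).prod (gaussianReal 0 1)) :=
    (allMoments_gaussianReal 1).comp_fst.smul hmom
  have hsnd : AllMoments (fun z : ℝ × ℝ => z.2 • (((z.1 : ℂ) + Complex.I * z.2) ^ a *
      ((z.1 : ℂ) - Complex.I * z.2) ^ b)) ((gaussianReal 0 1).prod (gaussianReal 0 1)) :=
    (allMoments_gaussianReal 1).comp_snd.smul hmom
  calc complexMoment (a + 1) b
      = ∫ z : ℝ × ℝ, z.1 • (((z.1 : ℂ) + Complex.I * z.2) ^ a *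
            ((z.1 : ℂ) - Complex.I * z.2) ^ b) ∂(gaussianReal 0 1).prod (gaussianReal 0 1) +
          Complex.I * ∫ z : ℝ × ℝ, z.2 • (((z.1 : ℂ) + Complex.I * z.2) ^ a *
            ((z.1 : ℂ) - Complex.I * z.2) ^ b) ∂(gaussianReal 0 1).prod (gaussianReal 0 1) := by
        rw [complexMoment, ← integral_const_mul,
          ← integral_add hfst.integrable (hsnd.const_mul _).integrable]
        refine integral_congr_ae (ae_of_all _ fun z => ?_)
        simp only [Complex.real_smul]
        ring
    _ = 2 * b * complexMoment a (b - 1) := by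
        rw [integral_fst_smul_complexMonomial, integral_snd_smul_complexMonomial]
        linear_combination
          (a * complexMoment (a - 1) b - b * complexMoment a (b - 1)) * Complex.I_mul_I

theorem complexMoment_comm (a b : ℕ) :
    complexMoment a b = (starRingEnd ℂ) (complexMoment b a) := by
  rw [complexMoment, complexMoment, ← integral_conj]
  refine integral_congr_ae (ae_of_all _ fun z => ?_)
  simp [sub_eq_add_neg, mul_comm]

theorem complexMoment_eq (a b : ℕ) :
    complexMoment a b = if a = b then ((2 ^ a * a.factorial : ℕ) : ℂ) else 0 := by
  induction a generalizing b with
  | zero =>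
    cases b with
    | zero => simp [complexMoment]
    | succ b => simp [complexMoment_comm 0, complexMoment_succ]
  | succ a ih =>
    rw [complexMoment_succ]
    cases b with
    | zero => simp
    | succ b =>
      rw [Nat.add_sub_cancel, ih]
      rcases eq_or_ne a b with rfl | hab
      · simp only [if_true, Nat.factorial_succ]
        push_cast
        ring
      · simp [hab]

/-! ### Homogeneous chaos over independent standard Gaussian variables -/

section Wick

variable {Ω ι Q : Type*} [Fintype Q]

section Mult

open scoped Classical in
/-- The multiplicity of the value `j` in the family `k`. -/
noncomputable def mult (k : Q → ι) (j : ι) : ℕ :=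
  (Finset.univ.filter fun q => k q = j).card

theorem mult_ne_zero_iff {k : Q → ι} {j : ι} : mult k j ≠ 0 ↔ ∃ q, k q = j := by
  classical
  rw [mult, Finset.card_ne_zero]
  exact ⟨fun ⟨q, hq⟩ => ⟨q, (Finset.mem_filter.1 hq).2⟩, fun ⟨q, hq⟩ => ⟨q, by simp [hq]⟩⟩

theorem mem_of_mult_ne_zero {T : Finset ι} {k : Q → ι} (hk : ∀ q, k q ∈ T) {j : ι}
    (hj : mult k j ≠ 0) : j ∈ T := by
  obtain ⟨q, rfl⟩ := mult_ne_zero_iff.1 hj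
  exact hk q

theorem prod_comp_eq_prod_pow_mult {M : Type*} [CommMonoid M] {T : Finset ι} {k : Q → ι}
    (hk : ∀ q, k q ∈ T) (x : ι → M) : ∏ q, x (k q) = ∏ j ∈ T, x j ^ mult k j := by
  classical
  rw [← Finset.prod_fiberwise_of_maps_to (t := T) (g := k) fun q _ => hk q]
  refine Finset.prod_congr rfl fun j _ => ?_
  rw [Finset.prod_congr rfl (g := fun _ => x j) fun q hq => by
    rw [(Finset.mem_filter.1 hq).2], Finset.prod_const, mult]

theorem sum_mult {T : Finset ι} {k : Q → ι} (hk : ∀ q, k q ∈ T) :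
    ∑ j ∈ T, mult k j = Fintype.card Q := by
  classical
  rw [← Finset.card_univ, Finset.card_eq_sum_card_fiberwise (t := T) (f := k) fun q _ => hk q]
  exact Finset.sum_congr rfl fun j _ => by rw [mult]

theorem card_filter_mult_eq_le (S : Finset (Q → ι)) (k : Q → ι)
    [DecidablePred fun k' : Q → ι => mult k = mult k'] :
    (S.filter (mult k = mult ·)).card ≤ Fintype.card Q ^ Fintype.card Q := by
  classical
  have hsub : S.filter (mult k = mult ·) ⊆ Fintype.piFinset fun _ : Q => Finset.univ.image k :=
    fun k' hk' => Fintype.mem_piFinset.2 fun q => by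
      have hmult := (Finset.mem_filter.1 hk').2
      obtain ⟨q', hq'⟩ := mult_ne_zero_iff.1 (hmult ▸ mult_ne_zero_iff.2 ⟨q, rfl⟩ :
        mult k (k' q) ≠ 0)
      exact Finset.mem_image.2 ⟨q', Finset.mem_univ _, hq'⟩
  refine (Finset.card_le_card hsub).trans ?_
  rw [Fintype.card_piFinset, Finset.prod_const, Finset.card_univ]
  exact Nat.pow_le_pow_left Finset.card_image_le _

end Mult

section Covariance

/-- The covariance `E[∏ Z_{k q} * conj (∏ Z_{k' q})]` for independent complex Gaussian variables
`Z_j` with `E[|Z_j| ^ 2] = 2`. -/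
noncomputable def wickCovariance (k k' : Q → ι) : ℝ :=
  open scoped Classical in
  if mult k = mult k' then 2 ^ Fintype.card Q * (∏ᶠ j, (mult k j).factorial : ℕ) else 0

theorem wickCovariance_nonneg (k k' : Q → ι) : 0 ≤ wickCovariance k k' := by
  rw [wickCovariance]
  split_ifs <;> positivity

theorem wickCovariance_comm (k k' : Q → ι) : wickCovariance k k' = wickCovariance k' k := by
  rw [wickCovariance, wickCovariance]
  split_ifs with hkk' hk'k hk'k
  · rw [hkk']
  · exact absurd hkk'.symm hk'k
  · exact absurd hk'k.symm hkk'
  · rfl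

theorem finprod_mult_factorial {T : Finset ι} {k : Q → ι} (hk : ∀ q, k q ∈ T) :
    ∏ᶠ j, (mult k j).factorial = ∏ j ∈ T, (mult k j).factorial :=
  finprod_eq_finsetProd_of_mulSupport_subset _ fun j hj =>
    mem_of_mult_ne_zero hk fun hzero => hj (by simp [hzero])

theorem prod_complexMoment_mult {T : Finset ι} {k k' : Q → ι} (hk : ∀ q, k q ∈ T)
    (hk' : ∀ q, k' q ∈ T) :
    ∏ j ∈ T, complexMoment (mult k j) (mult k' j) = wickCovariance k k' := by
  rw [wickCovariance]
  split_ifs with hmult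
  · simp only [complexMoment_eq, hmult, if_true]
    rw [finprod_mult_factorial hk', ← sum_mult hk', ← Finset.prod_pow_eq_pow_sum]
    push_cast
    rw [Finset.prod_mul_distrib]
  · obtain ⟨j, hj⟩ := Function.ne_iff.1 hmult
    have hjT : j ∈ T := by
      by_contra hjT
      exact hj ((not_ne_iff.1 fun h => hjT (mem_of_mult_ne_zero hk h)).trans
        (not_ne_iff.1 fun h => hjT (mem_of_mult_ne_zero hk' h)).symm)
    rw [Finset.prod_eq_zero hjT (by rw [complexMoment_eq, if_neg hj]), Complex.ofReal_zero]

theorem wickCovariance_le (k k' : Q → ι) :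
    wickCovariance k k' ≤ 2 ^ Fintype.card Q * (Fintype.card Q).factorial := by
  classical
  rw [wickCovariance]
  split_ifs
  · have hk : ∀ q, k q ∈ Finset.univ.image k := fun q => by simp
    rw [finprod_mult_factorial hk, ← sum_mult hk]
    gcongr
    exact Nat.le_of_dvd (Nat.factorial_pos _) (Nat.prod_factorial_dvd_factorial_sum _ _)
  · positivity

/-- The constant in the second moment bound for homogeneous polynomials: the bound
`2 ^ |Q| * |Q|!` of the covariances, times the bound `|Q| ^ |Q|` of the number of families
with prescribed multiplicities. -/
def wickConst (Q : Type*) [Fintype Q] : ℝ :=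
  2 ^ Fintype.card Q * (Fintype.card Q).factorial * (Fintype.card Q) ^ Fintype.card Q

theorem wickConst_nonneg (Q : Type*) [Fintype Q] : 0 ≤ wickConst Q := by
  unfold wickConst
  positivity

theorem sum_wickCovariance_le (S : Finset (Q → ι)) (k : Q → ι) :
    ∑ k' ∈ S, wickCovariance k k' ≤ wickConst Q := by
  classical
  calc ∑ k' ∈ S, wickCovariance k k'
      = ∑ k' ∈ S.filter (mult k = mult ·), wickCovariance k k' := by
        refine (Finset.sum_filter_of_ne fun k' _ hne => ?_).symm
        exact not_not.1 fun h => hne (by rw [wickCovariance, if_neg h])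
    _ ≤ (S.filter (mult k = mult ·)).card • (2 ^ Fintype.card Q * (Fintype.card Q).factorial : ℝ) :=
        Finset.sum_le_card_nsmul _ _ _ fun k' _ => wickCovariance_le k k'
    _ ≤ wickConst Q := by
        rw [nsmul_eq_mul, wickConst, mul_comm]
        gcongr
        exact_mod_cast card_filter_mult_eq_le S k

theorem schur_test {κ : Type*} (S : Finset κ) (c : κ → ℝ) {r : κ → κ → ℝ} {M : ℝ}
    (hr : ∀ k k', 0 ≤ r k k') (hrow : ∀ k, ∑ k' ∈ S, r k k' ≤ M)
    (hcol : ∀ k', ∑ k ∈ S, r k k' ≤ M) :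
    ∑ k ∈ S, ∑ k' ∈ S, c k * c k' * r k k' ≤ M * ∑ k ∈ S, c k ^ 2 := by
  calc ∑ k ∈ S, ∑ k' ∈ S, c k * c k' * r k k'
      ≤ ∑ k ∈ S, ∑ k' ∈ S, (c k ^ 2 / 2 * r k k' + c k' ^ 2 / 2 * r k k') := by
        refine Finset.sum_le_sum fun k _ => Finset.sum_le_sum fun k' _ => ?_
        rw [← add_mul]
        exact mul_le_mul_of_nonneg_right (by linarith [two_mul_le_add_sq (c k) (c k')]) (hr k k')
    _ = ∑ k ∈ S, c k ^ 2 / 2 * ∑ k' ∈ S, r k k' + ∑ k' ∈ S, c k' ^ 2 / 2 * ∑ k ∈ S, r k k' := by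
        simp only [Finset.sum_add_distrib, Finset.mul_sum]
        congr 1
        exact Finset.sum_comm
    _ ≤ ∑ k ∈ S, c k ^ 2 / 2 * M + ∑ k ∈ S, c k ^ 2 / 2 * M := by
        gcongr with k _ k _
        · exact hrow k
        · exact hcol k
    _ = M * ∑ k ∈ S, c k ^ 2 := by
        rw [← Finset.sum_add_distrib, Finset.mul_sum]
        exact Finset.sum_congr rfl fun k _ => by ring

end Covariance

/-- The complex variable `G_j(ω) + i G_j(ω')` built from two independent copies of `G_j`. -/
noncomputable def complexify (G : ι → Ω → ℝ) (j : ι) (z : Ω × Ω) : ℂ :=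
  (G j z.1 : ℂ) + Complex.I * G j z.2

/-- The homogeneous polynomial `∑_{k ∈ S} c_k ∏_q Z_{k q}` in the complexified variables `Z_j`. -/
noncomputable def complexSum (G : ι → Ω → ℝ) (S : Finset (Q → ι)) (c : (Q → ι) → ℝ)
    (z : Ω × Ω) : ℂ :=
  ∑ k ∈ S, (c k : ℂ) * ∏ q, complexify G (k q) z

/-- The Wick product of the variables `G_{k q}`, a product of Hermite polynomials. For
`G = W ∘ e` this is the multiple integral `basisIntegral W e k`. -/
noncomputable def hermiteProd (G : ι → Ω → ℝ) (k : Q → ι) (ω : Ω) : ℝ :=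
  open scoped Classical in
  ∏ j ∈ Finset.univ.image k, Polynomial.aeval (G j ω) (Polynomial.hermite (mult k j))

theorem complexSum_pow_eq (G : ι → Ω → ℝ) (S : Finset (Q → ι)) (c : (Q → ι) → ℝ) (p : ℕ) :
    ∃ (S' : Finset (Fin p × Q → ι)) (c' : (Fin p × Q → ι) → ℝ),
      ∑ κ ∈ S', c' κ ^ 2 = (∑ k ∈ S, c k ^ 2) ^ p ∧
      ∀ z, complexSum G S' c' z = complexSum G S c z ^ p := by
  classical
  let curry : (Fin p × Q → ι) ≃ (Fin p → Q → ι) := Equiv.curry _ _ _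
  have hpow : ∀ {R : Type} [CommSemiring R] (x : R), x ^ p = ∏ _a : Fin p, x := fun x => by simp
  refine ⟨(Fintype.piFinset fun _ : Fin p => S).map curry.symm.toEmbedding,
    fun κ => ∏ a, c (curry κ a), ?_, fun z => ?_⟩
  · rw [hpow, Finset.prod_univ_sum, Finset.sum_map]
    simp only [Equiv.coe_toEmbedding, Equiv.apply_symm_apply, Finset.prod_pow]
  · simp only [complexSum]
    rw [hpow, Finset.prod_univ_sum, Finset.sum_map]
    refine Finset.sum_congr rfl fun K _ => ?_
    simp only [Equiv.coe_toEmbedding, Equiv.apply_symm_apply]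
    rw [Finset.prod_mul_distrib, Fintype.prod_prod_type, Complex.ofReal_prod]
    rfl

theorem hermiteProd_eq_prod (G : ι → Ω → ℝ) {T : Finset ι} {k : Q → ι} (hk : ∀ q, k q ∈ T)
    (ω : Ω) :
    hermiteProd G k ω = ∏ j ∈ T, Polynomial.aeval (G j ω) (Polynomial.hermite (mult k j)) := by
  classical
  rw [hermiteProd]
  refine Finset.prod_subset (Finset.image_subset_iff.2 fun q _ => hk q) fun j _ hj => ?_
  have hzero : mult k j = 0 := by
    refine not_ne_iff.1 fun hne => hj ?_
    exact mem_of_mult_ne_zero (fun q => Finset.mem_image_of_mem k (Finset.mem_univ q)) hne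
  simp [hzero]

variable [MeasurableSpace Ω] {P : Measure Ω} {G : ι → Ω → ℝ}

theorem AllMoments.of_hasLaw {X : Ω → ℝ} {ν : Measure ℝ} (hν : AllMoments (fun x : ℝ => x) ν)
    (hX : HasLaw X ν P) : AllMoments X P := fun p => by
  have hmap := hν p
  rw [← hX.map_eq] at hmap
  exact (memLp_map_measure_iff hmap.1 hX.aemeasurable).1 hmap

theorem integral_finsetProd_comp_eq_prod_integral {ν : ι → Measure ℝ} (hind : iIndepFun G P)
    (hlaw : ∀ j, HasLaw (G j) (ν j) P) (T : Finset ι) {f : ι → ℝ → ℂ}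
    (hf : ∀ j, AEStronglyMeasurable (f j) (ν j)) :
    ∫ ω, ∏ j ∈ T, f j (G j ω) ∂P = ∏ j ∈ T, ∫ x, f j x ∂ν j := by
  have hprod := (hind.restrict T).integral_fun_prod_comp (f := fun j : T => f j)
    (fun j => (hlaw j).aemeasurable) fun j => by simpa [(hlaw j).map_eq] using hf j
  simp only [Finset.restrict] at hprod
  calc ∫ ω, ∏ j ∈ T, f j (G j ω) ∂P
      = ∫ ω, ∏ j : T, f j (G j ω) ∂P := by
        simp only [fun ω => Finset.prod_coe_sort T (fun j => f j (G j ω))]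
    _ = ∏ j ∈ T, ∫ ω, f j (G j ω) ∂P := by
        rw [hprod, Finset.prod_coe_sort T (fun j => ∫ ω, f j (G j ω) ∂P)]
    _ = ∏ j ∈ T, ∫ x, f j x ∂ν j :=
        Finset.prod_congr rfl fun j _ => (hlaw j).integral_comp (hf j)

theorem hermiteProd_eq_integral (hind : iIndepFun G P)
    (hlaw : ∀ j, HasLaw (G j) (gaussianReal 0 1) P) (k : Q → ι) (ω : Ω) :
    (hermiteProd G k ω : ℂ) = ∫ ω', ∏ q, complexify G (k q) (ω, ω') ∂P := by
  classical
  have hk : ∀ q, k q ∈ Finset.univ.image k := fun q => by simp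
  have hcont : ∀ j, Continuous fun y : ℝ => ((G j ω : ℂ) + Complex.I * y) ^ mult k j :=
    fun j => by fun_prop
  rw [hermiteProd_eq_prod G hk, Complex.ofReal_prod]
  simp only [aeval_hermite_eq_integral]
  rw [← integral_finsetProd_comp_eq_prod_integral hind hlaw _
    fun j => (hcont j).aestronglyMeasurable]
  exact integral_congr_ae (ae_of_all _ fun ω' =>
    (prod_comp_eq_prod_pow_mult hk fun j => complexify G j (ω, ω')).symm)

theorem aestronglyMeasurable_hermiteProd (hG : ∀ j, AEMeasurable (G j) P) (k : Q → ι) :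
    AEStronglyMeasurable (hermiteProd G k) P := by
  unfold hermiteProd
  exact Finset.aestronglyMeasurable_fun_prod _ fun j _ =>
    (Polynomial.continuous_aeval _).comp_aestronglyMeasurable (hG j).aestronglyMeasurable

variable [IsProbabilityMeasure P]

theorem allMoments_complexify (hlaw : ∀ j, HasLaw (G j) (gaussianReal 0 1) P) (j : ι) :
    AllMoments (complexify G j) (P.prod P) :=
  have hG := AllMoments.of_hasLaw (allMoments_gaussianReal 1) (hlaw j)
  hG.ofReal.comp_fst.add (hG.ofReal.comp_snd.const_mul _)

theorem allMoments_prod_complexify (hlaw : ∀ j, HasLaw (G j) (gaussianReal 0 1) P) (k : Q → ι) :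
    AllMoments (fun z => ∏ q, complexify G (k q) z) (P.prod P) :=
  AllMoments.prod _ fun q _ => allMoments_complexify hlaw (k q)

theorem allMoments_complexSum (hlaw : ∀ j, HasLaw (G j) (gaussianReal 0 1) P)
    (S : Finset (Q → ι)) (c : (Q → ι) → ℝ) : AllMoments (complexSum G S c) (P.prod P) :=
  AllMoments.sum S fun k _ => (allMoments_prod_complexify hlaw k).const_mul _

theorem integral_prod_complexify (hind : iIndepFun G P)
    (hlaw : ∀ j, HasLaw (G j) (gaussianReal 0 1) P) (T : Finset ι) (a b : ι → ℕ) :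
    ∫ z, ∏ j ∈ T, (complexify G j z ^ a j * (starRingEnd ℂ) (complexify G j z) ^ b j)
      ∂P.prod P = ∏ j ∈ T, complexMoment (a j) (b j) := by
  set φ : ι → ℝ → ℝ → ℂ := fun j x y =>
    ((x : ℂ) + Complex.I * y) ^ a j * ((x : ℂ) - Complex.I * y) ^ b j with hφ
  have hφ_cont : ∀ j, Continuous (Function.uncurry (φ j)) := fun j => by
    simp only [hφ, Function.uncurry_def]
    fun_prop
  have hfactor : ∀ j z, complexify G j z ^ a j * (starRingEnd ℂ) (complexify G j z) ^ b j =
      φ j (G j z.1) (G j z.2) := fun j z => by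
    simp [complexify, hφ, sub_eq_add_neg]
  have hmom : AllMoments (fun z => ∏ j ∈ T, (complexify G j z ^ a j *
      (starRingEnd ℂ) (complexify G j z) ^ b j)) (P.prod P) :=
    AllMoments.prod T fun j _ => ((allMoments_complexify hlaw j).pow _).mul
      ((allMoments_complexify hlaw j).star.pow _)
  rw [integral_prod _ hmom.integrable]
  simp only [hfactor]
  have hinner : ∀ ω, ∫ ω', ∏ j ∈ T, φ j (G j ω) (G j ω') ∂P =
      ∏ j ∈ T, ∫ y, φ j (G j ω) y ∂gaussianReal 0 1 := fun ω =>
    integral_finsetProd_comp_eq_prod_integral hind hlaw T fun j =>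
      ((hφ_cont j).comp (Continuous.prodMk_right _)).aestronglyMeasurable
  simp only [hinner]
  rw [integral_finsetProd_comp_eq_prod_integral hind hlaw T
    (f := fun j x => ∫ y, φ j x y ∂gaussianReal 0 1)
    fun j => (hφ_cont j).stronglyMeasurable.integral_prod_right.aestronglyMeasurable]
  exact Finset.prod_congr rfl fun j _ =>
    (integral_prod _ (allMoments_complexMoment (a j) (b j)).integrable).symm

theorem integral_prod_complexify_mul_star (hind : iIndepFun G P)
    (hlaw : ∀ j, HasLaw (G j) (gaussianReal 0 1) P) (k k' : Q → ι) :
    ∫ z, (∏ q, complexify G (k q) z) * (starRingEnd ℂ) (∏ q, complexify G (k' q) z)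
      ∂P.prod P = wickCovariance k k' := by
  classical
  set T := Finset.univ.image k ∪ Finset.univ.image k'
  have hk : ∀ q, k q ∈ T := fun q => Finset.mem_union_left _ (by simp)
  have hk' : ∀ q, k' q ∈ T := fun q => Finset.mem_union_right _ (by simp)
  rw [← prod_complexMoment_mult hk hk', ← integral_prod_complexify hind hlaw]
  refine integral_congr_ae (ae_of_all _ fun z => ?_)
  simp only [prod_comp_eq_prod_pow_mult hk (fun j => complexify G j z),
    prod_comp_eq_prod_pow_mult hk' (fun j => complexify G j z), map_prod, map_pow,
    Finset.prod_mul_distrib]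

theorem integral_norm_sq_complexSum_eq (hind : iIndepFun G P)
    (hlaw : ∀ j, HasLaw (G j) (gaussianReal 0 1) P) (S : Finset (Q → ι)) (c : (Q → ι) → ℝ) :
    ∫ z, ‖complexSum G S c z‖ ^ 2 ∂P.prod P =
      ∑ k ∈ S, ∑ k' ∈ S, c k * c k' * wickCovariance k k' := by
  have hexpand : ∀ z, ((‖complexSum G S c z‖ ^ 2 : ℝ) : ℂ) =
      ∑ k ∈ S, ∑ k' ∈ S, ((c k : ℂ) * c k') *
        ((∏ q, complexify G (k q) z) * (starRingEnd ℂ) (∏ q, complexify G (k' q) z)) := fun z => by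
    rw [← Complex.normSq_eq_norm_sq, ← Complex.mul_conj, complexSum, map_sum, Finset.sum_mul_sum]
    refine Finset.sum_congr rfl fun k _ => Finset.sum_congr rfl fun k' _ => ?_
    rw [map_mul, Complex.conj_ofReal]
    ring
  have hmom : ∀ k k', AllMoments (fun z => ((c k : ℂ) * c k') * ((∏ q, complexify G (k q) z) *
      (starRingEnd ℂ) (∏ q, complexify G (k' q) z))) (P.prod P) := fun k k' =>
    ((allMoments_prod_complexify hlaw k).mul (allMoments_prod_complexify hlaw k').star).const_mul _
  rw [← Complex.ofReal_inj, ← integral_complex_ofReal, integral_congr_ae (ae_of_all _ hexpand),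
    integral_finsetSum S fun k _ => (AllMoments.sum S fun k' _ => hmom k k').integrable]
  push_cast
  refine Finset.sum_congr rfl fun k _ => ?_
  rw [integral_finsetSum S fun k' _ => (hmom k k').integrable]
  refine Finset.sum_congr rfl fun k' _ => ?_
  rw [integral_const_mul, integral_prod_complexify_mul_star hind hlaw]

theorem integral_norm_sq_complexSum_le (hind : iIndepFun G P)
    (hlaw : ∀ j, HasLaw (G j) (gaussianReal 0 1) P) (S : Finset (Q → ι)) (c : (Q → ι) → ℝ) :
    ∫ z, ‖complexSum G S c z‖ ^ 2 ∂P.prod P ≤ wickConst Q * ∑ k ∈ S, c k ^ 2 := by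
  rw [integral_norm_sq_complexSum_eq hind hlaw]
  refine schur_test S c wickCovariance_nonneg (sum_wickCovariance_le S) fun k' => ?_
  simpa only [wickCovariance_comm _ k'] using sum_wickCovariance_le S k'

theorem integral_norm_pow_complexSum_le (hind : iIndepFun G P)
    (hlaw : ∀ j, HasLaw (G j) (gaussianReal 0 1) P) (S : Finset (Q → ι)) (c : (Q → ι) → ℝ)
    (p : ℕ) :
    ∫ z, ‖complexSum G S c z‖ ^ (2 * p) ∂P.prod P ≤
      wickConst (Fin p × Q) * (∑ k ∈ S, c k ^ 2) ^ p := by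
  obtain ⟨S', c', hcoeff, hpow⟩ := complexSum_pow_eq G S c p
  simpa only [hpow, hcoeff, norm_pow, ← pow_mul, mul_comm p 2] using
    integral_norm_sq_complexSum_le hind hlaw S' c'

theorem sum_hermiteProd_eq_integral (hind : iIndepFun G P)
    (hlaw : ∀ j, HasLaw (G j) (gaussianReal 0 1) P) (S : Finset (Q → ι)) (c : (Q → ι) → ℝ) :
    ∀ᵐ ω ∂P, ((∑ k ∈ S, c k * hermiteProd G k ω : ℝ) : ℂ) =
      ∫ ω', complexSum G S c (ω, ω') ∂P := by
  have hint : ∀ᵐ ω ∂P, ∀ k ∈ S, Integrable (fun ω' => ∏ q, complexify G (k q) (ω, ω')) P :=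
    (Filter.eventually_all_finset S).2 fun k _ =>
      (allMoments_prod_complexify hlaw k).integrable.prod_right_ae
  filter_upwards [hint] with ω hω
  simp only [complexSum]
  rw [integral_finsetSum S fun k hk => (hω k hk).const_mul _]
  push_cast
  refine Finset.sum_congr rfl fun k _ => ?_
  rw [integral_const_mul, hermiteProd_eq_integral hind hlaw]

theorem enorm_integral_pow_le_lintegral {E : Type*} [NormedAddCommGroup E] [NormedSpace ℝ E]
    {F : Ω → E} (hF : AEStronglyMeasurable F P) {m : ℕ} (hm : m ≠ 0) :
    ‖∫ ω, F ω ∂P‖ₑ ^ m ≤ ∫⁻ ω, ‖F ω‖ₑ ^ m ∂P := by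
  have hle : ‖∫ ω, F ω ∂P‖ₑ ≤ eLpNorm F m P := by
    refine (enorm_integral_le_lintegral_enorm _).trans ?_
    rw [← eLpNorm_one_eq_lintegral_enorm]
    exact eLpNorm_le_eLpNorm_of_exponent_le (by exact_mod_cast Nat.one_le_iff_ne_zero.2 hm) hF
  exact (pow_le_pow_left' hle m).trans_eq (eLpNorm_natCast_pow hm F)

/-- Conditioning on the first copy maps `∏ Z_{k q}` to the Wick product of the `G_{k q}`, so by
Jensen's inequality moments of a chaos are dominated by those of the complex polynomial, whose
powers are again homogeneous polynomials. -/
theorem lintegral_enorm_sum_hermiteProd_pow_le (hind : iIndepFun G P)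
    (hlaw : ∀ j, HasLaw (G j) (gaussianReal 0 1) P) (S : Finset (Q → ι)) (c : (Q → ι) → ℝ)
    {p : ℕ} (hp : p ≠ 0) :
    ∫⁻ ω, ‖∑ k ∈ S, c k * hermiteProd G k ω‖ₑ ^ (2 * p) ∂P ≤
      ENNReal.ofReal (wickConst (Fin p × Q) * (∑ k ∈ S, c k ^ 2) ^ p) := by
  have hmom := allMoments_complexSum hlaw S c (P := P)
  have hjensen : ∀ᵐ ω ∂P, ‖∑ k ∈ S, c k * hermiteProd G k ω‖ₑ ^ (2 * p) ≤
      ∫⁻ ω', ‖complexSum G S c (ω, ω')‖ₑ ^ (2 * p) ∂P := by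
    filter_upwards [sum_hermiteProd_eq_integral hind hlaw S c,
      hmom.integrable.1.prodMk_left] with ω hω hmeas
    rw [← ofReal_norm, ← Complex.norm_real, ofReal_norm, hω]
    exact enorm_integral_pow_le_lintegral hmeas (by positivity)
  have hint : Integrable (fun z => ‖complexSum G S c z‖ ^ (2 * p)) (P.prod P) := by
    exact_mod_cast (hmom (2 * p)).integrable_norm_pow (by positivity)
  calc ∫⁻ ω, ‖∑ k ∈ S, c k * hermiteProd G k ω‖ₑ ^ (2 * p) ∂P
      ≤ ∫⁻ ω, ∫⁻ ω', ‖complexSum G S c (ω, ω')‖ₑ ^ (2 * p) ∂P ∂P := lintegral_mono_ae hjensen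
    _ = ∫⁻ z, ‖complexSum G S c z‖ₑ ^ (2 * p) ∂P.prod P :=
        (lintegral_prod (fun z => ‖complexSum G S c z‖ₑ ^ (2 * p))
          (hmom.integrable.1.enorm.pow_const _)).symm
    _ = ENNReal.ofReal (∫ z, ‖complexSum G S c z‖ ^ (2 * p) ∂P.prod P) := by
        rw [ofReal_integral_eq_lintegral_ofReal hint (ae_of_all _ fun z => by positivity)]
        simp only [ENNReal.ofReal_pow (norm_nonneg _), ofReal_norm]
    _ ≤ _ := ENNReal.ofReal_le_ofReal (integral_norm_pow_complexSum_le hind hlaw S c p)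

end Wick

/-! ### Gaussian integration by parts -/

section BoundedC1

variable {E F : Type*} [NormedAddCommGroup E] [NormedSpace ℝ E] [NormedAddCommGroup F]
  [NormedSpace ℝ F]

/-- `φ` is a `C¹` function which is bounded together with its derivative: the class of test
functions in the integration by parts formula. -/
structure IsBoundedC1 (φ : E → ℝ) : Prop where
  contDiff : ContDiff ℝ 1 φ
  exists_bound : ∃ B, ∀ x, |φ x| ≤ B
  exists_bound_fderiv : ∃ B, ∀ x, ‖fderiv ℝ φ x‖ ≤ B

namespace IsBoundedC1

variable {φ ψ : E → ℝ}

theorem hasFDerivAt (hφ : IsBoundedC1 φ) (x : E) : HasFDerivAt φ (fderiv ℝ φ x) x :=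
  (hφ.contDiff.differentiable one_ne_zero x).hasFDerivAt

theorem continuous_fderiv_apply (hφ : IsBoundedC1 φ) (c : E) :
    Continuous fun x => fderiv ℝ φ x c :=
  (hφ.contDiff.continuous_fderiv one_ne_zero).clm_apply continuous_const

theorem exists_bound_fderiv_apply (hφ : IsBoundedC1 φ) (c : E) :
    ∃ B, ∀ x, ‖fderiv ℝ φ x c‖ ≤ B := by
  obtain ⟨B, hB⟩ := hφ.exists_bound_fderiv
  exact ⟨B * ‖c‖, fun x => (fderiv ℝ φ x).le_of_opNorm_le (hB x) c⟩

theorem fderiv_comp_clm {φ : F → ℝ} (hφ : IsBoundedC1 φ) (L : E →L[ℝ] F) (x : E) :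
    fderiv ℝ (fun x => φ (L x)) x = (fderiv ℝ φ (L x)).comp L :=
  ((hφ.hasFDerivAt (L x)).comp x L.hasFDerivAt).fderiv

theorem comp_clm {φ : F → ℝ} (hφ : IsBoundedC1 φ) (L : E →L[ℝ] F) :
    IsBoundedC1 fun x => φ (L x) := by
  obtain ⟨B, hB⟩ := hφ.exists_bound
  obtain ⟨B', hB'⟩ := hφ.exists_bound_fderiv
  refine ⟨hφ.contDiff.comp L.contDiff, ⟨B, fun x => hB (L x)⟩, B' * ‖L‖, fun x => ?_⟩
  rw [hφ.fderiv_comp_clm]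
  exact (ContinuousLinearMap.opNorm_comp_le _ _).trans (by gcongr; exact hB' _)

theorem fderiv_mul (hφ : IsBoundedC1 φ) (hψ : IsBoundedC1 ψ) (x : E) :
    fderiv ℝ (fun x => φ x * ψ x) x = φ x • fderiv ℝ ψ x + ψ x • fderiv ℝ φ x :=
  ((hφ.hasFDerivAt x).mul (hψ.hasFDerivAt x)).fderiv

theorem mul (hφ : IsBoundedC1 φ) (hψ : IsBoundedC1 ψ) : IsBoundedC1 fun x => φ x * ψ x := by
  obtain ⟨B, hB⟩ := hφ.exists_bound
  obtain ⟨B', hB'⟩ := hφ.exists_bound_fderiv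
  obtain ⟨D, hD⟩ := hψ.exists_bound
  obtain ⟨D', hD'⟩ := hψ.exists_bound_fderiv
  have hB0 : 0 ≤ B := (abs_nonneg _).trans (hB 0)
  have hD0 : 0 ≤ D := (abs_nonneg _).trans (hD 0)
  refine ⟨hφ.contDiff.mul hψ.contDiff, ⟨B * D, fun x => ?_⟩, B * D' + D * B', fun x => ?_⟩
  · rw [abs_mul]
    exact mul_le_mul (hB x) (hD x) (abs_nonneg _) hB0
  · rw [hφ.fderiv_mul hψ]
    refine (norm_add_le _ _).trans ?_
    rw [norm_smul, norm_smul]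
    exact add_le_add (mul_le_mul (hB x) (hD' x) (norm_nonneg _) hB0)
      (mul_le_mul (hD x) (hB' x) (norm_nonneg _) hD0)

theorem of_contDiff_top (hφ : ContDiff ℝ ((⊤ : ℕ∞) : WithTop ℕ∞) φ)
    (hb : ∀ q : ℕ, ∃ C : ℝ, ∀ x, ‖iteratedFDeriv ℝ q φ x‖ ≤ C) : IsBoundedC1 φ where
  contDiff := hφ.of_le (by exact_mod_cast le_top)
  exists_bound := by simpa only [norm_iteratedFDeriv_zero, Real.norm_eq_abs] using hb 0
  exists_bound_fderiv := by simpa only [norm_iteratedFDeriv_one] using hb 1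

theorem fderiv_apply_of_contDiff_top (hφ : ContDiff ℝ ((⊤ : ℕ∞) : WithTop ℕ∞) φ)
    (hb : ∀ q : ℕ, ∃ C : ℝ, ∀ x, ‖iteratedFDeriv ℝ q φ x‖ ≤ C) (c : E) :
    IsBoundedC1 fun x => fderiv ℝ φ x c := by
  have hfderiv : ContDiff ℝ 1 (fderiv ℝ φ) := hφ.fderiv_right
    (WithTop.coe_le_coe.2 (le_top : (1 + 1 : ℕ∞) ≤ ⊤))
  have hder : ∀ x, HasFDerivAt (fun x => fderiv ℝ φ x c)
      ((ContinuousLinearMap.apply ℝ ℝ c).comp (fderiv ℝ (fderiv ℝ φ) x)) x := fun x =>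
    (ContinuousLinearMap.apply ℝ ℝ c).hasFDerivAt.comp x
      (hfderiv.differentiable one_ne_zero x).hasFDerivAt
  obtain ⟨C, hC⟩ := hb 2
  refine ⟨hfderiv.clm_apply contDiff_const,
    (of_contDiff_top hφ hb).exists_bound_fderiv_apply c,
    ‖ContinuousLinearMap.apply ℝ ℝ c‖ * C, fun x => ?_⟩
  rw [(hder x).fderiv]
  refine (ContinuousLinearMap.opNorm_comp_le _ _).trans 
    (mul_le_mul_of_nonneg_left ?_ (norm_nonneg _))
  rw [← norm_iteratedFDeriv_one, norm_iteratedFDeriv_fderiv]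
  exact hC x

variable {Ω : Type*} [MeasurableSpace Ω] {P : Measure Ω} [IsFiniteMeasure P] {X : Ω → E}

theorem memLp_comp (hφ : IsBoundedC1 φ) (hX : AEStronglyMeasurable X P) (p : ℝ≥0∞) :
    MemLp (fun ω => φ (X ω)) p P := by
  obtain ⟨B, hB⟩ := hφ.exists_bound
  exact MemLp.of_bound (hφ.contDiff.continuous.comp_aestronglyMeasurable hX) B
    (ae_of_all _ fun ω => hB (X ω))

theorem memLp_fderiv_comp (hφ : IsBoundedC1 φ) (hX : AEStronglyMeasurable X P) (c : E)
    (p : ℝ≥0∞) : MemLp (fun ω => fderiv ℝ φ (X ω) c) p P := by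
  obtain ⟨B, hB⟩ := hφ.exists_bound_fderiv_apply c
  exact MemLp.of_bound ((hφ.continuous_fderiv_apply c).comp_aestronglyMeasurable hX) B
    (ae_of_all _ fun ω => hB (X ω))

theorem integral_fst_mul_comp_add_smul [MeasurableSpace E] [BorelSpace E]
    [SecondCountableTopology E] {Q : Measure E} [IsFiniteMeasure Q] {v : ℝ≥0} (hv : v ≠ 0)
    (hφ : IsBoundedC1 φ) (c : E) :
    ∫ z, z.1 * φ (z.2 + z.1 • c) ∂(gaussianReal 0 v).prod Q =
      v * ∫ z, fderiv ℝ φ (z.2 + z.1 • c) c ∂(gaussianReal 0 v).prod Q := by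
  have hX : AEStronglyMeasurable (fun z : ℝ × E => z.2 + z.1 • c) ((gaussianReal 0 v).prod Q) :=
    Continuous.aestronglyMeasurable (by fun_prop)
  have hfst : MemLp (fun z : ℝ × E => z.1) 1 ((gaussianReal 0 v).prod Q) :=
    by simpa using (allMoments_gaussianReal v).comp_fst (Q := Q) 1
  refine integral_fst_smul_gaussianReal_prod hv (fun x y => ?_)
    (memLp_one_iff_integrable.1 (hφ.memLp_comp hX 1))
    (memLp_one_iff_integrable.1 (MemLp.mul (p := 1) (q := ∞) (hφ.memLp_comp hX ∞)
      hfst))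
    (memLp_one_iff_integrable.1 (hφ.memLp_fderiv_comp hX c 1))
  have hline : HasDerivAt (fun x : ℝ => y + x • c) c x := by
    simpa using ((hasDerivAt_id x).smul_const c).const_add y
  exact (hφ.hasFDerivAt _).comp_hasDerivAt x hline

end IsBoundedC1

end BoundedC1

section IntegrationByParts

variable {Ω H κ κ' : Type*} [NormedAddCommGroup H] [InnerProductSpace ℝ H] {W : H → Ω → ℝ}

/-- The Gaussian vector `(W(h_i))_i`. -/
def gaussianVec (W : H → Ω → ℝ) (h : κ → H) (ω : Ω) : κ → ℝ := fun i => W (h i) ω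

variable [MeasurableSpace Ω] {P : Measure Ω}

namespace IsIsonormal

theorem hasLaw (hW : IsIsonormal W P) (h : H) :
    HasLaw (W h) (gaussianReal 0 (‖h‖₊ ^ 2)) P where
  aemeasurable := hW.gaussian.aemeasurable h
  map_eq := by
    have hsq : ∫ ω, W h ω ^ 2 ∂P = ‖h‖ ^ 2 := by
      simp only [pow_two, hW.covariance, real_inner_self_eq_norm_mul_norm]
    rw [(hW.gaussian.hasGaussianLaw_eval h).map_eq_gaussianReal, hW.centered,
      variance_of_integral_eq_zero (hW.gaussian.aemeasurable h) (hW.centered h), hsq]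
    congr 1
    ext
    simp

theorem allMoments (hW : IsIsonormal W P) (h : H) : AllMoments (W h) P :=
  AllMoments.of_hasLaw (allMoments_gaussianReal _) (hW.hasLaw h)

theorem hasLaw_basis (hW : IsIsonormal W P) {ι : Type*} (e : HilbertBasis ι ℝ H) (j : ι) :
    HasLaw (W (e j)) (gaussianReal 0 1) P := by
  have hnorm : ‖e j‖₊ = 1 := by
    ext
    simpa using e.orthonormal.1 j
  simpa only [hnorm, one_pow] using hW.hasLaw (e j)

theorem aemeasurable_gaussianVec [Finite κ] (hW : IsIsonormal W P) (h : κ → H) :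
    AEMeasurable (gaussianVec W h) P :=
  aemeasurable_pi_lambda _ fun i => (hW.hasLaw (h i)).aemeasurable

theorem aestronglyMeasurable_gaussianVec [Finite κ] (hW : IsIsonormal W P) (h : κ → H) :
    AEStronglyMeasurable (gaussianVec W h) P :=
  (hW.aemeasurable_gaussianVec h).aestronglyMeasurable

variable [IsProbabilityMeasure P]

theorem covariance_eq (hW : IsIsonormal W P) (h g : H) : cov[W h, W g; P] = inner ℝ h g := by
  rw [covariance_eq_sub (hW.allMoments h).memLp_two (hW.allMoments g).memLp_two, hW.centered,
    zero_mul, sub_zero, ← hW.covariance]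
  rfl

theorem iIndepFun_basis (hW : IsIsonormal W P) {ι : Type*} (e : HilbertBasis ι ℝ H) :
    iIndepFun (fun j => W (e j)) P := by
  rw [iIndepFun_iff_finset]
  intro T
  refine HasGaussianLaw.iIndepFun_of_covariance_eq_zero
    ((hW.gaussian.comp_right e).hasGaussianLaw T) fun i j hij => ?_
  change cov[W (e i), W (e j); P] = 0
  rw [hW.covariance_eq]
  exact e.orthonormal.2 fun h => hij (Subtype.ext h)

theorem indepFun_residual [Finite κ] (hW : IsIsonormal W P) (h : κ → H) {h₀ : H} {c : κ → ℝ}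
    (hc : ∀ i, c i * ‖h₀‖ ^ 2 = inner ℝ (h i) h₀) :
    IndepFun (W h₀) (fun ω => gaussianVec W h ω - W h₀ ω • c) P := by
  classical
  have := Fintype.ofFinite κ
  let I : Finset H := insert h₀ (Finset.univ.image h)
  have h₀_mem : h₀ ∈ I := Finset.mem_insert_self _ _
  have h_mem : ∀ i, h i ∈ I := fun i => Finset.mem_insert_of_mem (by simp)
  let L : (I → ℝ) →L[ℝ] (Unit → ℝ) × (κ → ℝ) :=
    (ContinuousLinearMap.pi fun _ => ContinuousLinearMap.proj (⟨h₀, h₀_mem⟩ : I)).prod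
      (ContinuousLinearMap.pi fun i => ContinuousLinearMap.proj (⟨h i, h_mem i⟩ : I) -
        c i • ContinuousLinearMap.proj (⟨h₀, h₀_mem⟩ : I))
  have hlaw : HasGaussianLaw
      (fun ω => (fun _ : Unit => W h₀ ω, fun i => W (h i) ω - c i * W h₀ ω)) P :=
    (hW.gaussian.hasGaussianLaw I).map_fun L
  have hind := hlaw.indepFun_of_covariance_eval (X := fun _ : Unit => W h₀)
    (Y := fun i ω => W (h i) ω - c i * W h₀ ω) fun _ i => by
      have hmem := fun g => (hW.allMoments g).memLp_two
      have hfun : (fun ω => W (h i) ω - c i * W h₀ ω) = W (h i) - c i • W h₀ := rfl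
      rw [hfun, covariance_sub_right (hmem h₀) (hmem (h i)) ((hmem h₀).const_smul _),
        covariance_smul_right, hW.covariance_eq, hW.covariance_eq, real_inner_self_eq_norm_sq,
        hc, real_inner_comm, sub_self]
  have hcomm : (fun ω => gaussianVec W h ω - W h₀ ω • c) =
      fun ω i => W (h i) ω - c i * W h₀ ω := by
    ext ω i
    simp [gaussianVec, mul_comm]
  rw [hcomm]
  exact hind.comp (φ := fun x : Unit → ℝ => x ()) (measurable_pi_apply _) measurable_id

/-- Splitting off from `(W(h_i))_i` its regression on `W(h₀)` leaves an independent vector, so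
that Stein's identity can be applied in the variable `W(h₀)` alone. -/
theorem integral_fderiv_eq_integral_mul [Fintype κ] (hW : IsIsonormal W P) (h : κ → H) (h₀ : H)
    {φ : (κ → ℝ) → ℝ} (hφ : IsBoundedC1 φ) :
    ∫ ω, fderiv ℝ φ (gaussianVec W h ω) (fun i => inner ℝ (h i) h₀) ∂P =
      ∫ ω, φ (gaussianVec W h ω) * W h₀ ω ∂P := by
  rcases eq_or_ne h₀ 0 with rfl | h₀_ne
  · have hzero : W 0 =ᵐ[P] 0 := by
      have hlaw := hW.hasLaw 0
      rw [nnnorm_zero, zero_pow two_ne_zero, gaussianReal_zero_var] at hlaw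
      exact hlaw.ae_eq_of_dirac
    have hcoeff : (fun i => inner ℝ (h i) (0 : H)) = (0 : κ → ℝ) := by
      ext i
      simp
    rw [hcoeff]
    simp only [map_zero, integral_zero]
    refine (integral_eq_zero_of_ae ?_).symm
    filter_upwards [hzero] with ω hω
    simp [hω]
  set c : κ → ℝ := (‖h₀‖ ^ 2)⁻¹ • fun i => inner ℝ (h i) h₀ with hc
  have hv : ‖h₀‖₊ ^ 2 ≠ 0 := by simpa using h₀_ne
  have hnorm : ‖h₀‖ ^ 2 ≠ 0 := by simpa using h₀_ne
  have hind := hW.indepFun_residual h (h₀ := h₀) (c := c) fun i => by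
    simp only [hc, Pi.smul_apply, smul_eq_mul]
    field_simp
  have hW₀ := (hW.hasLaw h₀).aemeasurable
  set U : Ω → κ → ℝ := fun ω => gaussianVec W h ω - W h₀ ω • c with hU
  have hUm : AEMeasurable U P := (hW.aemeasurable_gaussianVec h).sub (hW₀.smul_const c)
  have : IsProbabilityMeasure (P.map U) := Measure.isProbabilityMeasure_map hUm
  have hmap : P.map (fun ω => (W h₀ ω, U ω)) = (gaussianReal 0 (‖h₀‖₊ ^ 2)).prod (P.map U) := by
    rw [(indepFun_iff_map_prod_eq_prod_map_map hW₀ hUm).1 hind, (hW.hasLaw h₀).map_eq]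
  have hsum : ∀ ω, U ω + W h₀ ω • c = gaussianVec W h ω := fun ω => by simp [hU]
  have hstein := hφ.integral_fst_mul_comp_add_smul (Q := P.map U) hv c
  have hcont : Continuous fun z : ℝ × (κ → ℝ) => z.2 + z.1 • c := by fun_prop
  rw [← hmap,
    integral_map (f := fun z => z.1 * φ (z.2 + z.1 • c)) (hW₀.prodMk hUm)
      (continuous_fst.mul (hφ.contDiff.continuous.comp hcont)).aestronglyMeasurable,
    integral_map (f := fun z => fderiv ℝ φ (z.2 + z.1 • c) c) (hW₀.prodMk hUm)
      ((hφ.continuous_fderiv_apply c).comp hcont).aestronglyMeasurable] at hstein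
  simp only [hsum, mul_comm (W h₀ _)] at hstein
  rw [hstein, ← integral_const_mul]
  simp only [hc, map_smul, smul_eq_mul, NNReal.coe_pow, coe_nnnorm, mul_inv_cancel_left₀ hnorm]

theorem integral_fderiv_mul_eq [Fintype κ] [Fintype κ'] (hW : IsIsonormal W P)
    {φ : (κ → ℝ) → ℝ} (hφ : IsBoundedC1 φ) (h : κ → H)
    {ψ : (κ' → ℝ) → ℝ} (hψ : IsBoundedC1 ψ) (h' : κ' → H) (h₀ : H) :
    ∫ ω, fderiv ℝ φ (gaussianVec W h ω) (fun i => inner ℝ (h i) h₀) *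
        ψ (gaussianVec W h' ω) ∂P =
      ∫ ω, φ (gaussianVec W h ω) * (ψ (gaussianVec W h' ω) * W h₀ ω -
        fderiv ℝ ψ (gaussianVec W h' ω) (fun i => inner ℝ (h' i) h₀)) ∂P := by
  let L : (κ ⊕ κ' → ℝ) →L[ℝ] (κ → ℝ) :=
    ContinuousLinearMap.pi fun i => ContinuousLinearMap.proj (Sum.inl i)
  let L' : (κ ⊕ κ' → ℝ) →L[ℝ] (κ' → ℝ) :=
    ContinuousLinearMap.pi fun i => ContinuousLinearMap.proj (Sum.inr i)
  have hfderiv : ∀ x y, fderiv ℝ (fun x => φ (L x) * ψ (L' x)) x y =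
      φ (L x) * fderiv ℝ ψ (L' x) (L' y) + fderiv ℝ φ (L x) (L y) * ψ (L' x) := fun x y => by
    rw [(hφ.comp_clm L).fderiv_mul (hψ.comp_clm L'),
      hφ.fderiv_comp_clm, hψ.fderiv_comp_clm, mul_comm (fderiv ℝ φ _ _)]
    rfl
  have hparts := hW.integral_fderiv_eq_integral_mul (Sum.elim h h') h₀
    ((hφ.comp_clm L).mul (hψ.comp_clm L'))
  simp only [hfderiv] at hparts
  change ∫ ω, (φ (gaussianVec W h ω) *
      fderiv ℝ ψ (gaussianVec W h' ω) (fun i => inner ℝ (h' i) h₀) +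
    fderiv ℝ φ (gaussianVec W h ω) (fun i => inner ℝ (h i) h₀) * ψ (gaussianVec W h' ω)) ∂P =
    ∫ ω, φ (gaussianVec W h ω) * ψ (gaussianVec W h' ω) * W h₀ ω ∂P at hparts
  have hX := hW.aestronglyMeasurable_gaussianVec h
  have hX' := hW.aestronglyMeasurable_gaussianVec h'
  have hφψ' : Integrable (fun ω => φ (gaussianVec W h ω) *
      fderiv ℝ ψ (gaussianVec W h' ω) (fun i => inner ℝ (h' i) h₀)) P :=
    (hφ.memLp_comp hX 2).integrable_mul (hψ.memLp_fderiv_comp hX' _ 2)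
  have hφ'ψ : Integrable (fun ω => fderiv ℝ φ (gaussianVec W h ω)
      (fun i => inner ℝ (h i) h₀) * ψ (gaussianVec W h' ω)) P :=
    (hφ.memLp_fderiv_comp hX _ 2).integrable_mul (hψ.memLp_comp hX' 2)
  have hψW : MemLp (fun ω => ψ (gaussianVec W h' ω) * W h₀ ω) 2 P :=
    (hW.allMoments h₀).memLp_two.mul (hψ.memLp_comp hX' ∞)
  have hφψ : Integrable (fun ω => φ (gaussianVec W h ω) * (ψ (gaussianVec W h' ω) * W h₀ ω)) P :=
    (hφ.memLp_comp hX 2).integrable_mul hψW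
  rw [integral_add hφψ' hφ'ψ] at hparts
  simp only [mul_sub]
  rw [integral_sub hφψ hφψ', eq_sub_iff_add_eq', hparts]
  simp only [mul_assoc]

end IsIsonormal

end IntegrationByParts

/-! ### Uniqueness of the Malliavin derivative -/

section MalliavinUnique

variable {Ω H κ : Type*} [NormedAddCommGroup H] [InnerProductSpace ℝ H] {W : H → Ω → ℝ}

theorem IsCylindricalDeriv.exists_isBoundedC1 {F : Ω → ℝ} {DF : Ω → H}
    (h : IsCylindricalDeriv W F DF) : ∃ (m : ℕ) (k : Fin m → H) (φ : (Fin m → ℝ) → ℝ),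
      IsBoundedC1 φ ∧ (∀ c, IsBoundedC1 fun x => fderiv ℝ φ x c) ∧
      (F = fun ω => φ (gaussianVec W k ω)) ∧ ∀ h₀, (fun ω => inner ℝ (DF ω) h₀) =
        fun ω => fderiv ℝ φ (gaussianVec W k ω) fun i => inner ℝ (k i) h₀ := by
  obtain ⟨m, k, φ, hφ, hb, hF, hDF⟩ := h
  refine ⟨m, k, φ, .of_contDiff_top hφ hb, .fderiv_apply_of_contDiff_top hφ hb, funext hF,
    fun h₀ => funext fun ω => ?_⟩
  rw [hDF, sum_inner, pi_eq_sum_univ' fun i => inner ℝ (k i) h₀, map_sum]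
  refine Finset.sum_congr rfl fun i _ => ?_
  rw [real_inner_smul_left, map_smul, smul_eq_mul, mul_comm]
  rfl

variable [MeasurableSpace Ω] {P : Measure Ω}

theorem tendsto_integral_mul_of_tendsto_eLpNorm {F : Ω → ℝ} {G : ℕ → Ω → ℝ} {Ψ : Ω → ℝ}
    (hF : MemLp F 2 P) (hG : ∀ k, MemLp (G k) 2 P) (hΨ : MemLp Ψ 2 P)
    (hlim : Tendsto (fun k => eLpNorm (fun ω => F ω - G k ω) 2 P) atTop (𝓝 0)) :
    Tendsto (fun k => ∫ ω, G k ω * Ψ ω ∂P) atTop (𝓝 (∫ ω, F ω * Ψ ω ∂P)) := by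
  refine tendsto_integral_of_L1' _ (hF.integrable_mul hΨ).aestronglyMeasurable
    (Eventually.of_forall fun k => (hG k).integrable_mul hΨ) ?_
  have hbound := ENNReal.Tendsto.mul_const hlim (Or.inr hΨ.2.ne)
  rw [zero_mul] at hbound
  refine tendsto_of_tendsto_of_tendsto_of_le_of_le tendsto_const_nhds hbound (fun _ => zero_le)
    fun k => ?_
  have hdiff : (fun ω => G k ω * Ψ ω) - (fun ω => F ω * Ψ ω) =
      -((fun ω => F ω - G k ω) • Ψ) := by
    ext ω
    simp
    ring
  change eLpNorm ((fun ω => G k ω * Ψ ω) - fun ω => F ω * Ψ ω) 1 P ≤ _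
  rw [hdiff, eLpNorm_neg]
  exact eLpNorm_smul_le_mul_eLpNorm hΨ.1 (hF.1.sub (hG k).1)

theorem memLp_of_tendsto_eLpNorm {E : Type*} [NormedAddCommGroup E] {p : ℝ≥0∞} {F : Ω → E}
    {G : ℕ → Ω → E} (hF : AEStronglyMeasurable F P) (hG : ∀ k, MemLp (G k) p P)
    (hlim : Tendsto (fun k => eLpNorm (fun ω => F ω - G k ω) p P) atTop (𝓝 0)) :
    MemLp F p P := by
  obtain ⟨k, hk⟩ := (hlim.eventually (gt_mem_nhds one_pos)).exists
  have hdiff : MemLp (fun ω => F ω - G k ω) p P := ⟨hF.sub (hG k).1, hk.trans ENNReal.one_lt_top⟩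
  simpa [Pi.add_def] using hdiff.add (hG k)

theorem tendsto_eLpNorm_inner {F : Ω → H} {G : ℕ → Ω → H} (h₀ : H)
    (hlim : Tendsto (fun k => eLpNorm (fun ω => F ω - G k ω) 2 P) atTop (𝓝 0)) :
    Tendsto (fun k => eLpNorm (fun ω => inner ℝ (F ω) h₀ - inner ℝ (G k ω) h₀) 2 P) atTop
      (𝓝 0) := by
  have hbound := ENNReal.Tendsto.const_mul hlim (a := ENNReal.ofReal ‖h₀‖) (Or.inr (by finiteness))
  rw [mul_zero] at hbound
  refine tendsto_of_tendsto_of_tendsto_of_le_of_le tendsto_const_nhds hbound (fun _ => zero_le)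
    fun k => ?_
  refine eLpNorm_le_mul_eLpNorm_of_ae_le_mul (ae_of_all _ fun ω => ?_) 2
  rw [← inner_sub_left, mul_comm]
  exact norm_inner_le_norm _ _

variable [IsProbabilityMeasure P]

namespace IsMalliavinDeriv

variable {F : Ω → ℝ} {DF : Ω → H}

theorem memLp_inner (hW : IsIsonormal W P) (h : IsMalliavinDeriv W P F DF) (h₀ : H) :
    MemLp (fun ω => inner ℝ (DF ω) h₀) 2 P := by
  obtain ⟨-, hDF, G, DG, hG, -, hlim⟩ := h
  refine memLp_of_tendsto_eLpNorm (G := fun k ω => inner ℝ (DG k ω) h₀)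
    (hDF.inner aestronglyMeasurable_const) (fun k => ?_) (tendsto_eLpNorm_inner h₀ hlim)
  obtain ⟨m, l, φ, hφ, -, -, hDG⟩ := (hG k).exists_isBoundedC1
  rw [hDG h₀]
  exact hφ.memLp_fderiv_comp (hW.aestronglyMeasurable_gaussianVec l) _ 2

theorem integral_inner_mul (hW : IsIsonormal W P) (h : IsMalliavinDeriv W P F DF) [Fintype κ]
    {ψ : (κ → ℝ) → ℝ} (hψ : IsBoundedC1 ψ) (l : κ → H) (h₀ : H) :
    ∫ ω, inner ℝ (DF ω) h₀ * ψ (gaussianVec W l ω) ∂P =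
      ∫ ω, F ω * (ψ (gaussianVec W l ω) * W h₀ ω -
        fderiv ℝ ψ (gaussianVec W l ω) (fun i => inner ℝ (l i) h₀)) ∂P := by
  have hDF := h.memLp_inner hW h₀
  obtain ⟨hFm, -, G, DG, hG, hF, hD⟩ := h
  choose m k φ hφ _ hGφ hDGφ using fun i => (hG i).exists_isBoundedC1
  have hX := fun i => hW.aestronglyMeasurable_gaussianVec (k i)
  have hl := hW.aestronglyMeasurable_gaussianVec l
  have hGm : ∀ i, MemLp (G i) 2 P := fun i => hGφ i ▸ (hφ i).memLp_comp (hX i) 2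
  have hDGm : ∀ i, MemLp (fun ω => inner ℝ (DG i ω) h₀) 2 P := fun i =>
    hDGφ i h₀ ▸ (hφ i).memLp_fderiv_comp (hX i) _ 2
  have hΨ : MemLp (fun ω => ψ (gaussianVec W l ω) * W h₀ ω -
      fderiv ℝ ψ (gaussianVec W l ω) (fun i => inner ℝ (l i) h₀)) 2 P :=
    (MemLp.mul (p := ∞) (q := 2) (hW.allMoments h₀).memLp_two (hψ.memLp_comp hl ∞)).sub
      (hψ.memLp_fderiv_comp hl _ 2)
  refine tendsto_nhds_unique (tendsto_integral_mul_of_tendsto_eLpNorm hDF hDGm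
    (hψ.memLp_comp hl 2) (tendsto_eLpNorm_inner h₀ hD)) ?_
  refine (tendsto_integral_mul_of_tendsto_eLpNorm (memLp_of_tendsto_eLpNorm hFm hGm hF) hGm hΨ
    hF).congr fun i => ?_
  rw [hGφ i, ← hW.integral_fderiv_mul_eq (hφ i) (k i) hψ l h₀]
  exact integral_congr_ae (ae_of_all _ fun ω => by simp only [← congrFun (hDGφ i h₀) ω])

theorem integral_inner_mul_eq_zero (hW : IsIsonormal W P) (h : IsMalliavinDeriv W P F DF) (h₀ : H)
    {V : Ω → ℝ} (hV : MemLp V 2 P) (horth : ∀ (m : ℕ) (l : Fin m → H) (ψ : (Fin m → ℝ) → ℝ),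
      IsBoundedC1 ψ → ∫ ω, ψ (gaussianVec W l ω) * V ω ∂P = 0) :
    ∫ ω, inner ℝ (DF ω) h₀ * V ω ∂P = 0 := by
  have hDF := h.memLp_inner hW h₀
  obtain ⟨-, -, G, DG, hG, -, hlim⟩ := h
  choose m k φ hφ hφ' _ hDGφ using fun i => (hG i).exists_isBoundedC1
  refine tendsto_nhds_unique (tendsto_integral_mul_of_tendsto_eLpNorm hDF (fun i => ?_) hV
    (tendsto_eLpNorm_inner h₀ hlim)) (tendsto_const_nhds.congr fun i => ?_)
  · rw [hDGφ i]
    exact (hφ i).memLp_fderiv_comp (hW.aestronglyMeasurable_gaussianVec _) _ 2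
  · rw [← horth (m i) (k i) _ (hφ' i fun j => inner ℝ (k i j) h₀)]
    exact integral_congr_ae (ae_of_all _ fun ω => by simp only [← congrFun (hDGφ i h₀) ω])

theorem inner_ae_eq (hW : IsIsonormal W P) {D₁ D₂ : Ω → H} (h₁ : IsMalliavinDeriv W P F D₁)
    (h₂ : IsMalliavinDeriv W P F D₂) (h₀ : H) :
    (fun ω => inner ℝ (D₁ ω) h₀) =ᵐ[P] fun ω => inner ℝ (D₂ ω) h₀ := by
  have hD₁ := h₁.memLp_inner hW h₀
  have hD₂ := h₂.memLp_inner hW h₀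
  have hV : MemLp (fun ω => inner ℝ (D₁ ω) h₀ - inner ℝ (D₂ ω) h₀) 2 P := hD₁.sub hD₂
  have integral_sub_mul : ∀ Φ : Ω → ℝ, MemLp Φ 2 P →
      ∫ ω, (inner ℝ (D₁ ω) h₀ - inner ℝ (D₂ ω) h₀) * Φ ω ∂P =
        ∫ ω, inner ℝ (D₁ ω) h₀ * Φ ω ∂P - ∫ ω, inner ℝ (D₂ ω) h₀ * Φ ω ∂P := fun Φ hΦ => by
    simp only [sub_mul]
    exact integral_sub (hD₁.integrable_mul hΦ) (hD₂.integrable_mul hΦ)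
  have horth : ∀ (m : ℕ) (l : Fin m → H) (ψ : (Fin m → ℝ) → ℝ), IsBoundedC1 ψ →
      ∫ ω, ψ (gaussianVec W l ω) * (inner ℝ (D₁ ω) h₀ - inner ℝ (D₂ ω) h₀) ∂P = 0 := by
    intro m l ψ hψ
    simp only [mul_comm (ψ _)]
    rw [integral_sub_mul _ (hψ.memLp_comp (hW.aestronglyMeasurable_gaussianVec l) 2),
      h₁.integral_inner_mul hW hψ l h₀, h₂.integral_inner_mul hW hψ l h₀, sub_self]
  have hsq : ∫ ω, (inner ℝ (D₁ ω) h₀ - inner ℝ (D₂ ω) h₀) ^ 2 ∂P = 0 := by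
    simp only [pow_two]
    rw [integral_sub_mul _ hV, h₁.integral_inner_mul_eq_zero hW h₀ hV horth,
      h₂.integral_inner_mul_eq_zero hW h₀ hV horth, sub_self]
  rw [integral_eq_zero_iff_of_nonneg (fun ω => sq_nonneg _) hV.integrable_sq] at hsq
  filter_upwards [hsq] with ω hω
  exact sub_eq_zero.1 (pow_eq_zero_iff two_ne_zero |>.1 hω)

theorem ae_eq [CompleteSpace H] (hW : IsIsonormal W P) {D₁ D₂ : Ω → H}
    (h₁ : IsMalliavinDeriv W P F D₁) (h₂ : IsMalliavinDeriv W P F D₂) : D₁ =ᵐ[P] D₂ := by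
  obtain ⟨t, ht, hmem⟩ := (h₁.2.1.sub h₂.2.1).isSeparable_ae_range
  rw [← sub_ae_eq_zero]
  refine ae_eq_zero_of_forall_dual_of_isSeparable ℝ ht (fun c => ?_) hmem
  filter_upwards [h₁.inner_ae_eq hW h₂ ((InnerProductSpace.toDual ℝ H).symm c)] with ω hω
  rw [real_inner_comm, real_inner_comm _ (D₂ ω), InnerProductSpace.toDual_symm_apply,
    InnerProductSpace.toDual_symm_apply] at hω
  simp [hω]

end IsMalliavinDeriv

end MalliavinUnique

/-! ### Smooth functions of Gaussian vectors -/

section Cutoff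

theorem exists_smooth_cutoff (E : Type*) [NormedAddCommGroup E] [NormedSpace ℝ E]
    [FiniteDimensional ℝ E] :
    ∃ (χ : ℕ → E → ℝ) (M : ℝ), (∀ k, ContDiff ℝ ((⊤ : ℕ∞) : WithTop ℕ∞) (χ k)) ∧
      (∀ k, HasCompactSupport (χ k)) ∧ (∀ k x, |χ k x| ≤ 1) ∧
      (∀ k x, ‖fderiv ℝ (χ k) x‖ ≤ M) ∧ ∀ x, ∀ᶠ k in atTop, χ k =ᶠ[𝓝 x] 1 := by
  let b : ContDiffBump (0 : E) := ⟨1, 2, one_pos, one_lt_two⟩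
  have hb : ContDiff ℝ ((⊤ : ℕ∞) : WithTop ℕ∞) b := b.contDiff
  obtain ⟨M, hM⟩ := (b.hasCompactSupport.fderiv (𝕜 := ℝ)).exists_bound_of_continuous
    (hb.continuous_fderiv (by simp))
  let s : ℕ → ℝ := fun k => 1 / ((k : ℝ) + 1)
  have s_pos : ∀ k, 0 < s k := fun k => by positivity
  have s_le_one : ∀ k, s k ≤ 1 := fun k => div_le_one_of_le₀ (by simp) (by positivity)
  refine ⟨fun k x => b (s k • x), M, fun k => hb.comp (contDiff_const_smul (s k)),
    fun k => b.hasCompactSupport.comp_smul (s_pos k).ne', fun k x => ?_, fun k x => ?_,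
    fun x => ?_⟩
  · rw [abs_of_nonneg b.nonneg]
    exact b.le_one
  · rw [fderiv_comp_smul, norm_smul, Real.norm_of_nonneg (s_pos k).le]
    exact (mul_le_of_le_one_left (norm_nonneg _) (s_le_one k)).trans (hM _)
  · have hlim : Tendsto (fun k => s k • x) atTop (𝓝 0) := by
      simpa only [zero_smul] using (tendsto_one_div_add_atTop_nhds_zero_nat (𝕜 := ℝ)).smul_const x
    filter_upwards [hlim.eventually b.eventuallyEq_one.eventually_nhds] with k hk
    exact (continuous_const_smul (s k)).continuousAt.eventually hk

theorem abs_fderiv_mul_apply_le {E : Type*} [NormedAddCommGroup E] [NormedSpace ℝ E]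
    {χ φ : E → ℝ} {x v : E} {M : ℝ} (hχ : DifferentiableAt ℝ χ x) (hφ : DifferentiableAt ℝ φ x)
    (hχ_le : |χ x| ≤ 1) (hM : |fderiv ℝ χ x v| ≤ M) :
    |fderiv ℝ (fun x => χ x * φ x) x v| ≤ |fderiv ℝ φ x v| + M * |φ x| := by
  rw [fderiv_fun_mul hχ hφ]
  refine (abs_add_le _ _).trans (add_le_add ?_ ?_)
  · change |χ x * fderiv ℝ φ x v| ≤ _
    rw [abs_mul]
    exact mul_le_of_le_one_left (abs_nonneg _) hχ_le
  · change |φ x * fderiv ℝ χ x v| ≤ _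
    rw [abs_mul, mul_comm]
    exact mul_le_mul_of_nonneg_right hM (abs_nonneg _)

end Cutoff

section LpApproximation

variable {Ω E : Type*} [MeasurableSpace Ω] {P : Measure Ω} [NormedAddCommGroup E]

theorem tendsto_eLpNorm_zero_of_dominated {p : ℕ} (hp : p ≠ 0) {F : ℕ → Ω → E} {g : Ω → ℝ}
    (hF : ∀ k, AEStronglyMeasurable (F k) P) (hg : MemLp g p P) (hb : ∀ k ω, ‖F k ω‖ ≤ g ω)
    (hlim : ∀ ω, Tendsto (fun k => F k ω) atTop (𝓝 0)) :
    Tendsto (fun k => eLpNorm (F k) p P) atTop (𝓝 0) := by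
  have hpow : Tendsto (fun k => eLpNorm (F k) p P ^ p) atTop (𝓝 (∫⁻ _, 0 ∂P)) := by
    simp only [eLpNorm_natCast_pow hp]
    refine tendsto_lintegral_of_dominated_convergence' (fun ω => ‖g ω‖ₑ ^ p)
      (fun k => (hF k).enorm.pow_const p) (fun k => ae_of_all _ fun ω => ?_) ?_
      (ae_of_all _ fun ω => ?_)
    · exact pow_le_pow_left' (enorm_le_iff_norm_le.2 ((hb k ω).trans (le_abs_self _))) p
    · rw [← eLpNorm_natCast_pow hp]
      exact ENNReal.pow_ne_top hg.2.ne
    · simpa [hp] using ENNReal.Tendsto.pow (n := p) (hlim ω).enorm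
  have hroot := hpow.ennrpow_const (p : ℝ)⁻¹
  have hp' : (p : ℝ) ≠ 0 := by exact_mod_cast hp
  simpa [← ENNReal.rpow_natCast, ENNReal.rpow_rpow_inv hp',
    ENNReal.zero_rpow_of_pos (by positivity : (0 : ℝ) < (p : ℝ)⁻¹)] using hroot

theorem eLpNorm_sub_le_add {f g h : Ω → E} (hf : AEStronglyMeasurable f P)
    (hg : AEStronglyMeasurable g P) (hh : AEStronglyMeasurable h P) {p : ℝ≥0∞} (hp : 1 ≤ p) :
    eLpNorm (fun ω => f ω - h ω) p P ≤
      eLpNorm (fun ω => f ω - g ω) p P + eLpNorm (fun ω => g ω - h ω) p P := by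
  simpa only [Pi.add_def, Pi.sub_apply, sub_add_sub_cancel] using!
    eLpNorm_add_le (hf.sub hg) (hg.sub hh) hp

end LpApproximation

section MalliavinClosure

variable {Ω H κ : Type*} [NormedAddCommGroup H] [InnerProductSpace ℝ H] {W : H → Ω → ℝ}

/-- The Malliavin derivative `∑ i, ∂ᵢφ(W(h₁), …, W(hₘ)) hᵢ` of `φ(W(h₁), …, W(hₘ))`. -/
noncomputable def cylindricalGrad [Fintype κ] [DecidableEq κ] (W : H → Ω → ℝ) (h : κ → H)
    (φ : (κ → ℝ) → ℝ) (ω : Ω) : H :=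
  ∑ i, fderiv ℝ φ (gaussianVec W h ω) (Pi.single i 1) • h i

theorem norm_cylindricalGrad_sub_le [Fintype κ] [DecidableEq κ] (h : κ → H)
    (φ ψ : (κ → ℝ) → ℝ) (ω : Ω) :
    ‖cylindricalGrad W h φ ω - cylindricalGrad W h ψ ω‖ ≤
      ∑ i, (|fderiv ℝ φ (gaussianVec W h ω) (Pi.single i 1)| +
        |fderiv ℝ ψ (gaussianVec W h ω) (Pi.single i 1)|) * ‖h i‖ := by
  simp only [cylindricalGrad, ← Finset.sum_sub_distrib, ← sub_smul]
  refine norm_sum_le_of_le _ fun i _ => ?_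
  rw [norm_smul]
  exact mul_le_mul_of_nonneg_right (abs_sub _ _) (norm_nonneg _)

theorem isCylindricalDeriv_of_hasCompactSupport [Fintype κ] [DecidableEq κ] (h : κ → H)
    {φ : (κ → ℝ) → ℝ} (hφ : ContDiff ℝ ((⊤ : ℕ∞) : WithTop ℕ∞) φ) (hc : HasCompactSupport φ) :
    IsCylindricalDeriv W (fun ω => φ (gaussianVec W h ω)) (cylindricalGrad W h φ) := by
  let σ : Fin (Fintype.card κ) ≃ κ := (Fintype.equivFin κ).symm
  let L : (Fin (Fintype.card κ) → ℝ) ≃L[ℝ] (κ → ℝ) :=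
    ContinuousLinearEquiv.piCongrLeft ℝ (fun _ => ℝ) σ
  have hL : ∀ x i, L x (σ i) = x i := Equiv.piCongrLeft_apply_apply (fun _ => ℝ) σ
  have hL_vec : ∀ ω, L (gaussianVec W (h ∘ σ) ω) = gaussianVec W h ω := fun ω => by
    ext i
    obtain ⟨i, rfl⟩ := σ.surjective i
    exact hL _ i
  have hL_single : ∀ i, L (Pi.single i 1) = Pi.single (σ i) 1 := fun i => by
    ext j
    obtain ⟨j, rfl⟩ := σ.surjective j
    simp [hL, Pi.single_apply]
  have hφL : ContDiff ℝ ((⊤ : ℕ∞) : WithTop ℕ∞) (φ ∘ L) := hφ.comp L.contDiff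
  have hcL : HasCompactSupport (φ ∘ L) := hc.comp_homeomorph L.toHomeomorph
  refine ⟨_, h ∘ σ, φ ∘ L, hφL, fun q => (hcL.iteratedFDeriv (𝕜 := ℝ) q).exists_bound_of_continuous
    (hφL.continuous_iteratedFDeriv (by exact_mod_cast le_top)), fun ω => ?_, fun ω => ?_⟩
  · exact congrArg φ (hL_vec ω).symm
  · rw [cylindricalGrad, ← σ.sum_comp]
    refine Finset.sum_congr rfl fun i _ => ?_
    rw [L.comp_right_fderiv, ContinuousLinearMap.comp_apply, ContinuousLinearEquiv.coe_coe,
      hL_single]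
    exact congrArg (fun x => fderiv ℝ φ x (Pi.single (σ i) 1) • h (σ i)) (hL_vec ω).symm

variable [MeasurableSpace Ω] {P : Measure Ω}

namespace IsIsonormal

theorem aestronglyMeasurable_cylindricalGrad (hW : IsIsonormal W P) [Fintype κ] [DecidableEq κ]
    (h : κ → H) {φ : (κ → ℝ) → ℝ} (hφ : ContDiff ℝ ((⊤ : ℕ∞) : WithTop ℕ∞) φ) :
    AEStronglyMeasurable (cylindricalGrad W h φ) P := by
  refine Finset.aestronglyMeasurable_fun_sum _ fun i _ => ?_
  exact (((hφ.continuous_fderiv (by simp)).clm_apply continuous_const).comp_aestronglyMeasurable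
    (hW.aestronglyMeasurable_gaussianVec h)).smul aestronglyMeasurable_const

theorem aestronglyMeasurable_cylindrical (hW : IsIsonormal W P) {F : Ω → ℝ} {DF : Ω → H}
    (h : IsCylindricalDeriv W F DF) : AEStronglyMeasurable F P ∧ AEStronglyMeasurable DF P := by
  obtain ⟨m, k, φ, hφ, -, hF, hDF⟩ := h
  rw [funext hF, funext hDF]
  exact ⟨hφ.continuous.comp_aestronglyMeasurable (hW.aestronglyMeasurable_gaussianVec k),
    hW.aestronglyMeasurable_cylindricalGrad k hφ⟩

theorem isMalliavinDeriv_of_contDiff (hW : IsIsonormal W P) [Fintype κ] [DecidableEq κ]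
    (h : κ → H) {φ : (κ → ℝ) → ℝ} (hφ : ContDiff ℝ ((⊤ : ℕ∞) : WithTop ℕ∞) φ)
    (hF : MemLp (fun ω => φ (gaussianVec W h ω)) 2 P)
    (hDF : ∀ i, MemLp (fun ω => fderiv ℝ φ (gaussianVec W h ω) (Pi.single i 1)) 2 P) :
    IsMalliavinDeriv W P (fun ω => φ (gaussianVec W h ω)) (cylindricalGrad W h φ) := by
  obtain ⟨χ, M, hχ, hχ_supp, hχ_le, hχ_fderiv_le, hχ_one⟩ := exists_smooth_cutoff (κ → ℝ)
  have hcyl : ∀ k, IsCylindricalDeriv W (fun ω => χ k (gaussianVec W h ω) * φ (gaussianVec W h ω))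
      (cylindricalGrad W h fun x => χ k x * φ x) := fun k =>
    isCylindricalDeriv_of_hasCompactSupport h ((hχ k).mul hφ) (hχ_supp k).mul_right
  have hDm := hW.aestronglyMeasurable_cylindricalGrad h hφ
  have heq : ∀ ω, ∀ᶠ k in atTop, (fun x => χ k x * φ x) =ᶠ[𝓝 (gaussianVec W h ω)] φ := fun ω =>
    (hχ_one _).mono fun k hk => hk.mono fun y hy => by simp [hy]
  refine ⟨hF.1, hDm, _, _, hcyl, ?_, ?_⟩
  · refine tendsto_eLpNorm_zero_of_dominated two_ne_zero
      (fun k => hF.1.sub (hW.aestronglyMeasurable_cylindrical (hcyl k)).1)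
      (hF.norm.add hF.norm) (fun k ω => (norm_sub_le _ _).trans (add_le_add_right ?_ _))
      fun ω => tendsto_const_nhds.congr' ((heq ω).mono fun k hk => ?_)
    · rw [norm_mul]
      exact mul_le_of_le_one_left (norm_nonneg _) (hχ_le k _)
    · exact (sub_eq_zero.2 hk.self_of_nhds.symm).symm
  · refine tendsto_eLpNorm_zero_of_dominated two_ne_zero
      (g := fun ω => ∑ i, (|fderiv ℝ φ (gaussianVec W h ω) (Pi.single i 1)| +
        (|fderiv ℝ φ (gaussianVec W h ω) (Pi.single i 1)| + M * |φ (gaussianVec W h ω)|)) * ‖h i‖)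
      (fun k => hDm.sub (hW.aestronglyMeasurable_cylindrical (hcyl k)).2)
      (memLp_finsetSum _ fun i _ => ((hDF i).norm.add
        ((hDF i).norm.add (hF.norm.const_mul M))).mul_const _) (fun k ω => ?_)
      fun ω => tendsto_const_nhds.congr' ((heq ω).mono fun k hk => ?_)
    · refine (norm_cylindricalGrad_sub_le h φ _ ω).trans ?_
      gcongr with i
      refine abs_fderiv_mul_apply_le ((hχ k).differentiable (by simp) _)
        (hφ.differentiable (by simp) _) (hχ_le k _) ?_
      simpa [Pi.norm_single] using (fderiv ℝ (χ k) _).le_of_opNorm_le (hχ_fderiv_le k _)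
        (Pi.single i 1)
    · simp [cylindricalGrad, hk.fderiv_eq]

end IsIsonormal

theorem isMalliavinDeriv_of_forall_pos {F : Ω → ℝ} {DF : Ω → H}
    (hF : AEStronglyMeasurable F P) (hDF : AEStronglyMeasurable DF P)
    (h : ∀ ε : ℝ≥0∞, 0 < ε → ∃ (G : Ω → ℝ) (DG : Ω → H), IsCylindricalDeriv W G DG ∧
      eLpNorm (fun ω => F ω - G ω) 2 P ≤ ε ∧ eLpNorm (fun ω => DF ω - DG ω) 2 P ≤ ε) :
    IsMalliavinDeriv W P F DF := by
  have hpos : ∀ k : ℕ, (0 : ℝ≥0∞) < ((k + 1 : ℕ) : ℝ≥0∞)⁻¹ := fun k =>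
    ENNReal.inv_pos.2 (ENNReal.natCast_ne_top _)
  choose G DG hcyl hG hDG using fun k : ℕ => h _ (hpos k)
  have hlim := (tendsto_add_atTop_iff_nat 1).2 ENNReal.tendsto_inv_nat_nhds_zero
  exact ⟨hF, hDF, G, DG, hcyl,
    tendsto_of_tendsto_of_tendsto_of_le_of_le tendsto_const_nhds hlim (fun _ => zero_le) hG,
    tendsto_of_tendsto_of_tendsto_of_le_of_le tendsto_const_nhds hlim (fun _ => zero_le) hDG⟩

theorem IsMalliavinDeriv.exists_cylindrical {F : Ω → ℝ} {DF : Ω → H}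
    (h : IsMalliavinDeriv W P F DF) {ε : ℝ≥0∞} (hε : 0 < ε) :
    ∃ (G : Ω → ℝ) (DG : Ω → H), IsCylindricalDeriv W G DG ∧
      eLpNorm (fun ω => F ω - G ω) 2 P ≤ ε ∧ eLpNorm (fun ω => DF ω - DG ω) 2 P ≤ ε := by
  obtain ⟨-, -, G, DG, hG, hF, hD⟩ := h
  obtain ⟨k, hFk, hDk⟩ := ((hF.eventually (gt_mem_nhds hε)).and
    (hD.eventually (gt_mem_nhds hε))).exists
  exact ⟨G k, DG k, hG k, hFk.le, hDk.le⟩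

theorem IsIsonormal.isMalliavinDeriv_of_tendsto (hW : IsIsonormal W P) {F : Ω → ℝ} {DF : Ω → H}
    (hF : AEStronglyMeasurable F P) (hDF : AEStronglyMeasurable DF P) {α : Type*} {l : Filter α}
    [l.NeBot] {G : α → Ω → ℝ} {DG : α → Ω → H} (hG : ∀ a, IsMalliavinDeriv W P (G a) (DG a))
    (hFG : Tendsto (fun a => eLpNorm (fun ω => F ω - G a ω) 2 P) l (𝓝 0))
    (hDFG : Tendsto (fun a => eLpNorm (fun ω => DF ω - DG a ω) 2 P) l (𝓝 0)) :
    IsMalliavinDeriv W P F DF := by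
  refine isMalliavinDeriv_of_forall_pos hF hDF fun ε hε => ?_
  have hε2 : 0 < ε / 2 := ENNReal.half_pos hε.ne'
  obtain ⟨a, hFa, hDFa⟩ := ((hFG.eventually (gt_mem_nhds hε2)).and
    (hDFG.eventually (gt_mem_nhds hε2))).exists
  obtain ⟨G', DG', hG', hGG', hDGG'⟩ := (hG a).exists_cylindrical hε2
  obtain ⟨hG'm, hDG'm⟩ := hW.aestronglyMeasurable_cylindrical hG'
  rw [← ENNReal.add_halves ε]
  exact ⟨G', DG', hG',
    (eLpNorm_sub_le_add hF (hG a).1 hG'm one_le_two).trans (add_le_add hFa.le hGG'),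
    (eLpNorm_sub_le_add hDF (hG a).2.1 hDG'm one_le_two).trans (add_le_add hDFa.le hDGG')⟩

end MalliavinClosure

/-! ### The Malliavin derivative of a finite chaos expansion -/

section HermiteMonomial

theorem hasDerivAt_aeval_hermite (k : ℕ) (x : ℝ) :
    HasDerivAt (fun x : ℝ => Polynomial.aeval x (Polynomial.hermite k))
      (k * Polynomial.aeval x (Polynomial.hermite (k - 1))) x := by
  have hderiv := (Polynomial.hermite k).hasDerivAt_aeval x
  cases k with
  | zero => simpa using hderiv
  | succ k =>
    rw [derivative_hermite_succ] at hderiv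
    simpa using hderiv

variable {κ : Type*} [Fintype κ]

/-- The multivariate Hermite polynomial `∏ₗ H_{aₗ}(xₗ)`. -/
noncomputable def hermiteMonomial (a : κ → ℕ) (x : κ → ℝ) : ℝ :=
  ∏ l, Polynomial.aeval (x l) (Polynomial.hermite (a l))

theorem contDiff_hermiteMonomial (a : κ → ℕ) {m : WithTop ℕ∞} :
    ContDiff ℝ m (hermiteMonomial a) :=
  contDiff_prod fun l _ => (Polynomial.contDiff_aeval _ _).comp (contDiff_apply ℝ ℝ l)

theorem fderiv_hermiteMonomial_single [DecidableEq κ] (a : κ → ℕ) (x : κ → ℝ) (l : κ) :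
    fderiv ℝ (hermiteMonomial a) x (Pi.single l 1) =
      a l * hermiteMonomial (fun l' => a l' - if l' = l then 1 else 0) x := by
  have hderiv := HasFDerivAt.finsetProd (u := Finset.univ) (x := x) fun l' _ =>
    (hasDerivAt_aeval_hermite (a l') (x l')).comp_hasFDerivAt x
      (hasFDerivAt_apply (𝕜 := ℝ) (F' := fun _ : κ => ℝ) l' x)
  change HasFDerivAt (hermiteMonomial a) _ x at hderiv
  have hother : ∀ l' ∈ Finset.univ.erase l, Polynomial.aeval (x l')
      (Polynomial.hermite (a l' - if l' = l then 1 else 0)) =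
      Polynomial.aeval (x l') (Polynomial.hermite (a l')) := fun l' hl' => by
    simp [Finset.ne_of_mem_erase hl']
  rw [hderiv.fderiv, sum_apply, Finset.sum_eq_single l
    (fun l' _ hl' => by simp [Pi.single_eq_of_ne hl']) (by simp), hermiteMonomial,
    ← Finset.mul_prod_erase Finset.univ _ (Finset.mem_univ l), Finset.prod_congr rfl hother]
  simp
  ring

theorem AllMoments.hermiteMonomial {Ω : Type*} [MeasurableSpace Ω] {P : Measure Ω}
    [IsFiniteMeasure P] {G : κ → Ω → ℝ} (hG : ∀ l, AllMoments (G l) P) (a : κ → ℕ) :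
    AllMoments (fun ω => hermiteMonomial a fun l => G l ω) P :=
  AllMoments.prod Finset.univ fun l _ => (hG l).aeval _

end HermiteMonomial

section Multiplicity

variable {ι Q : Type*} [Fintype Q]

theorem sum_comp_eq_sum_mult_smul {M : Type*} [AddCommMonoid M] {T : Finset ι} {k : Q → ι}
    (hk : ∀ q, k q ∈ T) (x : ι → M) : ∑ q, x (k q) = ∑ j ∈ T, mult k j • x j :=
  prod_comp_eq_prod_pow_mult (M := Multiplicative M) hk x

theorem mult_subtype_ne [DecidableEq Q] [DecidableEq ι] (k : Q → ι) (q : Q) (j : ι) :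
    mult (fun q' : {q' // q' ≠ q} => k q') j = mult k j - if j = k q then 1 else 0 := by
  classical
  have hmap : (Finset.univ.filter fun q' : {q' // q' ≠ q} => k q' = j).map
      (Function.Embedding.subtype _) = (Finset.univ.filter fun q' => k q' = j).erase q := by
    ext q'
    simp [and_comm]
  have hcard := congrArg Finset.card hmap
  rw [Finset.card_map, Finset.card_erase_eq_ite] at hcard
  have hmult : mult (fun q' : {q' // q' ≠ q} => k q') j =
      if q ∈ Finset.univ.filter fun q' => k q' = j then mult k j - 1 else mult k j := by
    rw [mult, mult]
    convert! hcard
  rw [hmult]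
  by_cases hj : j = k q
  · simp [hj]
  · simp [hj, Ne.symm hj]

end Multiplicity

section BasisDeriv

variable {ι Ω H : Type*} [NormedAddCommGroup H] [InnerProductSpace ℝ H] {n : ℕ}

theorem hermiteProd_eq_hermiteMonomial {Q : Type*} [Fintype Q] (G : ι → Ω → ℝ) {T : Finset ι}
    {k : Q → ι} (hk : ∀ q, k q ∈ T) (ω : Ω) :
    hermiteProd G k ω = hermiteMonomial (fun j : T => mult k j) fun j => G j ω := by
  rw [hermiteProd_eq_prod G hk, ← Finset.prod_coe_sort, hermiteMonomial]

/-- The Malliavin derivative of the multiple integral of the symmetrization of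
`e_{i₁} ⊗ ⋯ ⊗ e_{iₙ}`: the sum over the slots `q` of the multiple integral of the remaining
factors times `e_{i_q}`. -/
noncomputable def basisDeriv (W : H → Ω → ℝ) (e : HilbertBasis ι ℝ H) (i : Fin n → ι)
    (ω : Ω) : H :=
  ∑ q : Fin n, hermiteProd (fun j => W (e j)) (fun q' : {q' // q' ≠ q} => i q') ω • e (i q)

variable (W : H → Ω → ℝ) (e : HilbertBasis ι ℝ H)

theorem basisIntegral_eq_hermiteMonomial {T : Finset ι} {i : Fin n → ι} (hi : ∀ q, i q ∈ T)
    (ω : Ω) : basisIntegral W e i ω =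
      hermiteMonomial (fun j : T => mult i j) (gaussianVec W (fun j : T => e j) ω) :=
  hermiteProd_eq_hermiteMonomial (fun j => W (e j)) hi ω

theorem basisDeriv_eq_cylindricalGrad [DecidableEq ι] {T : Finset ι} {i : Fin n → ι}
    (hi : ∀ q, i q ∈ T) (ω : Ω) : basisDeriv W e i ω =
      cylindricalGrad W (fun j : T => e j) (hermiteMonomial fun j : T => mult i j) ω := by
  have hslot : ∀ q, hermiteProd (fun j => W (e j)) (fun q' : {q' // q' ≠ q} => i q') ω =
      hermiteMonomial (fun j : T => mult i j - if (j : ι) = i q then 1 else 0)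
        (gaussianVec W (fun j : T => e j) ω) := fun q => by
    rw [hermiteProd_eq_hermiteMonomial _ fun q' : {q' // q' ≠ q} => hi q']
    simp only [mult_subtype_ne]
    rfl
  simp only [basisDeriv, hslot]
  rw [sum_comp_eq_sum_mult_smul hi fun j' => hermiteMonomial
      (fun j : T => mult i j - if (j : ι) = j' then 1 else 0)
      (gaussianVec W (fun j : T => e j) ω) • e j', ← Finset.sum_coe_sort]
  refine Finset.sum_congr rfl fun l _ => ?_
  rw [fderiv_hermiteMonomial_single, mul_smul, Nat.cast_smul_eq_nsmul]
  simp only [Subtype.ext_iff]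

theorem fderiv_sum_mul_apply {E α : Type*} [NormedAddCommGroup E] [NormedSpace ℝ E]
    (S : Finset α) (c : α → ℝ) {φ : α → E → ℝ} {x : E}
    (hφ : ∀ i ∈ S, DifferentiableAt ℝ (φ i) x) (v : E) :
    fderiv ℝ (fun x => ∑ i ∈ S, c i * φ i x) x v = ∑ i ∈ S, c i * fderiv ℝ (φ i) x v := by
  have hderiv : HasFDerivAt (fun x => ∑ i ∈ S, c i * φ i x) (∑ i ∈ S, c i • fderiv ℝ (φ i) x) x :=
    HasFDerivAt.fun_sum fun i hi => (hφ i hi).hasFDerivAt.const_mul (c i)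
  rw [hderiv.fderiv, sum_apply]
  rfl

theorem cylindricalGrad_sum {κ α : Type*} [Fintype κ] [DecidableEq κ] (h : κ → H) (S : Finset α)
    (c : α → ℝ) {φ : α → (κ → ℝ) → ℝ} (hφ : ∀ i ∈ S, Differentiable ℝ (φ i)) (ω : Ω) :
    cylindricalGrad W h (fun x => ∑ i ∈ S, c i * φ i x) ω =
      ∑ i ∈ S, c i • cylindricalGrad W h (φ i) ω := by
  simp only [cylindricalGrad, fderiv_sum_mul_apply S c fun i hi => hφ i hi _, Finset.sum_smul,
    Finset.smul_sum, smul_smul]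
  exact Finset.sum_comm

variable {W} [MeasurableSpace Ω] {P : Measure Ω} [IsFiniteMeasure P]

theorem isMalliavinDeriv_sum_basisIntegral (hW : IsIsonormal W P) (S : Finset (Fin n → ι))
    (c : (Fin n → ι) → ℝ) :
    IsMalliavinDeriv W P (fun ω => ∑ i ∈ S, c i * basisIntegral W e i ω)
      (fun ω => ∑ i ∈ S, c i • basisDeriv W e i ω) := by
  classical
  let T : Finset ι := S.biUnion fun i => Finset.univ.image i
  have hT : ∀ i ∈ S, ∀ q, i q ∈ T := fun i hi q =>
    Finset.mem_biUnion.2 ⟨i, hi, Finset.mem_image_of_mem _ (Finset.mem_univ q)⟩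
  let φ : (Fin n → ι) → (T → ℝ) → ℝ := fun i => hermiteMonomial fun j : T => mult i j
  have hφ : ∀ i, ContDiff ℝ ((⊤ : ℕ∞) : WithTop ℕ∞) (φ i) := fun i => contDiff_hermiteMonomial _
  have hφd : ∀ i, Differentiable ℝ (φ i) := fun i => (hφ i).differentiable (by simp)
  have hmom : ∀ a : T → ℕ, AllMoments
      (fun ω => hermiteMonomial a (gaussianVec W (fun j : T => e j) ω)) P :=
    AllMoments.hermiteMonomial fun j => hW.allMoments (e j)
  have hI : (fun ω => ∑ i ∈ S, c i * basisIntegral W e i ω) =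
      fun ω => ∑ i ∈ S, c i * φ i (gaussianVec W (fun j : T => e j) ω) := by
    ext ω
    exact Finset.sum_congr rfl fun i hi => by rw [basisIntegral_eq_hermiteMonomial W e (hT i hi)]
  have hD : (fun ω => ∑ i ∈ S, c i • basisDeriv W e i ω) =
      cylindricalGrad W (fun j : T => e j) fun x => ∑ i ∈ S, c i * φ i x := by
    ext ω
    rw [cylindricalGrad_sum W _ S c fun i _ => hφd i]
    exact Finset.sum_congr rfl fun i hi => by rw [basisDeriv_eq_cylindricalGrad W e (hT i hi)]
  rw [hI, hD]
  refine hW.isMalliavinDeriv_of_contDiff (fun j : T => e j)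
    (ContDiff.sum fun i _ => contDiff_const.mul (hφ i))
    (AllMoments.sum S fun i _ => (hmom _).const_mul _).memLp_two fun l => ?_
  simp only [fderiv_sum_mul_apply S c fun i _ => hφd i _, φ, fderiv_hermiteMonomial_single]
  exact (AllMoments.sum S fun i _ => ((hmom _).const_mul _).const_mul _).memLp_two

end BasisDeriv

/-! ### Moments of Hilbert-space-valued chaos -/

section VectorChaos

variable {Ω E : Type*} [MeasurableSpace Ω] {P : Measure Ω} [NormedAddCommGroup E]

theorem eLpNorm_norm_sq (F : Ω → E) (p : ℕ) :
    eLpNorm (fun ω => ‖F ω‖ ^ 2) p P = eLpNorm F (2 * p : ℕ) P ^ 2 := by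
  have hpow := eLpNorm_norm_rpow (p := (p : ℝ≥0∞)) (μ := P) F (q := ((2 : ℕ) : ℝ)) (by norm_num)
  simp only [Real.rpow_natCast, ENNReal.rpow_natCast] at hpow
  rw [hpow, ENNReal.ofReal_natCast, Nat.cast_mul, mul_comm]

theorem eLpNorm_sum_smul_orthonormal_sq_le [InnerProductSpace ℝ E] {κ : Type*} {b : κ → E}
    (hb : Orthonormal ℝ b) (T : Finset κ) {A : κ → Ω → ℝ}
    (hA : ∀ j ∈ T, AEStronglyMeasurable (A j) P) {p : ℕ} (hp : p ≠ 0) :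
    eLpNorm (fun ω => ∑ j ∈ T, A j ω • b j) (2 * p : ℕ) P ^ 2 ≤
      ∑ j ∈ T, eLpNorm (A j) (2 * p : ℕ) P ^ 2 := by
  have hpythagoras : (fun ω => ‖∑ j ∈ T, A j ω • b j‖ ^ 2) = ∑ j ∈ T, fun ω => ‖A j ω‖ ^ 2 := by
    ext ω
    rw [← real_inner_self_eq_norm_sq, hb.inner_sum, Finset.sum_apply]
    exact Finset.sum_congr rfl fun j _ => by simp [sq]
  simp only [← eLpNorm_norm_sq, hpythagoras]
  exact eLpNorm_sum_le (fun j hj => (hA j hj).norm.pow 2)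
    (by exact_mod_cast Nat.one_le_iff_ne_zero.2 hp)

theorem exists_orthonormal_expansion [InnerProductSpace ℝ E] {κ : Type*} (S : Finset κ)
    (ξ : κ → E) : ∃ (d : ℕ) (b : Fin d → E), Orthonormal ℝ b ∧
      ∀ k ∈ S, ξ k = ∑ j, inner ℝ (b j) (ξ k) • b j ∧
        ‖ξ k‖ ^ 2 = ∑ j, inner ℝ (b j) (ξ k) ^ 2 := by
  have : FiniteDimensional ℝ (Submodule.span ℝ (ξ '' S)) :=
    FiniteDimensional.span_of_finite ℝ (S.finite_toSet.image ξ)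
  let b := stdOrthonormalBasis ℝ (Submodule.span ℝ (ξ '' S))
  refine ⟨_, fun j => b j, b.orthonormal.comp_linearIsometry (Submodule.subtypeₗᵢ _),
    fun k hk => ?_⟩
  let x : Submodule.span ℝ (ξ '' S) := ⟨ξ k, Submodule.subset_span (mem_image_of_mem ξ hk)⟩
  constructor
  · simpa using! congrArg Subtype.val (b.sum_repr' x).symm
  · simpa using! (b.sum_sq_norm_inner_right x).symm

variable {Q ι : Type*} [Fintype Q] {G : ι → Ω → ℝ} [IsProbabilityMeasure P]

/-- The constant with which the `L²ᵖ` norm of a chaos with slots `Q` is bounded by the `ℓ²` norm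
of its coefficients. -/
noncomputable def chaosConst (p : ℕ) (Q : Type*) [Fintype Q] : ℝ := √(1 + wickConst (Fin p × Q))

theorem chaosConst_nonneg (p : ℕ) (Q : Type*) [Fintype Q] : 0 ≤ chaosConst p Q := Real.sqrt_nonneg _

theorem eLpNorm_sum_hermiteProd_le (hind : iIndepFun G P)
    (hlaw : ∀ j, HasLaw (G j) (gaussianReal 0 1) P) (S : Finset (Q → ι)) (c : (Q → ι) → ℝ)
    {p : ℕ} (hp : p ≠ 0) :
    eLpNorm (fun ω => ∑ k ∈ S, c k * hermiteProd G k ω) (2 * p : ℕ) P ≤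
      ENNReal.ofReal (chaosConst p Q * √(∑ k ∈ S, c k ^ 2)) := by
  have hw : 0 ≤ wickConst (Fin p × Q) := wickConst_nonneg _
  rw [← ENNReal.pow_le_pow_left_iff (n := 2 * p) (by positivity),
    eLpNorm_natCast_pow (by positivity), ← ENNReal.ofReal_pow (by unfold chaosConst; positivity)]
  refine (lintegral_enorm_sum_hermiteProd_pow_le hind hlaw S c hp).trans
    (ENNReal.ofReal_le_ofReal ?_)
  rw [mul_pow, pow_mul, pow_mul, chaosConst, Real.sq_sqrt (by positivity),
    Real.sq_sqrt (by positivity)]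
  gcongr
  exact (le_add_of_nonneg_left zero_le_one).trans (le_self_pow₀ (le_add_of_nonneg_right hw) hp)

theorem eLpNorm_sum_hermiteProd_smul_le [InnerProductSpace ℝ E] (hind : iIndepFun G P)
    (hlaw : ∀ j, HasLaw (G j) (gaussianReal 0 1) P) (S : Finset (Q → ι)) (ξ : (Q → ι) → E)
    {p : ℕ} (hp : p ≠ 0) :
    eLpNorm (fun ω => ∑ k ∈ S, hermiteProd G k ω • ξ k) (2 * p : ℕ) P ≤
      ENNReal.ofReal (chaosConst p Q * √(∑ k ∈ S, ‖ξ k‖ ^ 2)) := by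
  obtain ⟨d, b, hb, hξ⟩ := exists_orthonormal_expansion S ξ
  have hcoord : (fun ω => ∑ k ∈ S, hermiteProd G k ω • ξ k) =
      fun ω => ∑ j, (∑ k ∈ S, inner ℝ (b j) (ξ k) * hermiteProd G k ω) • b j := by
    ext ω
    simp only [Finset.sum_smul]
    rw [Finset.sum_comm]
    refine Finset.sum_congr rfl fun k hk => ?_
    conv_lhs => rw [(hξ k hk).1, Finset.smul_sum]
    simp only [smul_smul, mul_comm]
  have hmeas : ∀ j, AEStronglyMeasurable
      (fun ω => ∑ k ∈ S, inner ℝ (b j) (ξ k) * hermiteProd G k ω) P := fun j =>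
    Finset.aestronglyMeasurable_fun_sum _ fun k _ =>
      (aestronglyMeasurable_hermiteProd (fun i => (hlaw i).aemeasurable) k).const_mul _
  have hK : 0 ≤ chaosConst p Q := chaosConst_nonneg p Q
  have hsq : ∀ x : ℝ, 0 ≤ x → (chaosConst p Q * √x) ^ 2 = chaosConst p Q ^ 2 * x := fun x hx => by
    rw [mul_pow, Real.sq_sqrt hx]
  rw [hcoord, ← ENNReal.pow_le_pow_left_iff two_ne_zero, ← ENNReal.ofReal_pow (by positivity),
    hsq _ (by positivity)]
  calc eLpNorm (fun ω => ∑ j, (∑ k ∈ S, inner ℝ (b j) (ξ k) * hermiteProd G k ω) • b j)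
        (2 * p : ℕ) P ^ 2
      ≤ ∑ j, eLpNorm (fun ω => ∑ k ∈ S, inner ℝ (b j) (ξ k) * hermiteProd G k ω)
          (2 * p : ℕ) P ^ 2 :=
        eLpNorm_sum_smul_orthonormal_sq_le hb _ (fun j _ => hmeas j) hp
    _ ≤ ∑ j, ENNReal.ofReal (chaosConst p Q ^ 2 * ∑ k ∈ S, inner ℝ (b j) (ξ k) ^ 2) := by
        gcongr with j
        rw [← hsq _ (by positivity), ENNReal.ofReal_pow (by positivity)]
        gcongr
        exact eLpNorm_sum_hermiteProd_le hind hlaw S _ hp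
    _ = ENNReal.ofReal (chaosConst p Q ^ 2 * ∑ k ∈ S, ‖ξ k‖ ^ 2) := by
        rw [← ENNReal.ofReal_sum_of_nonneg fun j _ => by positivity, ← Finset.mul_sum,
          Finset.sum_comm, Finset.sum_congr rfl fun k hk => (hξ k hk).2.symm]

end VectorChaos

/-! ### Contractions of kernels -/

section Contraction

variable {ι H : Type*} [NormedAddCommGroup H] [InnerProductSpace ℝ H] {n : ℕ}

theorem hasSum_sq (f : TensorPow ι n) : HasSum (fun i => f i ^ 2) (‖f‖ ^ 2) := by
  simpa using lp.hasSum_norm (p := 2) (by norm_num) f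

/-- The multi-index with entry `j` in slot `q` and the entries of `k` in the other slots. -/
def insertSlot (q : Fin n) (k : {q' // q' ≠ q} → ι) (j : ι) : Fin n → ι :=
  (Equiv.funSplitAt q ι).symm (j, k)

theorem insertSlot_injective (q : Fin n) (k : {q' // q' ≠ q} → ι) :
    Function.Injective (insertSlot q k) :=
  (Equiv.funSplitAt q ι).symm.injective.comp (Prod.mk_left_injective k)

theorem insertSlot_eq_iff {q : Fin n} {k : {q' // q' ≠ q} → ι} {j : ι} {i : Fin n → ι} :
    insertSlot q k j = i ↔ j = i q ∧ k = fun q' : {q' // q' ≠ q} => i q' := by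
  rw [insertSlot, Equiv.symm_apply_eq, Prod.ext_iff]
  rfl

theorem update_insertSlot [DecidableEq (Fin n)] (q : Fin n) (k : {q' // q' ≠ q} → ι) (j j' : ι) :
    Function.update (insertSlot q k j) q j' = insertSlot q k j' := by
  refine (insertSlot_eq_iff.2 ⟨by simp, funext fun q' => ?_⟩).symm
  rw [Function.update_of_ne q'.2]
  exact congrFun (insertSlot_eq_iff.1 (rfl : insertSlot q k j = _)).2 q'

theorem exists_hasSum_insertSlot (e : HilbertBasis ι ℝ H) (f : TensorPow ι n) (q : Fin n)
    (k : {q' // q' ≠ q} → ι) : ∃ ξ : H, HasSum (fun j => f (insertSlot q k j) • e j) ξ ∧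
      HasSum (fun j => f (insertSlot q k j) ^ 2) (‖ξ‖ ^ 2) := by
  have hmem : Memℓp (fun j => f (insertSlot q k j)) 2 := memℓp_gen <| by
    simpa using! (hasSum_sq f).summable.comp_injective (insertSlot_injective q k)
  refine ⟨_, e.hasSum_repr_symm ⟨_, hmem⟩, ?_⟩
  rw [LinearIsometryEquiv.norm_map]
  simpa using lp.hasSum_norm (p := 2) (by norm_num) (⟨_, hmem⟩ : lp (fun _ : ι => ℝ) 2)

/-- The contraction of a kernel with the tensor `e_{k}` in all slots but `q`. -/
noncomputable def contraction (e : HilbertBasis ι ℝ H) (q : Fin n) (k : {q' // q' ≠ q} → ι) :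
    TensorPow ι n →ₗ[ℝ] H where
  toFun f := ∑' j, f (insertSlot q k j) • e j
  map_add' f f' := by
    obtain ⟨ξ, hξ, -⟩ := exists_hasSum_insertSlot e f q k
    obtain ⟨ξ', hξ', -⟩ := exists_hasSum_insertSlot e f' q k
    rw [hξ.tsum_eq, hξ'.tsum_eq, ← (hξ.add hξ').tsum_eq]
    simp only [lp.coeFn_add, Pi.add_apply, add_smul]
  map_smul' c f := by
    obtain ⟨ξ, hξ, -⟩ := exists_hasSum_insertSlot e f q k
    rw [hξ.tsum_eq, RingHom.id_apply, ← (hξ.const_smul c).tsum_eq]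
    simp only [lp.coeFn_smul, Pi.smul_apply, smul_assoc]

theorem contraction_mem_contractionSpace (e : HilbertBasis ι ℝ H) (q : Fin n)
    (k : {q' // q' ≠ q} → ι) (f : TensorPow ι n) : contraction e q k f ∈ contractionSpace e f := by
  rcases isEmpty_or_nonempty ι with hι | ⟨⟨j⟩⟩
  · simp [contraction]
  · exact Submodule.le_topologicalClosure _ (Submodule.subset_span
      ⟨q, insertSlot q k j, by simp only [update_insertSlot, contraction, LinearMap.coe_mk,
        AddHom.coe_mk]⟩)

theorem hasSum_sq_contraction (e : HilbertBasis ι ℝ H) (q : Fin n) (k : {q' // q' ≠ q} → ι)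
    (f : TensorPow ι n) :
    HasSum (fun j => f (insertSlot q k j) ^ 2) (‖contraction e q k f‖ ^ 2) := by
  obtain ⟨ξ, hξ, hsq⟩ := exists_hasSum_insertSlot e f q k
  rwa [← hξ.tsum_eq] at hsq

theorem sum_norm_sq_contraction_le (e : HilbertBasis ι ℝ H) (q : Fin n)
    (A : Finset ({q' // q' ≠ q} → ι)) (f : TensorPow ι n) :
    ∑ k ∈ A, ‖contraction e q k f‖ ^ 2 ≤ ‖f‖ ^ 2 := by
  have hsplit : HasSum (fun x : ({q' // q' ≠ q} → ι) × ι => f (insertSlot q x.1 x.2) ^ 2)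
      (‖f‖ ^ 2) :=
    ((Equiv.prodComm _ _).trans (Equiv.funSplitAt q ι).symm).hasSum_iff.2 (hasSum_sq f)
  exact sum_le_hasSum A (fun _ _ => sq_nonneg _)
    (hsplit.prod_fiberwise fun k => hasSum_sq_contraction e q k f)

theorem contraction_single [DecidableEq ι] (e : HilbertBasis ι ℝ H) (q : Fin n)
    (k : {q' // q' ≠ q} → ι) (i : Fin n → ι) (c : ℝ) :
    contraction e q k (lp.single 2 i c) =
      if k = fun q' : {q' // q' ≠ q} => i q' then c • e (i q) else 0 := by
  have hcoeff : ∀ j, (lp.single 2 i c : TensorPow ι n) (insertSlot q k j) =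
      if j = i q ∧ k = fun q' : {q' // q' ≠ q} => i q' then c else 0 := fun j => by
    rw [lp.single_apply, Pi.single_apply]
    simp only [insertSlot_eq_iff]
  change ∑' j, _ • e j = _
  rw [tsum_eq_single (i q) fun j hj => by
    rw [hcoeff, if_neg fun h => hj h.1, zero_smul]]
  simp only [hcoeff, true_and, ite_smul, zero_smul]

end Contraction

/-! ### The derivative of a chaos variable -/

section PartialDeriv

variable {Ω ι H : Type*} [NormedAddCommGroup H] [InnerProductSpace ℝ H] {n : ℕ}

/-- The part of the derivative of `Iₙ(f)` built from the contractions of `f` with the finitely many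
tensors `e_{k}`, `k ∈ A q`, in the slots other than `q`. -/
noncomputable def partialDeriv (W : H → Ω → ℝ) (e : HilbertBasis ι ℝ H)
    (A : ∀ q : Fin n, Finset ({q' // q' ≠ q} → ι)) (ω : Ω) : TensorPow ι n →ₗ[ℝ] H :=
  ∑ q, ∑ k ∈ A q, hermiteProd (fun j => W (e j)) k ω • contraction e q k

theorem partialDeriv_apply (W : H → Ω → ℝ) (e : HilbertBasis ι ℝ H)
    (A : ∀ q : Fin n, Finset ({q' // q' ≠ q} → ι)) (ω : Ω) (f : TensorPow ι n) :
    partialDeriv W e A ω f =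
      ∑ q, ∑ k ∈ A q, hermiteProd (fun j => W (e j)) k ω • contraction e q k f := by
  simp only [partialDeriv, LinearMap.sum_apply, LinearMap.smul_apply]

theorem partialDeriv_mem_contractionSpace (W : H → Ω → ℝ) (e : HilbertBasis ι ℝ H)
    (A : ∀ q : Fin n, Finset ({q' // q' ≠ q} → ι)) (ω : Ω) (f : TensorPow ι n) :
    partialDeriv W e A ω f ∈ contractionSpace e f := by
  rw [partialDeriv_apply]
  exact Submodule.sum_mem _ fun q _ => Submodule.sum_mem _ fun k _ =>
    Submodule.smul_mem _ _ (contraction_mem_contractionSpace e q k f)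

/-- The multi-indices that remain of those in `S` when slot `q` is removed. -/
def slotRestrictions [DecidableEq ι] (S : Finset (Fin n → ι)) (q : Fin n) :
    Finset ({q' // q' ≠ q} → ι) :=
  S.image fun i q' => i q'

theorem partialDeriv_slotRestrictions_single [DecidableEq ι] (W : H → Ω → ℝ)
    (e : HilbertBasis ι ℝ H) {S : Finset (Fin n → ι)} {i : Fin n → ι} (hi : i ∈ S) (ω : Ω) (c : ℝ) :
    partialDeriv W e (slotRestrictions S) ω (lp.single 2 i c) = c • basisDeriv W e i ω := by
  rw [partialDeriv_apply, basisDeriv, Finset.smul_sum]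
  refine Finset.sum_congr rfl fun q _ => ?_
  have hmem : (fun q' : {q' // q' ≠ q} => i q') ∈ slotRestrictions S q :=
    Finset.mem_image_of_mem _ hi
  simp only [contraction_single, smul_ite, smul_zero]
  rw [Finset.sum_ite_eq_of_mem' _ _ _ hmem, smul_comm]

theorem partialDeriv_slotRestrictions_sum_single [DecidableEq ι] (W : H → Ω → ℝ)
    (e : HilbertBasis ι ℝ H) (S : Finset (Fin n → ι)) (ω : Ω) (c : (Fin n → ι) → ℝ) :
    partialDeriv W e (slotRestrictions S) ω (∑ i ∈ S, lp.single 2 i (c i)) =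
      ∑ i ∈ S, c i • basisDeriv W e i ω := by
  rw [map_sum]
  exact Finset.sum_congr rfl fun i hi => partialDeriv_slotRestrictions_single W e hi ω (c i)

theorem norm_sum_single [DecidableEq ι] (S : Finset (Fin n → ι)) (c : (Fin n → ι) → ℝ) :
    ‖(∑ i ∈ S, lp.single 2 i (c i) : TensorPow ι n)‖ = √(∑ i ∈ S, c i ^ 2) := by
  rw [eq_comm, Real.sqrt_eq_iff_mul_self_eq (by positivity) (norm_nonneg _), ← sq]
  simpa using! (lp.norm_sum_single (E := fun _ : Fin n → ι => ℝ) (p := 2) (by norm_num) c S).symm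

variable [MeasurableSpace Ω] {W : H → Ω → ℝ} {P : Measure Ω}

theorem IsIsonormal.aestronglyMeasurable_partialDeriv (hW : IsIsonormal W P)
    (e : HilbertBasis ι ℝ H) (A : ∀ q : Fin n, Finset ({q' // q' ≠ q} → ι)) (f : TensorPow ι n) :
    AEStronglyMeasurable (fun ω => partialDeriv W e A ω f) P := by
  simp only [partialDeriv_apply]
  exact Finset.aestronglyMeasurable_fun_sum _ fun q _ => Finset.aestronglyMeasurable_fun_sum _
    fun k _ => (aestronglyMeasurable_hermiteProd
      (fun j => (hW.hasLaw_basis e j).aemeasurable) k).smul_const _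

theorem IsIsonormal.aestronglyMeasurable_sum_basisDeriv (hW : IsIsonormal W P)
    (e : HilbertBasis ι ℝ H) (S : Finset (Fin n → ι)) (c : (Fin n → ι) → ℝ) :
    AEStronglyMeasurable (fun ω => ∑ i ∈ S, c i • basisDeriv W e i ω) P := by
  classical
  simp only [← partialDeriv_slotRestrictions_sum_single]
  exact hW.aestronglyMeasurable_partialDeriv e _ _

/-- The constant in the bound of the `L^{2p}`-norm of the derivative of `Iₙ(f)` by `‖f‖`. -/
noncomputable def derivConst (p n : ℕ) : ℝ := ∑ q : Fin n, chaosConst p {q' // q' ≠ q}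

theorem derivConst_nonneg (p n : ℕ) : 0 ≤ derivConst p n :=
  Finset.sum_nonneg fun _ _ => chaosConst_nonneg _ _

variable [IsProbabilityMeasure P]

theorem IsIsonormal.eLpNorm_partialDeriv_le (hW : IsIsonormal W P) (e : HilbertBasis ι ℝ H)
    (A : ∀ q : Fin n, Finset ({q' // q' ≠ q} → ι)) (f : TensorPow ι n) {p : ℕ} (hp : p ≠ 0) :
    eLpNorm (fun ω => partialDeriv W e A ω f) (2 * p : ℕ) P ≤
      ENNReal.ofReal (derivConst p n * ‖f‖) := by
  have hslot : ∀ q : Fin n, eLpNorm (fun ω => ∑ k ∈ A q,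
      hermiteProd (fun j => W (e j)) k ω • contraction e q k f) (2 * p : ℕ) P ≤
        ENNReal.ofReal (chaosConst p {q' // q' ≠ q} * ‖f‖) := fun q => by
    refine (eLpNorm_sum_hermiteProd_smul_le (hW.iIndepFun_basis e) (hW.hasLaw_basis e) (A q)
      (fun k => contraction e q k f) hp).trans (ENNReal.ofReal_le_ofReal ?_)
    exact mul_le_mul_of_nonneg_left
      (Real.sqrt_le_iff.2 ⟨norm_nonneg f, sum_norm_sq_contraction_le e q (A q) f⟩)
      (chaosConst_nonneg p _)
  simp only [partialDeriv_apply]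
  rw [derivConst, Finset.sum_mul,
    ENNReal.ofReal_sum_of_nonneg fun q _ => mul_nonneg (chaosConst_nonneg p _) (norm_nonneg f),
    ← Finset.sum_fn]
  refine (eLpNorm_sum_le (fun q _ => Finset.aestronglyMeasurable_fun_sum _ fun k _ => ?_)
    (by exact_mod_cast (by lia : 1 ≤ 2 * p))).trans (Finset.sum_le_sum fun q _ => hslot q)
  exact (aestronglyMeasurable_hermiteProd
    (fun j => (hW.hasLaw_basis e j).aemeasurable) k).smul_const _

theorem IsIsonormal.eLpNorm_sum_basisDeriv_le (hW : IsIsonormal W P) (e : HilbertBasis ι ℝ H)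
    (S : Finset (Fin n → ι)) (c : (Fin n → ι) → ℝ) {p : ℕ} (hp : p ≠ 0) :
    eLpNorm (fun ω => ∑ i ∈ S, c i • basisDeriv W e i ω) (2 * p : ℕ) P ≤
      ENNReal.ofReal (derivConst p n * √(∑ i ∈ S, c i ^ 2)) := by
  classical
  simp only [← partialDeriv_slotRestrictions_sum_single, ← norm_sum_single]
  exact hW.eLpNorm_partialDeriv_le e _ _ hp

end PartialDeriv

theorem coeFn_sum_toLp {Ω α E : Type*} [MeasurableSpace Ω] {P : Measure Ω} [NormedAddCommGroup E]
    {p : ℝ≥0∞} {x : α → Ω → E} (hx : ∀ i, MemLp (x i) p P) (S : Finset α) :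
    ⇑(∑ i ∈ S, (hx i).toLp) =ᵐ[P] fun ω => ∑ i ∈ S, x i ω := by
  induction S using Finset.cons_induction with
  | empty => simpa using! Lp.coeFn_zero E p P
  | cons i S hi ih =>
    rw [Finset.sum_cons]
    filter_upwards [Lp.coeFn_add (hx i).toLp (∑ i ∈ S, (hx i).toLp), (hx i).coeFn_toLp, ih]
      with ω hadd hi hS
    rw [hadd, Pi.add_apply, hi, hS, Finset.sum_cons]

theorem summable_of_norm_sum_le_mul_sqrt {α E : Type*} [NormedAddCommGroup E] [CompleteSpace E]
    {x : α → E} {c : α → ℝ} {K : ℝ} (hx : ∀ S : Finset α, ‖∑ i ∈ S, x i‖ ≤ K * √(∑ i ∈ S, c i ^ 2))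
    (hc : Summable fun i => c i ^ 2) : Summable x := by
  refine summable_iff_vanishing_norm.2 fun ε hε => ?_
  obtain ⟨s, hs⟩ := summable_iff_vanishing_norm.1 hc ((ε / (|K| + 1)) ^ 2) (by positivity)
  refine ⟨s, fun t ht => ?_⟩
  have hsqrt : √(∑ i ∈ t, c i ^ 2) < ε / (|K| + 1) :=
    (Real.sqrt_lt' (by positivity)).2 ((le_abs_self _).trans_lt (hs t ht))
  calc ‖∑ i ∈ t, x i‖ ≤ K * √(∑ i ∈ t, c i ^ 2) := hx t
    _ ≤ (|K| + 1) * √(∑ i ∈ t, c i ^ 2) := by gcongr; linarith [le_abs_self K]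
    _ < (|K| + 1) * (ε / (|K| + 1)) := by gcongr
    _ = ε := mul_div_cancel₀ _ (by positivity)

theorem exists_seq_tendsto_ae_of_tendsto_eLpNorm {Ω α E : Type*} [MeasurableSpace Ω]
    {P : Measure Ω} [NormedAddCommGroup E] {l : Filter α} [l.NeBot] {p : ℝ≥0∞} (hp : p ≠ 0)
    {V : Ω → E} {Y : α → Ω → E} (hV : AEStronglyMeasurable V P)
    (hY : ∀ a, AEStronglyMeasurable (Y a) P)
    (hlim : Tendsto (fun a => eLpNorm (fun ω => V ω - Y a ω) p P) l (𝓝 0)) :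
    ∃ a : ℕ → α, ∀ᵐ ω ∂P, Tendsto (fun k => Y (a k) ω) atTop (𝓝 (V ω)) := by
  obtain ⟨δ, -, hδ, hδlim⟩ := exists_seq_strictAnti_tendsto' (zero_lt_one' ℝ≥0∞)
  choose a ha using fun k => (hlim.eventually (gt_mem_nhds (hδ k).1)).exists
  have halim : Tendsto (fun k => eLpNorm (Y (a k) - V) p P) atTop (𝓝 0) :=
    tendsto_of_tendsto_of_tendsto_of_le_of_le tendsto_const_nhds hδlim (fun _ => zero_le)
      fun k => (eLpNorm_sub_comm _ _ p P).trans_le (ha k).le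
  obtain ⟨ns, -, hns⟩ := (tendstoInMeasure_of_tendsto_eLpNorm hp (fun k => hY (a k)) hV
    halim).exists_seq_tendsto_ae
  exact ⟨a ∘ ns, hns⟩

theorem eLpNorm_le_of_tendsto_eLpNorm {Ω α E : Type*} [MeasurableSpace Ω]
    {P : Measure Ω} [NormedAddCommGroup E] {l : Filter α} [l.NeBot] {p q : ℝ≥0∞} (hp : p ≠ 0)
    {V : Ω → E} {Y : α → Ω → E} (hV : AEStronglyMeasurable V P)
    (hY : ∀ a, AEStronglyMeasurable (Y a) P)
    (hlim : Tendsto (fun a => eLpNorm (fun ω => V ω - Y a ω) p P) l (𝓝 0)) {B : ℝ≥0∞}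
    (hB : ∀ a, eLpNorm (Y a) q P ≤ B) : eLpNorm V q P ≤ B := by
  obtain ⟨a, ha⟩ := exists_seq_tendsto_ae_of_tendsto_eLpNorm hp hV hY hlim
  exact (Lp.eLpNorm_lim_le_liminf_eLpNorm (fun k => hY (a k)) V ha).trans
    (liminf_le_of_frequently_le' (Frequently.of_forall fun k => hB (a k)))

section ChaosDeriv

variable {Ω ι H : Type*} [MeasurableSpace Ω] [NormedAddCommGroup H] [InnerProductSpace ℝ H]
  {W : H → Ω → ℝ} {P : Measure Ω} {n : ℕ} {e : HilbertBasis ι ℝ H} {f f' : TensorPow ι n}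
  {V V' : Ω → H}

/-- `V` is the Malliavin derivative of `Iₙ(f)`, obtained as the `L²`-limit of the derivatives of the
partial sums of the expansion of `f` in the basis tensors. -/
def IsChaosDeriv (W : H → Ω → ℝ) (P : Measure Ω) (e : HilbertBasis ι ℝ H) (f : TensorPow ι n)
    (V : Ω → H) : Prop :=
  AEStronglyMeasurable V P ∧ Tendsto (fun S : Finset (Fin n → ι) =>
    eLpNorm (fun ω => V ω - ∑ i ∈ S, f i • basisDeriv W e i ω) 2 P) atTop (𝓝 0)

theorem IsChaosDeriv.congr_ae (hV : IsChaosDeriv W P e f V)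
    (hVV' : V =ᵐ[P] V') : IsChaosDeriv W P e f V' := by
  refine ⟨hV.1.congr hVV', hV.2.congr fun S => eLpNorm_congr_ae ?_⟩
  filter_upwards [hVV'] with ω hω
  rw [hω]

theorem IsChaosDeriv.sub (hW : IsIsonormal W P) (hV : IsChaosDeriv W P e f V)
    (hV' : IsChaosDeriv W P e f' V') : IsChaosDeriv W P e (f - f') (V - V') := by
  have hlim := hV.2.add hV'.2
  rw [add_zero] at hlim
  refine ⟨hV.1.sub hV'.1, tendsto_of_tendsto_of_tendsto_of_le_of_le tendsto_const_nhds hlim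
    (fun _ => zero_le) fun S => ?_⟩
  convert! eLpNorm_sub_le (hV.1.sub (hW.aestronglyMeasurable_sum_basisDeriv e S f))
    (hV'.1.sub (hW.aestronglyMeasurable_sum_basisDeriv e S f')) one_le_two using 2
  ext ω
  simp only [lp.coeFn_sub, Pi.sub_apply, sub_smul, Finset.sum_sub_distrib]
  exact sub_sub_sub_comm _ _ _ _

variable [IsProbabilityMeasure P]

theorem exists_isChaosDeriv [CompleteSpace H] (hW : IsIsonormal W P) (e : HilbertBasis ι ℝ H)
    (f : TensorPow ι n) : ∃ V, IsChaosDeriv W P e f V := by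
  have hbound : ∀ S : Finset (Fin n → ι), eLpNorm (fun ω => ∑ i ∈ S, f i • basisDeriv W e i ω) 2 P ≤
      ENNReal.ofReal (derivConst 1 n * √(∑ i ∈ S, f i ^ 2)) := fun S => by
    simpa using hW.eLpNorm_sum_basisDeriv_le e S f one_ne_zero
  have hmem : ∀ i, MemLp (fun ω => f i • basisDeriv W e i ω) 2 P := fun i => by
    refine ⟨?_, lt_of_le_of_lt ?_ (ENNReal.ofReal_lt_top (r := derivConst 1 n * √(f i ^ 2)))⟩
    · simpa using hW.aestronglyMeasurable_sum_basisDeriv e {i} f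
    · simpa using hbound {i}
  have hcoe : ∀ S : Finset (Fin n → ι), ⇑(∑ i ∈ S, (hmem i).toLp) =ᵐ[P]
      fun ω => ∑ i ∈ S, f i • basisDeriv W e i ω := fun S => coeFn_sum_toLp hmem S
  obtain ⟨V, hV⟩ := summable_of_norm_sum_le_mul_sqrt (x := fun i => (hmem i).toLp)
    (c := f) (K := derivConst 1 n) (fun S => by
      rw [Lp.norm_def, eLpNorm_congr_ae (hcoe S)]
      exact ENNReal.toReal_le_of_le_ofReal
        (mul_nonneg (derivConst_nonneg 1 n) (Real.sqrt_nonneg _)) (hbound S)) (hasSum_sq f).summable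
  refine ⟨V, Lp.aestronglyMeasurable V,
    ((Lp.tendsto_Lp_iff_tendsto_eLpNorm' _ _).1 hV).congr fun S => ?_⟩
  rw [eLpNorm_sub_comm]
  refine eLpNorm_congr_ae ?_
  filter_upwards [hcoe S] with ω hω
  rw [Pi.sub_apply, hω]

theorem IsChaosDeriv.eLpNorm_le (hW : IsIsonormal W P) (hV : IsChaosDeriv W P e f V) {p : ℕ}
    (hp : p ≠ 0) : eLpNorm V (2 * p : ℕ) P ≤ ENNReal.ofReal (derivConst p n * ‖f‖) := by
  refine eLpNorm_le_of_tendsto_eLpNorm two_ne_zero hV.1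
    (fun S => hW.aestronglyMeasurable_sum_basisDeriv e S f) hV.2 fun S =>
      (hW.eLpNorm_sum_basisDeriv_le e S f hp).trans (ENNReal.ofReal_le_ofReal ?_)
  exact mul_le_mul_of_nonneg_left (Real.sqrt_le_iff.2
    ⟨norm_nonneg f, sum_le_hasSum S (fun _ _ => sq_nonneg _) (hasSum_sq f)⟩)
    (derivConst_nonneg p n)

theorem IsChaosDeriv.isMalliavinDeriv (hW : IsIsonormal W P) (hV : IsChaosDeriv W P e f V)
    {X : Ω → ℝ} (hX : IsMultipleIntegral W P e f X) : IsMalliavinDeriv W P X V :=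
  hW.isMalliavinDeriv_of_tendsto hX.1 hV.1 (fun S => isMalliavinDeriv_sum_basisIntegral e hW S f)
    hX.2 hV.2

theorem IsChaosDeriv.tendsto_partialDeriv [DecidableEq ι] (hW : IsIsonormal W P)
    (hV : IsChaosDeriv W P e f V) :
    Tendsto (fun S => eLpNorm (fun ω => V ω - partialDeriv W e (slotRestrictions S) ω f) 2 P)
      atTop (𝓝 0) := by
  have htail : Tendsto (fun S => ENNReal.ofReal (derivConst 1 n *
      ‖(∑ i ∈ S, lp.single 2 i (f i) : TensorPow ι n) - f‖)) atTop (𝓝 0) := by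
    simpa using ENNReal.tendsto_ofReal (((tendsto_iff_norm_sub_tendsto_zero.1
      (lp.hasSum_single ENNReal.ofNat_ne_top f)).const_mul (derivConst 1 n)))
  have hlim := hV.2.add htail
  rw [add_zero] at hlim
  refine tendsto_of_tendsto_of_tendsto_of_le_of_le tendsto_const_nhds hlim (fun _ => zero_le)
    fun S => ?_
  refine (eLpNorm_sub_le_add hV.1 (hW.aestronglyMeasurable_sum_basisDeriv e S f)
    (hW.aestronglyMeasurable_partialDeriv e _ f) one_le_two).trans (add_le_add_right ?_ _)
  simp only [← partialDeriv_slotRestrictions_sum_single, ← map_sub]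
  simpa using hW.eLpNorm_partialDeriv_le e (slotRestrictions S)
    ((∑ i ∈ S, lp.single 2 i (f i) : TensorPow ι n) - f) one_ne_zero

theorem IsChaosDeriv.ae_mem_contractionSpace (hW : IsIsonormal W P)
    (hV : IsChaosDeriv W P e f V) : ∀ᵐ ω ∂P, V ω ∈ contractionSpace e f := by
  classical
  obtain ⟨S, hS⟩ := exists_seq_tendsto_ae_of_tendsto_eLpNorm two_ne_zero hV.1
    (fun S => hW.aestronglyMeasurable_partialDeriv e (slotRestrictions S) f)
    (hV.tendsto_partialDeriv hW)
  filter_upwards [hS] with ω hω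
  exact (Submodule.isClosed_topologicalClosure _).mem_of_tendsto hω
    (Eventually.of_forall fun k => partialDeriv_mem_contractionSpace W e _ ω f)

end ChaosDeriv

/-! ### Derivative processes -/

theorem norm_sub_le_of_forall_lt {E : Type*} [NormedAddCommGroup E] {y : ℝ → E} {C κ : ℝ}
    (hκ : κ ≠ 0) (hy : ∀ s t, 0 ≤ s → s < t → t ≤ 1 → ‖y t - y s‖ ≤ C * |t - s| ^ κ) :
    ∀ s ∈ Icc (0 : ℝ) 1, ∀ t ∈ Icc (0 : ℝ) 1, ‖y t - y s‖ ≤ C * |t - s| ^ κ := by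
  intro s hs t ht
  rcases lt_trichotomy s t with hst | rfl | hts
  · exact hy s t hs.1 hst ht.2
  · simp [Real.zero_rpow hκ]
  · rw [norm_sub_rev, abs_sub_comm]
    exact hy t s ht.1 hts hs.2

theorem norm_le_of_holderOnWith {E : Type*} [NormedAddCommGroup E] {y : ℝ → E} {K r : ℝ≥0}
    (hy : HolderOnWith K r y (Icc 0 1)) {x : ℝ} (hx : x ∈ Icc (0 : ℝ) 1) : ‖y x‖ ≤ ‖y 0‖ + K := by
  refine (norm_le_norm_add_norm_sub' _ (y 0)).trans (add_le_add_right ?_ _)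
  refine (norm_sub_le_of_holderOnWith hy hx (left_mem_Icc.2 zero_le_one)).trans ?_
  rw [sub_zero, abs_of_nonneg hx.1]
  exact mul_le_of_le_one_right K.2 (Real.rpow_le_one hx.1 hx.2 r.2)

theorem ae_eqOn_of_forall_ae_eq {Ω T E : Type*} [MeasurableSpace Ω] {P : Measure Ω}
    [PseudoEMetricSpace T] [TopologicalSpace.SeparableSpace T] [TopologicalSpace E] [T2Space E]
    {s : Set T} {Y Z : T → Ω → E} (hYZ : ∀ t ∈ s, Y t =ᵐ[P] Z t)
    (hY : ∀ᵐ ω ∂P, ContinuousOn (fun t => Y t ω) s)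
    (hZ : ∀ᵐ ω ∂P, ContinuousOn (fun t => Z t ω) s) :
    ∀ᵐ ω ∂P, EqOn (fun t => Y t ω) (fun t => Z t ω) s := by
  obtain ⟨d, hds, hd, hsd⟩ :=
    (TopologicalSpace.IsSeparable.of_separableSpace s).exists_countable_dense_subset
  filter_upwards [hY, hZ, (ae_ball_iff hd).2 fun t ht => hYZ t (hds ht)] with ω hYω hZω hdω
  exact EqOn.of_subset_closure hdω hYω hZω hds hsd

theorem BlockForm.exists_isYoungIntegral_sqrt_mul_iSup_norm_le {ι H : Type*}
    [NormedAddCommGroup H] [InnerProductSpace ℝ H] [CompleteSpace H] {e : HilbertBasis ι ℝ H}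
    {n : ℕ} {f : ℝ → TensorPow ι n} {α : ℝ} (hblock : BlockForm e f α) {g : ℝ → ℝ} {Y : ℝ → H}
    (hY : ∀ s t : ℚ, 0 ≤ s → s ≤ t → t ≤ 1 → Y t - Y s ∈ incrementSpace e f s t)
    (hYc : ContinuousOn Y (Icc 0 1)) {K₁ K₂ τ ρ : ℝ≥0} (hg : HolderOnWith K₁ τ g (Icc 0 1))
    (hYρ : HolderOnWith K₂ ρ Y (Icc 0 1)) (hτρ : 1 < τ + ρ) :
    ∃ J : ℝ → H, (∀ t ∈ Icc (0 : ℝ) 1, IsYoungIntegral g Y 0 t (J t)) ∧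
      BddAbove (range fun t : Icc (0 : ℝ) 1 => ‖J t‖) ∧
      √α * (⨆ t : Icc (0 : ℝ) 1, ‖J t‖) ≤ ‖J 1‖ := by
  have hexists : ∀ t ∈ Icc (0 : ℝ) 1, ∃ J, IsYoungIntegral g Y 0 t J := fun t ht =>
    exists_isYoungIntegral ht.1 (hg.mono (Icc_subset_Icc_right ht.2))
      (hYρ.mono (Icc_subset_Icc_right ht.2)) hτρ
  choose! J hJ using hexists
  have hα : 0 < √α := Real.sqrt_pos.2 hblock.1
  have hle : ∀ t : Icc (0 : ℝ) 1, ‖J t‖ ≤ ‖J 1‖ / √α := fun t =>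
    (le_div_iff₀' hα).2 <| hblock.sqrt_mul_norm_youngIntegral_le hY hYc
      (fun x hx => norm_le_of_holderOnWith hg hx) t.2 (hJ t t.2)
      (hJ 1 (right_mem_Icc.2 zero_le_one))
  exact ⟨J, hJ, ⟨_, forall_mem_range.2 hle⟩, (le_div_iff₀' hα).1 (ciSup_le hle)⟩

section DerivativeVersion

variable {Ω ι H : Type*} [MeasurableSpace Ω] [NormedAddCommGroup H] [InnerProductSpace ℝ H]
  {W : H → Ω → ℝ} {P : Measure Ω} [IsProbabilityMeasure P] {n : ℕ}
  {e : HilbertBasis ι ℝ H}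

theorem IsMalliavinDeriv.isChaosDeriv [CompleteSpace H] (hW : IsIsonormal W P)
    {f : TensorPow ι n} {X : Ω → ℝ} {V : Ω → H} (hV : IsMalliavinDeriv W P X V)
    (hX : IsMultipleIntegral W P e f X) : IsChaosDeriv W P e f V := by
  obtain ⟨V', hV'⟩ := exists_isChaosDeriv hW e f
  exact hV'.congr_ae ((hV'.isMalliavinDeriv hW hX).ae_eq hW hV)

variable {f : ℝ → TensorPow ι n}

theorem hasHolderMoments_of_isChaosDeriv (hW : IsIsonormal W P) {C κ : ℝ} {V : ℝ → Ω → H}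
    (hV : ∀ t, IsChaosDeriv W P e (f t) (V t))
    (hf : ∀ s ∈ Icc (0 : ℝ) 1, ∀ t ∈ Icc (0 : ℝ) 1, ‖f t - f s‖ ≤ C * |t - s| ^ κ) :
    HasHolderMoments V P κ := by
  refine fun p => ⟨(derivConst (p + 1) n * C).toNNReal, fun s hs t ht => ?_⟩
  have hinc := (hV t).sub hW (hV s)
  calc eLpNorm (V t - V s) p P ≤ eLpNorm (V t - V s) (2 * (p + 1) : ℕ) P :=
        eLpNorm_le_eLpNorm_of_exponent_le (by exact_mod_cast (by lia : p ≤ 2 * (p + 1))) hinc.1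
    _ ≤ ENNReal.ofReal (derivConst (p + 1) n * ‖f t - f s‖) := hinc.eLpNorm_le hW p.succ_ne_zero
    _ ≤ ENNReal.ofReal (derivConst (p + 1) n * C * |t - s| ^ κ) := by
        rw [mul_assoc]
        gcongr
        exacts [derivConst_nonneg _ _, hf s hs t ht]
    _ ≤ _ := by
        gcongr
        exact Real.le_coe_toNNReal _

theorem exists_isChaosDeriv_holder [CompleteSpace H] (hW : IsIsonormal W P) {C κ : ℝ} (hκ : 0 < κ)
    (hf : ∀ s ∈ Icc (0 : ℝ) 1, ∀ t ∈ Icc (0 : ℝ) 1, ‖f t - f s‖ ≤ C * |t - s| ^ κ) :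
    ∃ U : ℝ → Ω → H, (∀ t ∈ Icc (0 : ℝ) 1, IsChaosDeriv W P e (f t) (U t)) ∧
      ∀ r : ℝ≥0, (r : ℝ) < κ →
        ∀ᵐ ω ∂P, ∃ K : ℝ≥0, HolderOnWith K r (fun t => U t ω) (Icc 0 1) := by
  choose V hV using fun t => exists_isChaosDeriv hW e (f t)
  obtain ⟨U, hUV, hU⟩ := (hasHolderMoments_of_isChaosDeriv hW hV hf).exists_holder_modification hκ
    fun t _ => (hV t).1
  exact ⟨U, fun t ht => (hV t).congr_ae (hUV t ht).symm, hU⟩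

theorem ae_forall_rat_sub_mem_incrementSpace (hW : IsIsonormal W P) {Y : ℝ → Ω → H}
    (hY : ∀ t ∈ Icc (0 : ℝ) 1, IsChaosDeriv W P e (f t) (Y t)) :
    ∀ᵐ ω ∂P, ∀ s t : ℚ, 0 ≤ s → s ≤ t → t ≤ 1 → Y t ω - Y s ω ∈ incrementSpace e f s t := by
  simp only [ae_all_iff]
  intro s t hs hst ht
  exact ((hY t ⟨by exact_mod_cast hs.trans hst, by exact_mod_cast ht⟩).sub hW
    (hY s ⟨by exact_mod_cast hs, by exact_mod_cast hst.trans ht⟩)).ae_mem_contractionSpace hW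

end DerivativeVersion

end ChaosProcess

theorem mainTheorem4_general
    {Ω : Type*} [MeasurableSpace Ω] {P : Measure Ω} [IsProbabilityMeasure P]
    {H : Type*} [NormedAddCommGroup H] [InnerProductSpace ℝ H] [CompleteSpace H]
    {W : H → Ω → ℝ} (hW : ChaosProcess.IsIsonormal W P)
    {ι : Type*} {e : HilbertBasis ι ℝ H} {n : ℕ} {f : ℝ → ChaosProcess.TensorPow ι n}
    {X : ℝ → Ω → ℝ}
    (hX : ∀ t ∈ Icc (0 : ℝ) 1, ChaosProcess.IsMultipleIntegral W P e (f t) (X t))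
    {C θ : ℝ}
    (hreg : ∀ s t, 0 ≤ s → s < t → t ≤ 1 → ‖f t - f s‖ ≤ C * |t - s| ^ (θ / 2))
    {α : ℝ} (hblock : ChaosProcess.BlockForm e f α)
    {ρ τ : ℝ≥0} (hρ : (ρ : ℝ) < θ / 2) (hτρ : 1 < τ + ρ)
    {g : ℝ → Ω → ℝ}
    (hg : ∀ᵐ ω ∂P, ∃ K : ℝ≥0, HolderOnWith K τ (fun t => g t ω) (Icc 0 1)) :
    (∃ DX : ℝ → Ω → H,
      (∀ t ∈ Icc (0 : ℝ) 1, ChaosProcess.IsMalliavinDeriv W P (X t) (DX t)) ∧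
      ∀ r : ℝ≥0, (r : ℝ) < θ / 2 →
        ∀ᵐ ω ∂P, ∃ K : ℝ≥0, HolderOnWith K r (fun t => DX t ω) (Icc 0 1)) ∧
    ∀ DX : ℝ → Ω → H,
      (∀ t ∈ Icc (0 : ℝ) 1, ChaosProcess.IsMalliavinDeriv W P (X t) (DX t)) →
      (∀ᵐ ω ∂P, ContinuousOn (fun t => DX t ω) (Icc 0 1)) →
      ∀ᵐ ω ∂P, ∃ J : ℝ → H,
        (∀ t ∈ Icc (0 : ℝ) 1,
          ChaosProcess.IsYoungIntegral (fun r => g r ω) (fun r => DX r ω) 0 t (J t)) ∧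
        BddAbove (range fun t : Icc (0 : ℝ) 1 => ‖J t‖) ∧
        √α * (⨆ t : Icc (0 : ℝ) 1, ‖J t‖) ≤ ‖J 1‖ := by
  have hθ : 0 < θ / 2 := ρ.2.trans_lt hρ
  obtain ⟨U, hUchaos, hUholder⟩ := ChaosProcess.exists_isChaosDeriv_holder (e := e) hW hθ
    (ChaosProcess.norm_sub_le_of_forall_lt hθ.ne' hreg)
  have hUderiv : ∀ t ∈ Icc (0 : ℝ) 1, ChaosProcess.IsMalliavinDeriv W P (X t) (U t) :=
    fun t ht => (hUchaos t ht).isMalliavinDeriv hW (hX t ht)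
  refine ⟨⟨U, hUderiv, hUholder⟩, fun DX hDX hDXcont => ?_⟩
  obtain ⟨r, hr, hrθ⟩ := exists_between (Real.toNNReal_pos.2 hθ)
  have hUcont : ∀ᵐ ω ∂P, ContinuousOn (fun t => U t ω) (Icc 0 1) := by
    filter_upwards [hUholder r (Real.lt_toNNReal_iff_coe_lt.1 hrθ)] with ω ⟨K, hK⟩
    exact hK.continuousOn hr
  have hinc := ChaosProcess.ae_forall_rat_sub_mem_incrementSpace hW
    fun t ht => (hDX t ht).isChaosDeriv hW (hX t ht)
  have hDXU := ChaosProcess.ae_eqOn_of_forall_ae_eq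
    (fun t ht => (hDX t ht).ae_eq hW (hUderiv t ht)) hDXcont hUcont
  filter_upwards [hg, hDXcont, hinc, hDXU, hUholder ρ hρ]
    with ω ⟨K₁, hgω⟩ hcontω hincω hDXUω ⟨K₂, hUω⟩
  have hDXholder : HolderOnWith K₂ ρ (fun t => DX t ω) (Icc 0 1) := fun x hx y hy => by
    simpa only [hDXUω hx, hDXUω hy] using hUω x hx y hy
  exact hblock.exists_isYoungIntegral_sqrt_mul_iSup_norm_le hincω hcontω hgω hDXholder hτρ

theorem mainTheorem4
    {Ω : Type*} [MeasurableSpace Ω] (P : Measure Ω) [IsProbabilityMeasure P]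
    {H : Type*} [NormedAddCommGroup H] [InnerProductSpace ℝ H] [CompleteSpace H]
    [TopologicalSpace.SeparableSpace H]
    (W : H → Ω → ℝ) (hW : ChaosProcess.IsIsonormal W P)
    {ι : Type*} (e : HilbertBasis ι ℝ H)
    (n : ℕ) (hn : 1 ≤ n)
    (f : ℝ → ChaosProcess.TensorPow ι n)
    (hf : ∀ t ∈ Icc (0 : ℝ) 1, ChaosProcess.IsSymmTensor (f t))
    (X : ℝ → Ω → ℝ)
    (hX : ∀ t ∈ Icc (0 : ℝ) 1, ChaosProcess.IsMultipleIntegral W P e (f t) (X t))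
    (hXcont : ∀ᵐ ω ∂P, ContinuousOn (fun t => X t ω) (Icc 0 1))
    (C θ : ℝ) (hreg : ChaosProcess.KernelRegularity f C θ)
    (α : ℝ) (hblock : ChaosProcess.BlockForm e f α)
    (ρ τ : ℝ≥0) (hρ : (ρ : ℝ) < θ / 2) (hτρ : 1 < τ + ρ)
    (g : ℝ → Ω → ℝ)
    (hg : ∀ᵐ ω ∂P, ∃ K : ℝ≥0, HolderOnWith K τ (fun t => g t ω) (Icc 0 1)) :
    (∃ DX : ℝ → Ω → H,
      (∀ t ∈ Icc (0 : ℝ) 1, ChaosProcess.IsMalliavinDeriv W P (X t) (DX t)) ∧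
      ∀ r : ℝ≥0, (r : ℝ) < θ / 2 →
        ∀ᵐ ω ∂P, ∃ K : ℝ≥0, HolderOnWith K r (fun t => DX t ω) (Icc 0 1)) ∧
    ∀ DX : ℝ → Ω → H,
      (∀ t ∈ Icc (0 : ℝ) 1, ChaosProcess.IsMalliavinDeriv W P (X t) (DX t)) →
      (∀ᵐ ω ∂P, ContinuousOn (fun t => DX t ω) (Icc 0 1)) →
      ∀ᵐ ω ∂P, ∃ J : ℝ → H,
        (∀ t ∈ Icc (0 : ℝ) 1,
          ChaosProcess.IsYoungIntegral (fun r => g r ω) (fun r => DX r ω) 0 t (J t)) ∧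
        BddAbove (range fun t : Icc (0 : ℝ) 1 => ‖J t‖) ∧
        Real.sqrt α * (⨆ t : Icc (0 : ℝ) 1, ‖J t‖) ≤ ‖J 1‖ :=
  mainTheorem4_general hW hX (fun s t hs hst ht => (hreg.2.2.2 s t hs hst ht).2) hblock hρ hτρ hg
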